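/- Setting. Let $G$ be a (second countable, Hausdorff) Lie groupoid with unit manifold $G^0$, range and source maps $r,s$, and left Haar system $\{\lambda^u\}_{u\in G^0}$, $\lambda^u$ living on $G^u=r^{-1}(u)$. Assume that $G^0$, with the action $g\cdot s(g)=r(g)$, is a proper $G$-space (the map $g\mapsto (r(g),s(g))$ is proper) and is $G$-compact (the orbit space $G^0/G$ is compact). Let $p:X\to G^0$ be a $G$-manifold which is a smooth fibre bundle over $G^0$ with compact fibre $Z$, and let $\tilde E\to X$ be a smooth $G$-equivariant complex vector bundle such that $(X,\tilde E)$ is, locally over $G^0$, a product with $(Z,E)$ for a fixed smooth complex vector bundle $E$ over $Z$. Let $\tilde E$ and the complexified bundle $TX$ of vectors tangent to the fibres $X^u=p^{-1}(u)$ carry $G$-isometric (continuous) hermitian metrics (conjugate linear in the first variable), and let $\mu^u$ be the volume measure on $X^u$ of the metric of $TX$, given locally by $|\det g_{ij}|^{1/2}dx$. Let $\mathfrak H$ be the Hilbert bundle over $G^0$ with fibres $\mathfrak H^u=L^2(X^u,\tilde E|_{X^u},\mu^u)$, topologized so that the sections $u\mapsto e^u=e|_{X^u}$, $e\in C_c(X,\tilde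 E)$, are continuous: its basic open sets are $\{\xi\in\mathfrak H^u: u\in V,\ \|\xi-e^u\|<\varepsilon\}$ with $V\subseteq G^0$ open, $e\in C_c(X,\tilde E)$, $\varepsilon>0$. The groupoid acts on $\mathfrak H$ by the unitaries $L_g:\mathfrak H^{s(g)}\to\mathfrak H^{r(g)}$, $(L_gf)(x)=g\,f(g^{-1}x)$. A morphism of $\mathfrak H$ is a continuous map $T:\mathfrak H\to\mathfrak H$, linear on fibres ($T^u:\mathfrak H^u\to\mathfrak H^u$), whose fibrewise adjoint is also continuous on $\mathfrak H$; it is bounded if $\|T\|=\sup_u\|T^u\|<\infty$, equivariant if $L_gT^{s(g)}L_{g^{-1}}=T^{r(g)}$ for all $g\in G$, and compact if for each compact $A\subseteq G^0$ the set $\{T^u\xi: u\in A,\ \xi\in\mathfrak H^u,\ \|\xi\|\le1\}$ has compact closure in $\mathfrak H$. Let $\mathbf K_G(\mathfrak H)$ be the set of equivariant compact bounded morphisms, with the norm $\|T\|$. Proposition 5.3. For $e_1,e_2\in C_c(X,\tilde E)$, $u\in G^0$ and $\xi\in\mathfrak H^u$ the integral $$T(e_1,e_2)^u\xi=\int_{G^u}\langle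 L_ge_2,\xi\rangle\,L_ge_1\,d\lambda^u(g)\in\mathfrak H^u$$ converges (the integrand is Bochner integrable), and $T(e_1,e_2)\in\mathbf K_G(\mathfrak H)$. Moreover the linear span of the operators $T(e_1,e_2)$, $e_1,e_2\in C_c(X,\tilde E)$, is contained in $\mathbf K_G(\mathfrak H)$ and is dense in it: for every $R\in\mathbf K_G(\mathfrak H)$ and $\varepsilon>0$ there is $S$ in this span with $\|R^u-S^u\|\le\varepsilon$ for all $u\in G^0$. -/

import Mathlib

open scoped Manifold ContDiff Topology
open Bundle MeasureTheory

noncomputable section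

namespace ProperLie

/-- The fibre `p⁻¹(u)` of a map, as a subspace of the domain. -/
abbrev Fib {A B : Type*} (p : A → B) (u : B) : Type _ := {a : A // p a = u}

/-! ## Lie groupoids

`G` is the manifold of arrows and `M` the manifold of units. Multiplication is a total function on
`G × G`, but only its values on composable pairs (`s a = r b`) are ever used. Smoothness of a map
that is only meaningful on the submanifold of composable pairs is smoothness on that subset of the
ambient manifold. -/

/-- A Lie groupoid `G` over the unit manifold `M`. -/
structure LieGroupoid (dG dM : ℕ) (G M : Type*)
    [TopologicalSpace G] [ChartedSpace (EuclideanSpace ℝ (Fin dG)) G]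
    [TopologicalSpace M] [ChartedSpace (EuclideanSpace ℝ (Fin dM)) M] where
  /-- range map -/
  r : G → M
  /-- source map -/
  s : G → M
  /-- inclusion of the units -/
  unit : M → G
  /-- multiplication `ab`, meaningful when `s a = r b` -/
  mul : G → G → G
  /-- inversion -/
  inv : G → G
  r_unit : ∀ u, r (unit u) = u
  s_unit : ∀ u, s (unit u) = u
  r_mul : ∀ a b, s a = r b → r (mul a b) = r a
  s_mul : ∀ a b, s a = r b → s (mul a b) = s b
  mul_assoc : ∀ a b c, s a = r b → s b = r c → mul (mul a b) c = mul a (mul b c)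
  unit_mul : ∀ a, mul (unit (r a)) a = a
  mul_unit : ∀ a, mul a (unit (s a)) = a
  r_inv : ∀ a, r (inv a) = s a
  s_inv : ∀ a, s (inv a) = r a
  inv_mul : ∀ a, mul (inv a) a = unit (s a)
  mul_inv : ∀ a, mul a (inv a) = unit (r a)
  smooth_r : ContMDiff (𝓡 dG) (𝓡 dM) ∞ r
  smooth_s : ContMDiff (𝓡 dG) (𝓡 dM) ∞ s
  submersion_r : ∀ a, Function.Surjective (mfderiv (𝓡 dG) (𝓡 dM) r a)
  submersion_s : ∀ a, Function.Surjective (mfderiv (𝓡 dG) (𝓡 dM) s a)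
  smooth_unit : ContMDiff (𝓡 dM) (𝓡 dG) ∞ unit
  smooth_inv : ContMDiff (𝓡 dG) (𝓡 dG) ∞ inv
  smooth_mul : ContMDiffOn ((𝓡 dG).prod (𝓡 dG)) (𝓡 dG) ∞
    (fun q : G × G => mul q.1 q.2) {q | s q.1 = r q.2}

section Groupoid

variable {dG dM : ℕ} {G M : Type*}
  [TopologicalSpace G] [ChartedSpace (EuclideanSpace ℝ (Fin dG)) G]
  [TopologicalSpace M] [ChartedSpace (EuclideanSpace ℝ (Fin dM)) M]

namespace LieGroupoid

variable (𝒢 : LieGroupoid dG dM G M)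

/-- The unit space, with the action `g · s(g) = r(g)`, is a proper `G`-space: the map
`g ↦ (g · s(g), s(g)) = (r(g), s(g))` is proper. -/
def UnitSpaceProper : Prop :=
  ∀ C : Set (M × M), IsCompact C → IsCompact {g : G | (𝒢.r g, 𝒢.s g) ∈ C}

/-- The orbit equivalence relation of the action of `G` on its unit space. -/
def orbitSetoid : Setoid M where
  r u v := ∃ g, 𝒢.s g = u ∧ 𝒢.r g = v
  iseqv :=
    { refl := fun u => ⟨𝒢.unit u, 𝒢.s_unit u, 𝒢.r_unit u⟩
      symm := fun ⟨g, h₁, h₂⟩ => ⟨𝒢.inv g, by rw [𝒢.s_inv, h₂], by rw [𝒢.r_inv, h₁]⟩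
      trans := fun ⟨g, h₁, h₂⟩ ⟨k, h₃, h₄⟩ =>
        ⟨𝒢.mul k g, by rw [𝒢.s_mul _ _ (h₃.trans h₂.symm), h₁],
          by rw [𝒢.r_mul _ _ (h₃.trans h₂.symm), h₄]⟩ }

/-- The unit space is `G`-compact: its orbit space is compact in the quotient topology. -/
def UnitSpaceGCompact : Prop := CompactSpace (Quotient 𝒢.orbitSetoid)

/-- A left Haar system: a family of regular Borel measures `λᵘ` on the fibres `Gᵘ = r⁻¹(u)`, of
full support, continuous and left invariant. (The compact support of `u ↦ ∫ f dλᵘ` is automatic,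
it lies in the image under `r` of the support of `f`.) -/
structure IsLeftHaarSystem [MeasurableSpace G] (lam : ∀ u : M, Measure (Fib 𝒢.r u)) : Prop where
  regular : ∀ u, (lam u).Regular
  full_support : ∀ u, (lam u).IsOpenPosMeasure
  continuous : ∀ f : G → ℂ, Continuous f → HasCompactSupport f →
    Continuous fun u => ∫ g : Fib 𝒢.r u, f g.1 ∂lam u
  left_invariant : ∀ (g : G) (f : G → ℂ), Continuous f → HasCompactSupport f →
    ∫ k : Fib 𝒢.r (𝒢.s g), f (𝒢.mul g k.1) ∂lam (𝒢.s g) =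
      ∫ k : Fib 𝒢.r (𝒢.r g), f k.1 ∂lam (𝒢.r g)

end LieGroupoid

/-! ## `G`-manifolds, fibred charts, metrics along the fibres and their volumes -/

/-- A `G`-manifold: a surjective submersion `p : X → M` with a smooth action of `G`. The action
`act g x` is meaningful when `s g = p x`. -/
structure GManifold (𝒢 : LieGroupoid dG dM G M) (dX : ℕ) (X : Type*)
    [TopologicalSpace X] [ChartedSpace (EuclideanSpace ℝ (Fin dX)) X] where
  p : X → M
  act : G → X → X
  surjective_p : Function.Surjective p
  smooth_p : ContMDiff (𝓡 dX) (𝓡 dM) ∞ p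
  submersion_p : ∀ x, Function.Surjective (mfderiv (𝓡 dX) (𝓡 dM) p x)
  p_act : ∀ g x, 𝒢.s g = p x → p (act g x) = 𝒢.r g
  act_act : ∀ h g x, 𝒢.s h = 𝒢.r g → 𝒢.s g = p x → act h (act g x) = act (𝒢.mul h g) x
  inv_act : ∀ g x, 𝒢.s g = p x → act (𝒢.inv g) (act g x) = x
  smooth_act : ContMDiffOn ((𝓡 dG).prod (𝓡 dX)) (𝓡 dX) ∞
    (fun q : G × X => act q.1 q.2) {q | 𝒢.s q.1 = p q.2}

/-- A fibred chart of a map `p : X → M`: a diffeomorphism `x ↦ (p x, y(x))` of an open subset of `X`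
onto an open subset of `M × ℝʲ`. -/
structure FibredChart (dM dX j : ℕ) {X M : Type*}
    [TopologicalSpace M] [ChartedSpace (EuclideanSpace ℝ (Fin dM)) M]
    [TopologicalSpace X] [ChartedSpace (EuclideanSpace ℝ (Fin dX)) X] (p : X → M) where
  toHomeo : OpenPartialHomeomorph X (M × EuclideanSpace ℝ (Fin j))
  smooth : ContMDiffOn (𝓡 dX) ((𝓡 dM).prod (𝓡 j)) ∞ toHomeo toHomeo.source
  smooth_symm : ContMDiffOn ((𝓡 dM).prod (𝓡 j)) (𝓡 dX) ∞ toHomeo.symm toHomeo.target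
  fst_eq : ∀ x ∈ toHomeo.source, (toHomeo x).1 = p x

section Metric

variable {dX j : ℕ} {X : Type*}
  [TopologicalSpace X] [ChartedSpace (EuclideanSpace ℝ (Fin dX)) X]

/-- The coordinate vector `∂ᵢ` along the fibre, at the point of `X` with coordinates `(u, y)`. -/
def FibredChart.coordVec {p : X → M} (ψ : FibredChart dM dX j p)
    (q : M × EuclideanSpace ℝ (Fin j)) (i : Fin j) :
    TangentSpace (𝓡 dX) (ψ.toHomeo.symm q) :=
  mfderiv (𝓡 j) (𝓡 dX) (fun y => ψ.toHomeo.symm (q.1, y)) q.2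
    (EuclideanSpace.single i (1 : ℝ) : EuclideanSpace ℝ (Fin j))

/-- Complex valued real-bilinear forms on the tangent spaces of `X`. -/
abbrev TangentForm (dX : ℕ) (X : Type*)
    [TopologicalSpace X] [ChartedSpace (EuclideanSpace ℝ (Fin dX)) X] : Type _ :=
  ∀ x : X, TangentSpace (𝓡 dX) x →ₗ[ℝ] TangentSpace (𝓡 dX) x →ₗ[ℝ] ℂ

/-- The matrix `g_{ik}` of a form in the coordinates of a fibred chart. -/
def FibredChart.gram {p : X → M} (ψ : FibredChart dM dX j p) (h : TangentForm dX X)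
    (q : M × EuclideanSpace ℝ (Fin j)) : Matrix (Fin j) (Fin j) ℂ :=
  Matrix.of fun i k => h (ψ.toHomeo.symm q) (ψ.coordVec q i) (ψ.coordVec q k)

/-- A (continuous) hermitian metric on the complexification of the bundle of vectors tangent to the
fibres of `p`, i.e. of the kernel of `dp`. It is given by its values on pairs of real vertical
vectors; only these values matter. Its sesquilinear extension (conjugate linear in the first
variable) satisfies
`⟨v + iw, v + iw⟩ = h(v,v) + h(w,w) + i h(v,w) - i h(w,v)`. -/
structure IsVerticalHermitianMetric (dM : ℕ) (j : ℕ) {M : Type*} [TopologicalSpace M]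
    [ChartedSpace (EuclideanSpace ℝ (Fin dM)) M] (p : X → M) (h : TangentForm dX X) : Prop where
  symm : ∀ x (v w : TangentSpace (𝓡 dX) x), mfderiv (𝓡 dX) (𝓡 dM) p x v = 0 →
    mfderiv (𝓡 dX) (𝓡 dM) p x w = 0 → h x w v = starRingEnd ℂ (h x v w)
  pos : ∀ x (v w : TangentSpace (𝓡 dX) x), mfderiv (𝓡 dX) (𝓡 dM) p x v = 0 →
    mfderiv (𝓡 dX) (𝓡 dM) p x w = 0 → (v ≠ 0 ∨ w ≠ 0) →
    0 < (h x v v + h x w w + Complex.I * h x v w - Complex.I * h x w v).re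
  continuous : ∀ (ψ : FibredChart dM dX j p) (i k : Fin j),
    ContinuousOn (fun q => ψ.gram h q i k) ψ.toHomeo.target

/-- The metric is `G`-isometric: for every `g` the differential of
`l_g : X^{s(g)} → X^{r(g)}`, `x ↦ gx`, preserves it. -/
def IsGIsometricForm {𝒢 : LieGroupoid dG dM G M} (𝒳 : GManifold 𝒢 dX X)
    (h : TangentForm dX X) : Prop :=
  ∀ g x, 𝒢.s g = 𝒳.p x → ∀ v w : TangentSpace (𝓡 dX) x,
    mfderiv (𝓡 dX) (𝓡 dM) 𝒳.p x v = 0 → mfderiv (𝓡 dX) (𝓡 dM) 𝒳.p x w = 0 →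
    h (𝒳.act g x)
      (mfderivWithin (𝓡 dX) (𝓡 dX) (𝒳.act g) (𝒳.p ⁻¹' {𝒢.s g}) x v)
      (mfderivWithin (𝓡 dX) (𝓡 dX) (𝒳.act g) (𝒳.p ⁻¹' {𝒢.s g}) x w) = h x v w

/-- `μ` is the family of volume measures of the metric `h` on the fibres `Xᵘ`: in local coordinates
`dμᵘ = |det g_{ik}|^{1/2} dy`. (The measures are finite because the fibres will be compact.) -/
structure IsFibreVolume (dM : ℕ) (j : ℕ) {M : Type*} [TopologicalSpace M]
    [ChartedSpace (EuclideanSpace ℝ (Fin dM)) M] [MeasurableSpace X]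
    (p : X → M) (h : TangentForm dX X) (μ : ∀ u : M, Measure (Fib p u)) : Prop where
  finite : ∀ u, IsFiniteMeasure (μ u)
  apply_eq : ∀ (u : M) (ψ : FibredChart dM dX j p) (A : Set (Fib p u)), MeasurableSet A →
    (∀ a ∈ A, a.1 ∈ ψ.toHomeo.source) →
    μ u A = ∫⁻ y in {y : EuclideanSpace ℝ (Fin j) | (u, y) ∈ ψ.toHomeo.target ∧
        ∃ a ∈ A, a.1 = ψ.toHomeo.symm (u, y)},
      ENNReal.ofReal (Real.sqrt ‖(ψ.gram h (u, y)).det‖)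

end Metric

end Groupoid

/-! ## Families of compact manifolds with an equivariant hermitian vector bundle -/

/-- The standing geometric data over a Lie groupoid `G` with unit space `M`:
* a `G`-manifold `p : X → M` which is a smooth fibre bundle with compact fibre `Z`;
* a smooth `G`-equivariant complex vector bundle `E` over `X` (smooth over `X`, and locally over `M`
  isomorphic to the product with a fixed smooth vector bundle `E₀` over `Z`);
* a `G`-isometric hermitian metric on `E` (the given inner products on the fibres `E x`, which are
  conjugate linear in the first variable);
* a `G`-isometric hermitian metric `h` on the complexified bundle of vectors tangent to the fibres
  of `p`, and the associated volume measures `μᵘ` on the fibres `Xᵘ`. -/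
structure GFamily {dG dM : ℕ} {G M : Type*}
    [TopologicalSpace G] [ChartedSpace (EuclideanSpace ℝ (Fin dG)) G]
    [TopologicalSpace M] [ChartedSpace (EuclideanSpace ℝ (Fin dM)) M]
    (𝒢 : LieGroupoid dG dM G M)
    (dX j : ℕ) (X Z : Type*)
    [TopologicalSpace X] [ChartedSpace (EuclideanSpace ℝ (Fin dX)) X] [MeasurableSpace X]
    [TopologicalSpace Z] [ChartedSpace (EuclideanSpace ℝ (Fin j)) Z]
    (F : Type*) [NormedAddCommGroup F] [NormedSpace ℂ F]
    (E : X → Type*) [TopologicalSpace (TotalSpace F E)] [∀ x, NormedAddCommGroup (E x)]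
    [∀ x, InnerProductSpace ℂ (E x)] [FiberBundle F E]
    (E₀ : Z → Type*) [TopologicalSpace (TotalSpace F E₀)] [∀ z, TopologicalSpace (E₀ z)]
    [∀ z, AddCommGroup (E₀ z)] [∀ z, Module ℂ (E₀ z)] [FiberBundle F E₀]
    extends GManifold 𝒢 dX X where
  /-- Local triviality over `M` of `(X, E)` with model `(Z, E₀)`. -/
  locally_trivial : ∀ u₀ : M, ∃ (U : Set M) (φ : OpenPartialHomeomorph X (M × Z))
    (Φ : ∀ x : X, E x →ₗ[ℂ] E₀ (φ x).2),
    IsOpen U ∧ u₀ ∈ U ∧ φ.source = p ⁻¹' U ∧ φ.target = U ×ˢ Set.univ ∧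
    (∀ x ∈ φ.source, (φ x).1 = p x) ∧
    ContMDiffOn (𝓡 dX) ((𝓡 dM).prod (𝓡 j)) ∞ φ φ.source ∧
    ContMDiffOn ((𝓡 dM).prod (𝓡 j)) (𝓡 dX) ∞ φ.symm φ.target ∧
    (∀ x ∈ φ.source, Function.Bijective (Φ x)) ∧
    ContMDiffOn ((𝓡 dX).prod 𝓘(ℝ, F)) ((𝓡 j).prod 𝓘(ℝ, F)) ∞
      (fun v : TotalSpace F E => (⟨(φ v.proj).2, Φ v.proj v.2⟩ : TotalSpace F E₀))
      {v | v.proj ∈ φ.source}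
  /-- The action `E_x → E_{gx}` of `g`, meaningful when `s g = p x`. -/
  lift : ∀ (g : G) (x : X), E x →ₗ[ℂ] E (act g x)
  lift_lift : ∀ h g x (v : E x), 𝒢.s h = 𝒢.r g → 𝒢.s g = p x →
    (⟨_, lift h _ (lift g x v)⟩ : TotalSpace F E) = ⟨_, lift (𝒢.mul h g) x v⟩
  inv_lift : ∀ g x (v : E x), 𝒢.s g = p x →
    (⟨_, lift (𝒢.inv g) _ (lift g x v)⟩ : TotalSpace F E) = ⟨x, v⟩
  smooth_lift : ContMDiffOn ((𝓡 dG).prod ((𝓡 dX).prod 𝓘(ℝ, F))) ((𝓡 dX).prod 𝓘(ℝ, F)) ∞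
    (fun q : G × TotalSpace F E => (⟨_, lift q.1 q.2.proj q.2.2⟩ : TotalSpace F E))
    {q | 𝒢.s q.1 = p q.2.proj}
  /-- The hermitian metric of `E` is continuous (by polarization, it suffices to say so for the
  associated quadratic form on the total space). -/
  metric_continuous : Continuous fun v : TotalSpace F E => ‖v.2‖ ^ 2
  lift_isometric : ∀ g x (v w : E x), 𝒢.s g = p x →
    inner ℂ (lift g x v) (lift g x w) = inner ℂ v w
  /-- The metric along the fibres of `p`. -/
  h : TangentForm dX X
  h_metric : IsVerticalHermitianMetric dM j p h
  h_isometric : IsGIsometricForm toGManifold h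
  /-- The volume measures on the fibres of `p`. -/
  μ : ∀ u : M, Measure (Fib p u)
  μ_volume : IsFibreVolume dM j p h μ

section Family

set_option linter.unusedSectionVars false

variable {dG dM : ℕ} {G M : Type*}
    [TopologicalSpace G] [ChartedSpace (EuclideanSpace ℝ (Fin dG)) G]
    [TopologicalSpace M] [ChartedSpace (EuclideanSpace ℝ (Fin dM)) M]
    {𝒢 : LieGroupoid dG dM G M}
    {dX j : ℕ} {X Z : Type*}
    [TopologicalSpace X] [ChartedSpace (EuclideanSpace ℝ (Fin dX)) X]
    [MeasurableSpace X] [BorelSpace X]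
    [TopologicalSpace Z] [ChartedSpace (EuclideanSpace ℝ (Fin j)) Z] [CompactSpace Z]
    {F : Type*} [NormedAddCommGroup F] [NormedSpace ℂ F]
    {E : X → Type*} [TopologicalSpace (TotalSpace F E)] [∀ x, NormedAddCommGroup (E x)]
    [∀ x, InnerProductSpace ℂ (E x)] [FiberBundle F E] [VectorBundle ℂ F E]
    {E₀ : Z → Type*} [TopologicalSpace (TotalSpace F E₀)] [∀ z, TopologicalSpace (E₀ z)]
    [∀ z, AddCommGroup (E₀ z)] [∀ z, Module ℂ (E₀ z)] [FiberBundle F E₀]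

/-! ### Continuous sections -/

/-- A section of `E` along a map `b : A → X` is continuous if it is so as a map to the total
space. Sums of such sections are continuous. -/
theorem continuous_add_section {A : Type*} [TopologicalSpace A] {b : A → X}
    {f g : ∀ a, E (b a)}
    (hf : Continuous fun a => (⟨b a, f a⟩ : TotalSpace F E))
    (hg : Continuous fun a => (⟨b a, g a⟩ : TotalSpace F E)) :
    Continuous fun a => (⟨b a, f a + g a⟩ : TotalSpace F E) := by
  rw [continuous_iff_continuousAt] at *
  intro a
  have h1 := (FiberBundle.continuousAt_totalSpace F _).1 (hf a)
  have h2 := (FiberBundle.continuousAt_totalSpace F _).1 (hg a)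
  refine (FiberBundle.continuousAt_totalSpace F _).2 ⟨h1.1, ?_⟩
  refine (h1.2.add h2.2).congr ?_
  have hb : ∀ᶠ c in 𝓝 a, b c ∈ (trivializationAt F E (b a)).baseSet :=
    h1.1.eventually ((trivializationAt F E (b a)).open_baseSet.mem_nhds
      (FiberBundle.mem_baseSet_trivializationAt F E (b a)))
  filter_upwards [hb] with c hc
  exact (((trivializationAt F E (b a)).linear ℂ hc).map_add (f c) (g c)).symm

theorem continuous_smul_section {A : Type*} [TopologicalSpace A] {b : A → X}
    {f : ∀ a, E (b a)} (c : ℂ)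
    (hf : Continuous fun a => (⟨b a, f a⟩ : TotalSpace F E)) :
    Continuous fun a => (⟨b a, c • f a⟩ : TotalSpace F E) := by
  rw [continuous_iff_continuousAt] at *
  intro a
  have h1 := (FiberBundle.continuousAt_totalSpace F _).1 (hf a)
  refine (FiberBundle.continuousAt_totalSpace F _).2 ⟨h1.1, ?_⟩
  refine (h1.2.const_smul c).congr ?_
  have hb : ∀ᶠ d in 𝓝 a, b d ∈ (trivializationAt F E (b a)).baseSet :=
    h1.1.eventually ((trivializationAt F E (b a)).open_baseSet.mem_nhds
      (FiberBundle.mem_baseSet_trivializationAt F E (b a)))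
  filter_upwards [hb] with d hd
  exact (((trivializationAt F E (b a)).linear ℂ hd).map_smul c (f d)).symm

theorem continuous_zero_section {A : Type*} [TopologicalSpace A] {b : A → X} (hb : Continuous b) :
    Continuous fun a => (⟨b a, 0⟩ : TotalSpace F E) := by
  rw [continuous_iff_continuousAt]
  intro a
  refine (FiberBundle.continuousAt_totalSpace F _).2 ⟨hb.continuousAt, ?_⟩
  refine (continuousAt_const (y := (0 : F))).congr ?_
  have hb : ∀ᶠ d in 𝓝 a, b d ∈ (trivializationAt F E (b a)).baseSet :=
    hb.continuousAt.eventually ((trivializationAt F E (b a)).open_baseSet.mem_nhds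
      (FiberBundle.mem_baseSet_trivializationAt F E (b a)))
  filter_upwards [hb] with d hd
  exact (((trivializationAt F E (b a)).linear ℂ hd).map_zero).symm

variable (F E) in
/-- `C_c(X, E)`: continuous sections of `E` with compact support. -/
structure CcSection where
  toFun : ∀ x, E x
  continuous : Continuous fun x => (⟨x, toFun x⟩ : TotalSpace F E)
  compact_support : IsCompact (closure {x | toFun x ≠ 0})

namespace GFamily

variable (D : GFamily 𝒢 dX j X Z F E E₀)

/-- `C(Xᵘ, E|Xᵘ)`: continuous sections of `E` over the fibre `Xᵘ`. -/
def contSections (u : M) : Submodule ℂ (∀ x : Fib D.p u, E x.1) where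
  carrier := {f | Continuous fun x : Fib D.p u => (⟨x.1, f x⟩ : TotalSpace F E)}
  add_mem' := fun hf hg => continuous_add_section hf hg
  zero_mem' := continuous_zero_section continuous_subtype_val
  smul_mem' := fun c _ hf => continuous_smul_section c hf

/-- The fibres `Xᵘ` are compact, being homeomorphic to `Z`. -/
theorem compactSpace_fib (u : M) : CompactSpace (Fib D.p u) := by
  obtain ⟨U, φ, -, -, hu, hs, ht, hφ, -⟩ := D.locally_trivial u
  have hK : IsCompact (D.p ⁻¹' {u}) := by
    have h1 : IsCompact (({u} : Set M) ×ˢ (Set.univ : Set Z)) := isCompact_singleton.prod isCompact_univ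
    have h2 : ({u} : Set M) ×ˢ (Set.univ : Set Z) ⊆ φ.target := by
      rw [ht]; exact Set.prod_mono (by simpa using hu) le_rfl
    have h3 := h1.image_of_continuousOn (φ.continuousOn_symm.mono h2)
    convert h3 using 1
    ext x
    simp only [Set.mem_preimage, Set.mem_singleton_iff, Set.mem_image]
    constructor
    · intro hx
      have hxs : x ∈ φ.source := by rw [hs]; simpa [hx] using hu
      refine ⟨φ x, ⟨by simp [hφ x hxs, hx], trivial⟩, φ.left_inv hxs⟩
    · rintro ⟨q, hq, rfl⟩
      have := φ.map_target (h2 hq)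
      rw [← hφ _ this, φ.right_inv (h2 hq)]
      exact hq.1
  exact isCompact_iff_compactSpace.1 hK

theorem continuous_inner {u : M} (f g : D.contSections u) :
    Continuous fun x : Fib D.p u => (inner ℂ (f.1 x) (g.1 x) : ℂ) := by
  have key : ∀ k : D.contSections u, Continuous fun x : Fib D.p u => ((‖k.1 x‖ ^ 2 : ℝ) : ℂ) :=
    fun k => Complex.continuous_ofReal.comp (D.metric_continuous.comp k.2)
  have h1 := key (f + g)
  have h2 := key (f - g)
  have h3 := key (f - Complex.I • g)
  have h4 := key (f + Complex.I • g)
  have := (((h1.sub h2).add ((h3.sub h4).mul (continuous_const (y := Complex.I)))).div_const 4)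
  refine this.congr fun x => ?_
  rw [inner_eq_sum_norm_sq_div_four (𝕜 := ℂ) (f.1 x) (g.1 x)]
  simp

theorem integrable_inner {u : M} (f g : D.contSections u) :
    Integrable (fun x : Fib D.p u => (inner ℂ (f.1 x) (g.1 x) : ℂ)) (D.μ u) := by
  have := D.compactSpace_fib u
  have := D.μ_volume.finite u
  exact (D.continuous_inner f g).integrable_of_hasCompactSupport (HasCompactSupport.of_compactSpace _)

/-- The `L²` inner product `⟨f, g⟩ = ∫ ⟨f(x), g(x)⟩ dμᵘ(x)` on continuous sections over `Xᵘ`. -/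
@[reducible]
def l2Core (u : M) : PreInnerProductSpace.Core ℂ (D.contSections u) where
  inner f g := ∫ x : Fib D.p u, inner ℂ (f.1 x) (g.1 x) ∂D.μ u
  conj_inner_symm f g := by
    rw [← integral_conj]
    exact integral_congr_ae (.of_forall fun x => inner_conj_symm _ _)
  re_inner_nonneg f := by
    have h : ∀ x : Fib D.p u, (inner ℂ (f.1 x) (f.1 x) : ℂ) = ((‖f.1 x‖ ^ 2 : ℝ) : ℂ) :=
      fun x => by simp [inner_self_eq_norm_sq_to_K]
    simp only [h]
    rw [integral_complex_ofReal]
    simpa using integral_nonneg (fun x => sq_nonneg ‖f.1 x‖)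
  add_left f g k := by
    rw [← integral_add (D.integrable_inner f k) (D.integrable_inner g k)]
    exact integral_congr_ae (.of_forall fun x => inner_add_left _ _ _)
  smul_left f g c := by
    rw [← integral_const_mul]
    exact integral_congr_ae (.of_forall fun x => inner_smul_left _ _ _)

/-- The space of continuous sections over `Xᵘ`, with its `L²` inner product and seminorm. -/
def PreL2 (u : M) : Type _ := D.contSections u

instance (u : M) : AddCommGroup (D.PreL2 u) := inferInstanceAs (AddCommGroup (D.contSections u))

instance (u : M) : Module ℂ (D.PreL2 u) := inferInstanceAs (Module ℂ (D.contSections u))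

/-- The `L²` inner product, on the type `PreL2`. -/
@[reducible]
def preL2Core (u : M) : PreInnerProductSpace.Core ℂ (D.PreL2 u) := D.l2Core u

instance (u : M) : SeminormedAddCommGroup (D.PreL2 u) :=
  @InnerProductSpace.Core.toSeminormedAddCommGroup ℂ (D.PreL2 u) _ _ _ (D.preL2Core u)

instance (u : M) : InnerProductSpace ℂ (D.PreL2 u) := InnerProductSpace.ofCore (D.preL2Core u)

/-- The Hilbert space `𝔥ᵘ = L²(Xᵘ, E|Xᵘ, μᵘ)`: the completion of the continuous sections over the
compact fibre `Xᵘ` in the `L²` norm of the finite Borel measure `μᵘ`. -/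
abbrev H (u : M) : Type _ := UniformSpace.Completion (D.PreL2 u)

/-- The class in `L²(Xᵘ, E|Xᵘ, μᵘ)` of the restriction to `Xᵘ` of a section of `E`. -/
def restrict (e : CcSection F E) (u : M) : D.PreL2 u :=
  ⟨fun x => e.toFun x.1, e.continuous.comp continuous_subtype_val⟩

/-! ### The Hilbert bundle -/

/-- The total space of the Hilbert bundle `𝔥` over `M`. -/
def HTotal : Type _ := Σ u : M, D.H u

/-- The topology of the Hilbert bundle `𝔥`: the basic open sets are the tubes
`{ξ ∈ 𝔥ᵘ : u ∈ V, ‖ξ - eᵘ‖ < ε}`, for `V ⊆ M` open, `e ∈ C_c(X, E)` and `ε > 0`. This is the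
unique Hilbert bundle topology for which the sections `u ↦ eᵘ`, `e ∈ C_c(X, E)`, are continuous. -/
instance : TopologicalSpace D.HTotal :=
  TopologicalSpace.generateFrom
    {W | ∃ (V : Set M) (e : CcSection F E) (ε : ℝ), IsOpen V ∧ 0 < ε ∧
      W = {ξ : D.HTotal | ξ.1 ∈ V ∧ ‖ξ.2 - (D.restrict e ξ.1 : D.H ξ.1)‖ < ε}}

/-! ### The action of `G` on sections -/

theorem act_inv_act (g : G) (x : X) (hx : D.p x = 𝒢.r g) :
    D.act g (D.act (𝒢.inv g) x) = x := by
  have h1 : 𝒢.s (𝒢.inv g) = D.p x := by rw [𝒢.s_inv, hx]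
  have h2 := D.inv_act (𝒢.inv g) x h1
  have h3 : 𝒢.inv (𝒢.inv g) = g := by
    have e1 := 𝒢.mul_inv (𝒢.inv g)
    have e2 : 𝒢.mul g (𝒢.mul (𝒢.inv g) (𝒢.inv (𝒢.inv g))) = g := by
      rw [e1, 𝒢.r_inv, 𝒢.mul_unit]
    rw [← 𝒢.mul_assoc _ _ _ (𝒢.r_inv g).symm (𝒢.r_inv _).symm, 𝒢.mul_inv] at e2
    have e3 := 𝒢.unit_mul (𝒢.inv (𝒢.inv g))
    rw [𝒢.r_inv, 𝒢.s_inv, e2] at e3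
    exact e3.symm
  rwa [h3] at h2

/-- `g⁻¹x`, as a map `Xᵛ → Xᵘ` for `g` with source `u` and range `v`. -/
def pull (g : G) {u v : M} (hu : 𝒢.s g = u) (hv : 𝒢.r g = v) (x : Fib D.p v) : Fib D.p u :=
  ⟨D.act (𝒢.inv g) x.1, by
    rw [D.p_act _ _ (by rw [𝒢.s_inv, hv, x.2]), 𝒢.r_inv, hu]⟩

/-- The section `(L_g f)(x) = g (f (g⁻¹ x))` over `Xᵛ`, for a section `f` over `Xᵘ` and `g` with
source `u` and range `v`. -/
def translateFun (g : G) {u v : M} (hu : 𝒢.s g = u) (hv : 𝒢.r g = v)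
    (f : ∀ x : Fib D.p u, E x.1) (x : Fib D.p v) : E x.1 :=
  D.act_inv_act g x.1 (x.2.trans hv.symm) ▸
    D.lift g (D.act (𝒢.inv g) x.1) (f (D.pull g hu hv x))

theorem translateFun_total (g : G) {u v : M} (hu : 𝒢.s g = u) (hv : 𝒢.r g = v)
    (f : ∀ x : Fib D.p u, E x.1) (x : Fib D.p v) :
    (⟨x.1, D.translateFun g hu hv f x⟩ : TotalSpace F E) =
      ⟨_, D.lift g (D.pull g hu hv x).1 (f (D.pull g hu hv x))⟩ := by
  have aux : ∀ (x y : X) (h : y = x) (w : E y), (⟨x, h ▸ w⟩ : TotalSpace F E) = ⟨y, w⟩ := by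
    rintro x y rfl w; rfl
  exact aux _ _ _ _

/-- `L_g` on continuous sections. -/
def translate (g : G) {u v : M} (hu : 𝒢.s g = u) (hv : 𝒢.r g = v) (f : D.PreL2 u) : D.PreL2 v :=
  ⟨D.translateFun g hu hv f.1, by
    change Continuous _
    simp only [translateFun_total]
    have c1 : Continuous (D.pull g hu hv) := by
      refine Continuous.subtype_mk ?_ _
      have := D.smooth_act.continuousOn.comp_continuous
        (f := fun x : Fib D.p v => (𝒢.inv g, x.1)) (by fun_prop)
        (fun x => by change 𝒢.s (𝒢.inv g) = D.p x.1; rw [𝒢.s_inv, hv, x.2])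
      exact this
    have c2 : Continuous fun x : Fib D.p v =>
        (⟨(D.pull g hu hv x).1, f.1 (D.pull g hu hv x)⟩ : TotalSpace F E) := f.2.comp c1
    exact D.smooth_lift.continuousOn.comp_continuous
      (f := fun x : Fib D.p v =>
        (g, (⟨(D.pull g hu hv x).1, f.1 (D.pull g hu hv x)⟩ : TotalSpace F E)))
      (continuous_const.prodMk c2) (fun x => hu.trans (D.pull g hu hv x).2.symm)⟩

/-- The unitary operator `L_g : 𝔥ᵘ → 𝔥ᵛ`, for `g` with source `u` and range `v`: the extension by
continuity of `L_g` on continuous sections, which is isometric for the `L²` norms. -/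
def L (g : G) {u v : M} (hu : 𝒢.s g = u) (hv : 𝒢.r g = v) : D.H u → D.H v :=
  UniformSpace.Completion.map (D.translate g hu hv)

/-! ### Morphisms of the Hilbert bundle -/

/-- A family of fibrewise maps `𝔥ᵘ → 𝔥ᵘ`, regarded as a map `𝔥 → 𝔥`. -/
def toTotal (T : ∀ u, D.H u → D.H u) (ξ : D.HTotal) : D.HTotal := ⟨ξ.1, T ξ.1 ξ.2⟩

/-- A morphism of `𝔥`: a continuous map `𝔥 → 𝔥` which is linear on each fibre and such that the
fibrewise adjoint is also continuous on `𝔥`. -/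
structure IsMorphism (T : ∀ u, D.H u → D.H u) : Prop where
  linear : ∀ u, IsLinearMap ℂ (T u)
  continuous : Continuous (D.toTotal T)
  adjoint : ∃ T' : ∀ u, D.H u → D.H u,
    (∀ u (ξ η : D.H u), inner ℂ (T' u ξ) η = inner ℂ ξ (T u η)) ∧ Continuous (D.toTotal T')

/-- Boundedness: `sup_u ‖Tᵘ‖ < ∞`. -/
def IsBounded (T : ∀ u, D.H u → D.H u) : Prop :=
  ∃ C : ℝ, ∀ u (ξ : D.H u), ‖T u ξ‖ ≤ C * ‖ξ‖

/-- Equivariance: `L_g T^{s(g)} L_{g⁻¹} = T^{r(g)}` for all `g`. -/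
def IsEquivariant (T : ∀ u, D.H u → D.H u) : Prop :=
  ∀ (g : G) (ξ : D.H (𝒢.r g)),
    D.L g rfl rfl (T (𝒢.s g) (D.L (𝒢.inv g) (𝒢.s_inv g) (𝒢.r_inv g) ξ)) = T (𝒢.r g) ξ

/-- Compactness: for every compact `A ⊆ M` the set `{Tᵘ ξ : u ∈ A, ξ ∈ 𝔥ᵘ, ‖ξ‖ ≤ 1}` has compact
closure in `𝔥`. -/
def IsCompactFamily (T : ∀ u, D.H u → D.H u) : Prop :=
  ∀ A : Set M, IsCompact A →
    IsCompact (closure {ζ : D.HTotal | ∃ u ∈ A, ∃ ξ : D.H u, ‖ξ‖ ≤ 1 ∧ ζ = ⟨u, T u ξ⟩})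

/-- `K_G(𝔥)`: the equivariant compact (bounded) morphisms of `𝔥`. -/
def KG : Set (∀ u, D.H u → D.H u) :=
  {T | D.IsMorphism T ∧ D.IsBounded T ∧ D.IsCompactFamily T ∧ D.IsEquivariant T}

/-! ### The averaged operators -/

/-- For `g ∈ Gᵘ`, the element `L_g e` of `𝔥ᵘ` (the image under `L_g` of the restriction of `e` to
`X^{s(g)}`). -/
def Lsec (e : CcSection F E) {u : M} (g : Fib 𝒢.r u) : D.H u :=
  (D.translate g.1 rfl g.2 (D.restrict e (𝒢.s g.1)) : D.H u)

/-- The integrand `⟨L_g e₂, ξ⟩ L_g e₁`, for `g ∈ Gᵘ` and `ξ ∈ 𝔥ᵘ`. -/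
def avgIntegrand (e₁ e₂ : CcSection F E) (u : M) (ξ : D.H u) (g : Fib 𝒢.r u) : D.H u :=
  (inner ℂ (D.Lsec e₂ g) ξ : ℂ) • D.Lsec e₁ g

/-- The averaged operators `T(e₁, e₂)ᵘ ξ = ∫_{Gᵘ} ⟨L_g e₂, ξ⟩ L_g e₁ dλᵘ(g)`. -/
def avgOp [MeasurableSpace G] (lam : ∀ u : M, Measure (Fib 𝒢.r u)) (e₁ e₂ : CcSection F E) :
    ∀ u, D.H u → D.H u :=
  fun u ξ => ∫ g : Fib 𝒢.r u, D.avgIntegrand e₁ e₂ u ξ g ∂lam u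

end GFamily

end Family

end ProperLie

end

open ProperLie

namespace ProperLie

open Filter Set

/-! ## Finite partitions of unity on compact sets -/

/-! The restrictions of `C_c(X, E)` make the fibres `D.H u` a continuous field of Hilbert spaces
(`GFamily.isHilbertField`). Their inner products vary continuously, because the fibre volumes have
continuous densities in fibred charts. They are dense in each fibre, by Tietze extension from the
compact fibre. They form a module over the continuous functions on `M`. Convergence in the total
space can then be tested against sections (`IsHilbertField.tendsto_iff`).

The metrics are invariant, so the action preserves the fibre volumes (`GManifold.map_move`). Hence
each `L_g` is unitary, and `g ↦ L_g e` is continuous (`tubeCont_Lsec`). A section `e₁` lives over a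
compact `K ⊆ M`, so the integrand of `T(e₁, e₂)ᵘ` vanishes unless `s g ∈ K`. Properness leaves a
compact part of `Gᵘ`, which gives integrability. The norm of `T(e₁, e₂)ᵘ` is at most the integral of
`‖e₁‖ ‖e₂‖ ∘ s` over `Gᵘ`. This is continuous and constant on orbits, hence bounded by
cocompactness. The adjoint is `T(e₂, e₁)`, and equivariance is left invariance of the Haar system.
For compactness, `g ↦ L_g e₁` is approximated by finite sums of scalar functions times sections, so
that over a compact base the image of the unit ball is uniformly close to a compact set
(`isApproximable_avgOp`).

For density, let `c ≥ 0` be a cutoff function: it has compact support and `∫ c(s g) dλᵘ(g) = 1` for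
every `u`. Equivariance gives `Rᵘ = ∫ c(s g) L_g R^{s(g)} L_g⁻¹ dλᵘ(g)`, in which only the values of
`R` over the support of `c` occur. There compactness of `R` and continuity of its adjoint give a
uniform finite rank approximation `∑ |eᵢ⟩⟨fᵢ|` (`exists_finiteRank_on`). Substituting it turns the
integral into `∑ T(c eᵢ, fᵢ)`, and the weights have total mass one, so the error stays below `ε`. -/

theorem exists_finite_partition {X : Type*} [TopologicalSpace X] [LocallyCompactSpace X] [T2Space X]
    {K : Set X} (hK : IsCompact K) (P : X → Set X) (hP : ∀ x ∈ K, P x ∈ 𝓝 x) :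
    ∃ (t : Finset X) (ρ : t → X → ℝ), (∀ i : t, (i : X) ∈ K) ∧ (∀ i, Continuous (ρ i)) ∧
      (∀ i, HasCompactSupport (ρ i)) ∧ (∀ i x, 0 ≤ ρ i x) ∧
      (∀ i : t, tsupport (ρ i) ⊆ interior (P i)) ∧ (∀ x ∈ K, ∑ i, ρ i x = 1) ∧
      ∀ x, ∑ i, ρ i x ≤ 1 := by
  obtain ⟨t, htK, ht⟩ := hK.elim_nhds_subcover (fun x => interior (P x))
    (fun x hx => interior_mem_nhds.2 (hP x hx))
  obtain ⟨ρ, hρ, hc⟩ := PartitionOfUnity.exists_isSubordinate_of_locallyFinite_t2space hK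
    (fun i : t => interior (P i)) (fun i => isOpen_interior) (locallyFinite_of_finite _)
    (fun x hx => by
      obtain ⟨i, hi, hxi⟩ := mem_iUnion₂.1 (ht hx)
      exact mem_iUnion.2 ⟨⟨i, hi⟩, hxi⟩)
  refine ⟨t, fun i => ρ i, fun i => htK i i.2, fun i => (ρ i).continuous, hc,
    fun i x => ρ.nonneg i x, hρ, fun x hx => ?_, fun x => ?_⟩
  · rw [← finsum_eq_sum_of_fintype]; exact ρ.sum_eq_one hx
  · rw [← finsum_eq_sum_of_fintype]; exact ρ.sum_le_one x

/-! ## Continuous fields of Hilbert spaces -/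

section Field

set_option linter.unusedSectionVars false

variable {M : Type*} [TopologicalSpace M] {H : M → Type*} [∀ u, NormedAddCommGroup (H u)]
  [∀ u, InnerProductSpace ℂ (H u)]

/-- A space of sections generating a continuous field of Hilbert spaces. -/
structure IsHilbertField (Γ : Submodule ℂ (∀ u, H u)) : Prop where
  inner_cont : ∀ e ∈ Γ, ∀ f ∈ Γ, Continuous fun u => (inner ℂ (e u) (f u) : ℂ)
  dense : ∀ u (ξ : H u) (ε : ℝ), 0 < ε → ∃ e ∈ Γ, ‖ξ - e u‖ < ε
  smul_mem : ∀ e ∈ Γ, ∀ c : M → ℂ, Continuous c → (fun u => c u • e u) ∈ Γ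

/-- The topology of the total space generated by the tubes around sections in `Γ`. -/
@[reducible]
def tubeTopology (Γ : Submodule ℂ (∀ u, H u)) : TopologicalSpace (Σ u, H u) :=
  TopologicalSpace.generateFrom
    {W | ∃ (V : Set M) (e : ∀ u, H u) (ε : ℝ), e ∈ Γ ∧ IsOpen V ∧ 0 < ε ∧
      W = {ξ : Σ u, H u | ξ.1 ∈ V ∧ ‖ξ.2 - e ξ.1‖ < ε}}

/-- Convergence of a family `a ↦ σ a ∈ H (b a)` to `ξ ∈ H u`. -/
def TubeTendsto (Γ : Submodule ℂ (∀ u, H u)) {A : Type*} (l : Filter A) (b : A → M)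
    (σ : ∀ a, H (b a)) (u : M) (ξ : H u) : Prop :=
  Tendsto b l (𝓝 u) ∧ ∀ ε : ℝ, 0 < ε → ∃ e ∈ Γ, ‖ξ - e u‖ < ε ∧ ∀ᶠ a in l, ‖σ a - e (b a)‖ < ε

/-- Continuity of a section `σ` along `b`. -/
def TubeCont (Γ : Submodule ℂ (∀ u, H u)) {A : Type*} [TopologicalSpace A] (b : A → M)
    (σ : ∀ a, H (b a)) : Prop :=
  ∀ a, TubeTendsto Γ (𝓝 a) b σ (b a) (σ a)

variable {Γ : Submodule ℂ (∀ u, H u)} {A : Type*} {l : Filter A} {b : A → M}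
  {σ τ : ∀ a, H (b a)} {u : M} {ξ η : H u}

namespace IsHilbertField

variable (hF : IsHilbertField Γ)
include hF

theorem norm_cont {e : ∀ u, H u} (he : e ∈ Γ) : Continuous fun u => ‖e u‖ := by
  have h := (Complex.continuous_re.comp (hF.inner_cont e he e he)).sqrt
  refine h.congr fun u => ?_
  simp only [Function.comp]
  rw [inner_self_eq_norm_sq_to_K]
  norm_cast
  exact Real.sqrt_sq (norm_nonneg _)

/-- The section that witnesses convergence is immaterial: two sections in `Γ` that are close at `u`
remain close nearby, because the norm of their difference is continuous. -/
theorem near (h : TubeTendsto Γ l b σ u ξ) {e : ∀ u, H u} (he : e ∈ Γ) {ε : ℝ}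
    (hε : ‖ξ - e u‖ < ε) : ∀ᶠ a in l, ‖σ a - e (b a)‖ < ε := by
  -- Half of the slack is spent on `σ - f`; the other half absorbs the variation of `‖f - e‖` near
  -- `u`.
  obtain ⟨f, hf, h1, h2⟩ := h.2 ((ε - ‖ξ - e u‖) / 2) (by linarith)
  have hc := (hF.norm_cont (Γ.sub_mem hf he)).tendsto u
  have h3 : ‖(f - e) u‖ < (ε + ‖ξ - e u‖) / 2 := by
    have : (f - e) u = (ξ - e u) - (ξ - f u) := by simp
    rw [this]
    have := norm_sub_le (ξ - e u) (ξ - f u)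
    linarith
  filter_upwards [h2, (hc.comp h.1).eventually (gt_mem_nhds h3)] with a ha1 ha2
  have : σ a - e (b a) = (σ a - f (b a)) + (f - e) (b a) := by simp
  rw [this]
  have := norm_add_le (σ a - f (b a)) ((f - e) (b a))
  simp only [Function.comp] at ha2
  linarith

/-- Fibrewise density puts the limit into a tube of every radius, and `near` passes from one section
per radius to all tubes. Every later continuity argument goes through this criterion. -/
theorem tendsto_iff {f : A → Σ u, H u} :
    Tendsto f l (@nhds _ (tubeTopology Γ) ⟨u, ξ⟩) ↔
      TubeTendsto Γ l (fun a => (f a).1) (fun a => (f a).2) u ξ := by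
  rw [tubeTopology, TopologicalSpace.tendsto_nhds_generateFrom_iff]
  constructor
  · intro h
    refine ⟨?_, fun ε hε => ?_⟩
    · rw [tendsto_nhds]
      intro V hV hu
      obtain ⟨e, he, h1⟩ := hF.dense u ξ 1 one_pos
      filter_upwards [h _ ⟨V, e, 1, he, hV, one_pos, rfl⟩ ⟨hu, h1⟩] with a ha
      exact ha.1
    · obtain ⟨e, he, h1⟩ := hF.dense u ξ ε hε
      refine ⟨e, he, h1, ?_⟩
      filter_upwards [h _ ⟨univ, e, ε, he, isOpen_univ, hε, rfl⟩ ⟨trivial, h1⟩] with a ha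
      exact ha.2
  · rintro h W ⟨V, e, ε, he, hV, hε, rfl⟩ ⟨h1, h2⟩
    filter_upwards [h.1 (hV.mem_nhds h1), hF.near h he h2] with a ha1 ha2
    exact ⟨ha1, ha2⟩

theorem continuous_iff [TopologicalSpace A] {f : A → Σ u, H u} :
    @Continuous _ _ _ (tubeTopology Γ) f ↔ TubeCont Γ (fun a => (f a).1) (fun a => (f a).2) := by
  let _ := tubeTopology Γ
  rw [continuous_iff_continuousAt]
  exact forall_congr' fun a => hF.tendsto_iff

theorem tendsto_of_mem {e : ∀ u, H u} (he : e ∈ Γ) (hb : Tendsto b l (𝓝 u)) :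
    TubeTendsto Γ l b (fun a => e (b a)) u (e u) :=
  ⟨hb, fun ε hε => ⟨e, he, by simpa using hε, .of_forall fun a => by simpa using hε⟩⟩

/-- Convergence is stable under uniform approximation; the approximants may depend on `ε`. -/
theorem tendsto_of_approx (hb : Tendsto b l (𝓝 u))
    (h : ∀ ε : ℝ, 0 < ε → ∃ (τ : ∀ a, H (b a)) (ζ : H u), TubeTendsto Γ l b τ u ζ ∧
      ‖ξ - ζ‖ ≤ ε ∧ ∀ᶠ a in l, ‖σ a - τ a‖ ≤ ε) : TubeTendsto Γ l b σ u ξ := by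
  refine ⟨hb, fun ε hε => ?_⟩
  obtain ⟨τ, ζ, h1, h2, h3⟩ := h (ε / 3) (by linarith)
  obtain ⟨e, he, h4, h5⟩ := h1.2 (ε / 3) (by linarith)
  refine ⟨e, he, ?_, ?_⟩
  · have := norm_sub_le_norm_sub_add_norm_sub ξ ζ (e u); linarith
  · filter_upwards [h3, h5] with a ha hb
    have := norm_sub_le_norm_sub_add_norm_sub (σ a) (τ a) (e (b a)); linarith

theorem tendsto_add (h1 : TubeTendsto Γ l b σ u ξ) (h2 : TubeTendsto Γ l b τ u η) :
    TubeTendsto Γ l b (fun a => σ a + τ a) u (ξ + η) := by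
  refine ⟨h1.1, fun ε hε => ?_⟩
  obtain ⟨e, he, h3, h4⟩ := h1.2 (ε / 2) (by linarith)
  obtain ⟨f, hf, h5, h6⟩ := h2.2 (ε / 2) (by linarith)
  refine ⟨e + f, Γ.add_mem he hf, ?_, ?_⟩
  · have := norm_add_le (ξ - e u) (η - f u)
    rw [Pi.add_apply, add_sub_add_comm]; linarith
  · filter_upwards [h4, h6] with a ha hb
    have := norm_add_le (σ a - e (b a)) (τ a - f (b a))
    rw [Pi.add_apply, add_sub_add_comm]; linarith

theorem tendsto_norm (h1 : TubeTendsto Γ l b σ u ξ) :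
    Tendsto (fun a => ‖σ a‖) l (𝓝 ‖ξ‖) := by
  rw [Metric.tendsto_nhds]
  intro ε hε
  obtain ⟨e, he, h3, h4⟩ := h1.2 (ε / 3) (by linarith)
  have h5 := ((hF.norm_cont he).tendsto u).comp h1.1
  filter_upwards [h4, (Metric.tendsto_nhds.1 h5) (ε / 3) (by linarith)] with a ha hb
  simp only [Function.comp, Real.dist_eq] at *
  have e1 := abs_le.1 (abs_norm_sub_norm_le ξ (e u))
  have e2 := abs_le.1 (abs_norm_sub_norm_le (σ a) (e (b a)))
  rw [abs_lt] at *
  constructor <;> linarith [e1.1, e1.2, e2.1, e2.2]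

theorem tendsto_smul {c : A → ℂ} {c₀ : ℂ} (hc : Tendsto c l (𝓝 c₀))
    (h1 : TubeTendsto Γ l b σ u ξ) : TubeTendsto Γ l b (fun a => c a • σ a) u (c₀ • ξ) := by
  refine ⟨h1.1, fun ε hε => ?_⟩
  -- The errors in the scalar and in the vector are multiplied by about `‖ξ‖ + 1` and `‖c₀‖`; `C`
  -- exceeds the sum of both.
  set C : ℝ := ‖c₀‖ + ‖ξ‖ + 2 with hC
  have hCpos : 0 < C := by positivity
  obtain ⟨e, he, h3, h4⟩ := h1.2 (ε / (2 * C)) (by positivity)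
  have hn := (hF.tendsto_norm h1).eventually (gt_mem_nhds (lt_add_one ‖ξ‖))
  have hd : ∀ᶠ a in l, ‖c a - c₀‖ < ε / (2 * C) := by
    have := Metric.tendsto_nhds.1 hc (ε / (2 * C)) (by positivity)
    simpa [dist_eq_norm] using this
  have hq : ε / (2 * C) * C = ε / 2 := by field_simp
  refine ⟨c₀ • e, Γ.smul_mem _ he, ?_, ?_⟩
  · rw [Pi.smul_apply, ← smul_sub, norm_smul]
    have : ‖c₀‖ * ‖ξ - e u‖ ≤ C * (ε / (2 * C)) := by
      gcongr
      rw [hC]; linarith [norm_nonneg ξ]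
    linarith
  · filter_upwards [h4, hn, hd] with a ha hb hc
    have e1 : c a • σ a - (c₀ • e) (b a) = (c a - c₀) • σ a + c₀ • (σ a - e (b a)) := by
      simp [sub_smul, smul_sub]
    rw [e1]
    have e2 := norm_add_le ((c a - c₀) • σ a) (c₀ • (σ a - e (b a)))
    rw [norm_smul, norm_smul] at e2
    have e3 : ‖c a - c₀‖ * ‖σ a‖ ≤ (ε / (2 * C)) * (‖ξ‖ + 1) := by gcongr
    have e4 : ‖c₀‖ * ‖σ a - e (b a)‖ ≤ ‖c₀‖ * (ε / (2 * C)) := by gcongr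
    have e5 : (ε / (2 * C)) * (‖ξ‖ + 1) + ‖c₀‖ * (ε / (2 * C)) < ε / (2 * C) * C + ε / 2 := by
      have : 0 < ε / (2 * C) := by positivity
      rw [hC]; nlinarith
    linarith

theorem tendsto_sub (h1 : TubeTendsto Γ l b σ u ξ) (h2 : TubeTendsto Γ l b τ u η) :
    TubeTendsto Γ l b (fun a => σ a - τ a) u (ξ - η) := by
  have := hF.tendsto_add h1 (hF.tendsto_smul (tendsto_const_nhds (x := (-1 : ℂ))) h2)
  simpa [sub_eq_add_neg] using this

theorem tendsto_inner (h1 : TubeTendsto Γ l b σ u ξ) (h2 : TubeTendsto Γ l b τ u η) :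
    Tendsto (fun a => (inner ℂ (σ a) (τ a) : ℂ)) l (𝓝 (inner ℂ ξ η)) := by
  have key : ∀ (c : ℂ), Tendsto (fun a => ((‖σ a + c • τ a‖ ^ 2 : ℝ) : ℂ)) l
      (𝓝 ((‖ξ + c • η‖ ^ 2 : ℝ) : ℂ)) := fun c =>
    (Complex.continuous_ofReal.tendsto _).comp ((hF.tendsto_norm
      (hF.tendsto_add h1 (hF.tendsto_smul tendsto_const_nhds h2))).pow 2)
  have h := (((key 1).sub (key (-1))).add
    (((key (-Complex.I)).sub (key Complex.I)).mul_const Complex.I)).div_const 4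
  have e : ∀ v (x y : H v), (inner ℂ x y : ℂ) = (((‖x + (1 : ℂ) • y‖ ^ 2 : ℝ) : ℂ) -
      ((‖x + (-1 : ℂ) • y‖ ^ 2 : ℝ) : ℂ) + (((‖x + (-Complex.I) • y‖ ^ 2 : ℝ) : ℂ) -
      ((‖x + Complex.I • y‖ ^ 2 : ℝ) : ℂ)) * Complex.I) / 4 := by
    intro v x y
    rw [inner_eq_sum_norm_sq_div_four (𝕜 := ℂ) x y]
    simp [sub_eq_add_neg]
  simp only [e]
  exact h

theorem norm_sub_le_of_tendsto [l.NeBot] (h1 : TubeTendsto Γ l b σ u ξ)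
    (h2 : TubeTendsto Γ l b τ u η) {δ : ℝ} (h : ∀ᶠ a in l, ‖σ a - τ a‖ ≤ δ) : ‖ξ - η‖ ≤ δ :=
  le_of_tendsto (hF.tendsto_norm (hF.tendsto_sub h1 h2)) h

theorem tendsto_sum {ι : Type*} (t : Finset ι) {σ : ι → ∀ a, H (b a)} {ξ : ι → H u}
    (hb : Tendsto b l (𝓝 u)) (h : ∀ i ∈ t, TubeTendsto Γ l b (σ i) u (ξ i)) :
    TubeTendsto Γ l b (fun a => ∑ i ∈ t, σ i a) u (∑ i ∈ t, ξ i) := by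
  classical
  induction t using Finset.induction_on with
  | empty => simpa using hF.tendsto_of_mem Γ.zero_mem hb
  | insert i t hi ih =>
    simp only [Finset.sum_insert hi]
    exact hF.tendsto_add (h i (Finset.mem_insert_self _ _))
      (ih fun k hk => h k (Finset.mem_insert_of_mem hk))

/-- A uniformly bounded linear family is uniformly Lipschitz on fibres, so its continuity need only
be checked on the sections in `Γ`. -/
theorem tendsto_apply {T : ∀ u, H u → H u} (hT : ∀ u, IsLinearMap ℂ (T u)) {C : ℝ}
    (hC : ∀ u ξ, ‖T u ξ‖ ≤ C * ‖ξ‖) (he : ∀ e ∈ Γ, TubeCont Γ (fun u => u) fun u => T u (e u))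
    (h : TubeTendsto Γ l b σ u ξ) : TubeTendsto Γ l b (fun a => T (b a) (σ a)) u (T u ξ) := by
  refine hF.tendsto_of_approx h.1 fun ε hε => ?_
  -- `C` may be zero or negative, and it has to be divided by.
  set C' := max C 1
  have hC' : 0 < C' := lt_max_of_lt_right one_pos
  have hle : ∀ v (x y : H v), ‖x - y‖ ≤ ε / C' → ‖T v x - T v y‖ ≤ ε := by
    intro v x y hxy
    rw [← (hT v).map_sub]
    calc _ ≤ C * ‖x - y‖ := hC _ _
      _ ≤ C' * (ε / C') := by gcongr; exact le_max_left _ _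
      _ = ε := by field_simp
  obtain ⟨e, he', h1, h2⟩ := h.2 (ε / C') (by positivity)
  refine ⟨fun a => T (b a) (e (b a)), T u (e u), ?_, hle _ _ _ h1.le, ?_⟩
  · have := he e he' u
    refine ⟨h.1, fun δ hδ => ?_⟩
    obtain ⟨f, hf, h3, h4⟩ := this.2 δ hδ
    exact ⟨f, hf, h3, h.1.eventually h4⟩
  · filter_upwards [h2] with a ha using hle _ _ _ ha.le

theorem continuous_of_tubeCont {T : ∀ u, H u → H u} (hT : ∀ u, IsLinearMap ℂ (T u)) {C : ℝ}
    (hC : ∀ u ξ, ‖T u ξ‖ ≤ C * ‖ξ‖) (he : ∀ e ∈ Γ, TubeCont Γ (fun u => u) fun u => T u (e u)) :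
    @Continuous _ _ (tubeTopology Γ) (tubeTopology Γ)
      (fun ζ : Σ u, H u => (⟨ζ.1, T ζ.1 ζ.2⟩ : Σ u, H u)) := by
  let _ := tubeTopology Γ
  rw [hF.continuous_iff]
  exact fun ζ => hF.tendsto_apply hT hC he (hF.tendsto_iff.1 (tendsto_id (x := 𝓝 ζ)))

theorem tubeCont_apply {T : ∀ u, H u → H u}
    (hT : @Continuous _ _ (tubeTopology Γ) (tubeTopology Γ)
      (fun ζ : Σ u, H u => (⟨ζ.1, T ζ.1 ζ.2⟩ : Σ u, H u))) {e : ∀ u, H u} (he : e ∈ Γ) :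
    TubeCont Γ (fun u => u) fun u => T u (e u) := by
  let _ := tubeTopology Γ
  have h1 : Continuous (fun u : M => (⟨u, e u⟩ : Σ u, H u)) := by
    rw [hF.continuous_iff]
    exact fun u => hF.tendsto_of_mem he tendsto_id
  exact hF.continuous_iff.1 (hT.comp h1)

/-- A set of vectors over a compact set of the base which can be approximated, fibrewise and
uniformly, by compact sets has compact closure. -/
theorem isCompact_closure_of_approx [T2Space M] [∀ u, CompleteSpace (H u)] {A : Set M}
    (hA : IsCompact A) {S : Set (Σ u, H u)} (hSA : ∀ ζ ∈ S, ζ.1 ∈ A)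
    (h : ∀ δ : ℝ, 0 < δ → ∃ K : Set (Σ u, H u), @IsCompact _ (tubeTopology Γ) K ∧
      ∀ ζ ∈ S, ∃ κ : H ζ.1, (⟨ζ.1, κ⟩ : Σ u, H u) ∈ K ∧ ‖ζ.2 - κ‖ ≤ δ) :
    @IsCompact _ (tubeTopology Γ) (@closure _ (tubeTopology Γ) S) := by
  let _ := tubeTopology Γ
  choose! K hK hSK using h
  -- The closed `δ`-neighbourhood of `K δ` over `A`. It contains `S`, and being closed it contains
  -- the closure of `S`.
  set N : ℝ → Set (Σ u, H u) := fun δ =>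
    {ζ | ζ.1 ∈ A ∧ ∃ κ : H ζ.1, (⟨ζ.1, κ⟩ : Σ u, H u) ∈ K δ ∧ ‖ζ.2 - κ‖ ≤ δ} with hN
  -- limits of ultrafilters on `N δ`
  have key : ∀ δ, 0 < δ → ∀ 𝒰 : Ultrafilter (Σ u, H u), N δ ∈ 𝒰 →
      ∀ u, Tendsto (fun ζ : Σ u, H u => ζ.1) 𝒰 (𝓝 u) →
      ∃ (κ : ∀ ζ : Σ u, H u, H ζ.1) (κ₀ : H u), (⟨u, κ₀⟩ : Σ u, H u) ∈ K δ ∧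
        TubeTendsto Γ (𝒰 : Filter (Σ u, H u)) (fun ζ => ζ.1) κ u κ₀ ∧
        ∀ᶠ ζ : Σ u, H u in (𝒰 : Filter (Σ u, H u)), ‖ζ.2 - κ ζ‖ ≤ δ := by
    intro δ hδ 𝒰 h𝒰 u hu
    have : ∀ ζ : Σ u, H u, ∃ κ : H ζ.1, ζ ∈ N δ → (⟨ζ.1, κ⟩ : Σ u, H u) ∈ K δ ∧ ‖ζ.2 - κ‖ ≤ δ := by
      intro ζ
      by_cases hζ : ζ ∈ N δ
      · obtain ⟨-, κ, h1⟩ := hζ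
        exact ⟨κ, fun _ => h1⟩
      · exact ⟨0, fun h => absurd h hζ⟩
    choose κ hκ using this
    have h1 : (fun ζ => (⟨ζ.1, κ ζ⟩ : Σ u, H u)) ⁻¹' K δ ∈ 𝒰 :=
      mem_of_superset h𝒰 fun ζ hζ => (hκ ζ hζ).1
    obtain ⟨⟨u', κ₀⟩, hκK, hle⟩ := (isCompact_iff_ultrafilter_le_nhds.1 (hK δ hδ))
      (𝒰.map fun ζ : Σ u, H u => (⟨ζ.1, κ ζ⟩ : Σ u, H u)) (by simpa using h1)
    have h2 : TubeTendsto Γ (𝒰 : Filter (Σ u, H u)) (fun ζ => ζ.1) κ u' κ₀ :=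
      (hF.tendsto_iff (f := fun ζ : Σ u, H u => (⟨ζ.1, κ ζ⟩ : Σ u, H u))).1 hle
    -- The chosen nearby points converge in `K δ` along the ultrafilter; as `M` is Hausdorff, their
    -- limit lies over the prescribed base point.
    obtain rfl : u' = u := tendsto_nhds_unique h2.1 hu
    exact ⟨κ, κ₀, hκK, h2, mem_of_superset h𝒰 fun ζ hζ => (hκ ζ hζ).2⟩
  have hclosed : ∀ δ, 0 < δ → IsClosed (N δ) := by
    intro δ hδ
    rw [isClosed_iff_ultrafilter]
    rintro ⟨u, ξ⟩ 𝒰 hle h𝒰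
    have h1 : TubeTendsto Γ (𝒰 : Filter (Σ u, H u)) (fun ζ : Σ u, H u => ζ.1) (fun ζ => ζ.2) u ξ :=
      (hF.tendsto_iff (f := fun ζ => ζ)).1 hle
    obtain ⟨κ, κ₀, h2, h3, h4⟩ := key δ hδ 𝒰 h𝒰 u h1.1
    refine ⟨?_, κ₀, h2, hF.norm_sub_le_of_tendsto h1 h3 h4⟩
    exact hA.isClosed.mem_of_tendsto h1.1 (mem_of_superset h𝒰 fun ζ hζ => hζ.1)
  have hSN : ∀ δ, 0 < δ → closure S ⊆ N δ := fun δ hδ =>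
    closure_minimal (fun ζ hζ => ⟨hSA ζ hζ, hSK δ hδ ζ hζ⟩) (hclosed δ hδ)
  rw [isCompact_iff_ultrafilter_le_nhds]
  intro 𝒰 h𝒰
  rw [Filter.le_principal_iff] at h𝒰
  have hNU : ∀ δ, 0 < δ → N δ ∈ 𝒰 := fun δ hδ => mem_of_superset h𝒰 (hSN δ hδ)
  obtain ⟨u, -, hu⟩ := (isCompact_iff_ultrafilter_le_nhds.1 hA) (𝒰.map fun ζ : Σ u, H u => ζ.1)
    (by
      rw [Filter.le_principal_iff]
      have : (fun ζ : Σ u, H u => ζ.1) ⁻¹' A ∈ 𝒰 :=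
        mem_of_superset (hNU 1 one_pos) fun ζ hζ => hζ.1
      exact this)
  have hu' : Tendsto (fun ζ : Σ u, H u => ζ.1) 𝒰 (𝓝 u) := hu
  -- The argument "totally bounded and complete implies compact", run along one ultrafilter: the
  -- limits `κ₀ n` of the `1/(n+1)`-approximants all lie in the single Hilbert space `H u`, where
  -- they are Cauchy, and their limit is the limit of the ultrafilter.
  have hpos : ∀ n : ℕ, 0 < 1 / ((n : ℝ) + 1) := fun n => by positivity
  choose κ κ₀ hκK hκ hd using fun n : ℕ => key _ (hpos n) 𝒰 (hNU _ (hpos n)) u hu'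
  have hcau : ∀ n m, ‖κ₀ n - κ₀ m‖ ≤ 1 / ((n : ℝ) + 1) + 1 / ((m : ℝ) + 1) := by
    intro n m
    refine hF.norm_sub_le_of_tendsto (hκ n) (hκ m) ?_
    filter_upwards [hd n, hd m] with ζ h1 h2
    have := norm_sub_le (ζ.2 - κ m ζ) (ζ.2 - κ n ζ)
    rw [show ζ.2 - κ m ζ - (ζ.2 - κ n ζ) = κ n ζ - κ m ζ by abel] at this
    linarith
  have hC : CauchySeq κ₀ := by
    refine cauchySeq_of_le_tendsto_0 (fun n : ℕ => 2 * (1 / ((n : ℝ) + 1))) (fun n m N hn hm => ?_)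
      (by simpa using tendsto_one_div_add_atTop_nhds_zero_nat.const_mul (2 : ℝ))
    rw [dist_eq_norm]
    refine (hcau n m).trans ?_
    have h1 : 1 / ((n : ℝ) + 1) ≤ 1 / ((N : ℝ) + 1) := by gcongr
    have h2 : 1 / ((m : ℝ) + 1) ≤ 1 / ((N : ℝ) + 1) := by gcongr
    linarith
  obtain ⟨ζ₀, hζ₀⟩ := cauchySeq_tendsto_of_complete hC
  have hlim : (𝒰 : Filter (Σ u, H u)) ≤ 𝓝 (⟨u, ζ₀⟩ : Σ u, H u) := by
    refine (hF.tendsto_iff (f := fun ζ => ζ)).2 (hF.tendsto_of_approx hu' fun ε hε => ?_)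
    have h1 := (Metric.tendsto_nhds.1 hζ₀) ε hε
    have h2 := tendsto_one_div_add_atTop_nhds_zero_nat.eventually (gt_mem_nhds hε)
    obtain ⟨n, hn1, hn2⟩ := (h1.and h2).exists
    refine ⟨κ n, κ₀ n, hκ n, ?_, (hd n).mono fun ζ hζ => hζ.trans hn2.le⟩
    rw [dist_comm, dist_eq_norm] at hn1
    exact hn1.le
  exact ⟨_, isClosed_closure.mem_of_tendsto (f := fun ζ => ζ) hlim h𝒰, hlim⟩

end IsHilbertField

end Field

theorem exists_bump {X : Type*} [TopologicalSpace X] [LocallyCompactSpace X] [T2Space X]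
    {K : Set X} (hK : IsCompact K) : ∃ θ : X → ℝ, Continuous θ ∧ HasCompactSupport θ ∧
      (∀ x, 0 ≤ θ x) ∧ (∀ x, θ x ≤ 1) ∧ ∀ x ∈ K, θ x = 1 := by
  obtain ⟨f, h1, -, h2, h3⟩ := exists_continuous_one_zero_of_isCompact hK isClosed_empty
    (disjoint_empty K)
  exact ⟨f, f.continuous, h2, fun x => (h3 x).1, fun x => (h3 x).2, fun x hx => h1 hx⟩

/-! ## Integration along the fibres of a map -/

section Integration

set_option linter.unusedSectionVars false

variable {G M : Type*} [TopologicalSpace G] [LocallyCompactSpace G] [T2Space G]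
  [SecondCountableTopology G] [MeasurableSpace G] [BorelSpace G] [TopologicalSpace M] [T2Space M]

/-- A continuous system of locally finite measures on the fibres of `r`. -/
structure IsFibreSystem (r : G → M) (lam : ∀ u : M, Measure (Fib r u)) : Prop where
  continuous_map : Continuous r
  finite : ∀ u, IsFiniteMeasureOnCompacts (lam u)
  continuous : ∀ f : G → ℂ, Continuous f → HasCompactSupport f →
    Continuous fun u => ∫ g : Fib r u, f g.1 ∂lam u

namespace IsFibreSystem

variable {r : G → M} {lam : ∀ u : M, Measure (Fib r u)} (hr : IsFibreSystem r lam)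
include hr

theorem hasCompactSupport {B : Type*} [Zero B] {K : Set G} (hK : IsCompact K) {u : M}
    {f : Fib r u → B} (h : ∀ g, g.1 ∉ K → f g = 0) : HasCompactSupport f := by
  have hc : IsClosed {g | r g = u} := isClosed_singleton.preimage hr.continuous_map
  exact HasCompactSupport.intro (hc.isClosedEmbedding_subtypeVal.isCompact_preimage hK)
    fun g hg => h g hg

theorem integrable {B : Type*} [NormedAddCommGroup B] {K : Set G} (hK : IsCompact K)
    {u : M} {f : Fib r u → B} (hf : Continuous f) (h : ∀ g, g.1 ∉ K → f g = 0) :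
    Integrable f (lam u) := by
  have := hr.finite u
  exact hf.integrable_of_hasCompactSupport (hr.hasCompactSupport hK h)

theorem integrable_restrict {B : Type*} [NormedAddCommGroup B] {u : M} {f : G → B}
    (hf : Continuous f) (h : HasCompactSupport f) :
    Integrable (fun g : Fib r u => f g.1) (lam u) :=
  hr.integrable h (hf.comp continuous_subtype_val) fun _ hg => image_eq_zero_of_notMem_tsupport hg

theorem continuous_real {f : G → ℝ} (hf : Continuous f) (h : HasCompactSupport f) :
    Continuous fun u => ∫ g : Fib r u, f g.1 ∂lam u := by
  have := Complex.continuous_re.comp (hr.continuous (fun g => (f g : ℂ))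
    (Complex.continuous_ofReal.comp hf) (h.comp_left (g := fun x : ℝ => (x : ℂ)) rfl))
  refine this.congr fun u => ?_
  simp only [Function.comp]
  rw [integral_complex_ofReal, Complex.ofReal_re]

variable {H : M → Type*} [∀ u, NormedAddCommGroup (H u)]
  [∀ u, InnerProductSpace ℂ (H u)] {Γ : Submodule ℂ (∀ u, H u)} (hF : IsHilbertField Γ)
  {Ψ : ∀ u, Fib r u → H u} (hΨ : TubeCont Γ r fun g => Ψ (r g) ⟨g, rfl⟩)

include hF hΨ in
-- On one fibre of `r` the comparison sections are constant vectors of `H u`, so tube continuity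
-- reduces to norm continuity.
theorem continuous_of_tubeCont (u : M) : Continuous (Ψ u) := by
  rw [continuous_iff_continuousAt]
  rintro ⟨g, rfl⟩
  rw [ContinuousAt, Metric.tendsto_nhds]
  intro ε hε
  obtain ⟨e, he, h1, h2⟩ := (hΨ g).2 (ε / 2) (by linarith)
  filter_upwards [(continuous_subtype_val.tendsto (⟨g, rfl⟩ : Fib r (r g))).eventually h2]
  rintro ⟨k, hk⟩ hk'
  rw [dist_eq_norm]
  -- `H (r k)` and `H (r g)` agree only propositionally; the equality is eliminated on a free
  -- variable.
  have key : ∀ (v : M) (hv : r k = v), ‖Ψ (r k) ⟨k, rfl⟩ - e (r k)‖ = ‖Ψ v ⟨k, hv⟩ - e v‖ := by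
    rintro _ rfl; rfl
  rw [key _ hk] at hk'
  have := norm_sub_le (Ψ (r g) ⟨k, hk⟩ - e (r g)) (Ψ (r g) ⟨g, rfl⟩ - e (r g))
  rw [sub_sub_sub_cancel_right] at this
  linarith

include hΨ in
-- A partition of unity on `K ⊆ G` glues the local comparison sections. The error is bounded by `δ *
-- θ`, with `θ` of compact support in the applications, and not merely by `δ`, so that it can be
-- integrated over fibres of possibly infinite measure.
theorem exists_approx {K : Set G} (hK : IsCompact K) (h0 : ∀ u (g : Fib r u), g.1 ∉ K → Ψ u g = 0)
    {θ : G → ℝ} (hθ : Continuous θ) (hθ0 : ∀ g, 0 ≤ θ g) (hθ1 : ∀ g ∈ K, θ g = 1) {δ : ℝ}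
    (hδ : 0 < δ) : ∃ (t : Finset G) (χ : t → G → ℝ) (e : t → ∀ u, H u), (∀ i, e i ∈ Γ) ∧
      (∀ i, Continuous (χ i)) ∧ (∀ i, HasCompactSupport (χ i)) ∧ (∀ i g, 0 ≤ χ i g) ∧
      ∀ u (g : Fib r u), ‖Ψ u g - ∑ i, (χ i g.1 : ℂ) • e i u‖ ≤ δ * θ g.1 := by
  choose e he h1 h2 using fun g => (hΨ g).2 δ hδ
  obtain ⟨t, ρ, -, hρc, hρs, hρ0, hρP, hρ1, hρle⟩ := exists_finite_partition hK
    (fun g => {k | ‖Ψ (r k) ⟨k, rfl⟩ - e g (r k)‖ < δ}) fun g _ => h2 g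
  refine ⟨t, fun i g => θ g * ρ i g, fun i => e i, fun i => he i, fun i => hθ.mul (hρc i),
    fun i => (hρs i).mul_left, fun i g => mul_nonneg (hθ0 g) (hρ0 i g), ?_⟩
  rintro _ ⟨g, rfl⟩
  -- On `K` both `θ` and `∑ ρ i` equal 1; off `K` the term `Ψ` vanishes. In both cases the error is
  -- a `ρ`-weighted sum of local errors.
  have e1 : Ψ (r g) ⟨g, rfl⟩ - ∑ i : t, ((θ g * ρ i g : ℝ) : ℂ) • e i (r g) =
      (θ g : ℂ) • ∑ i : t, (ρ i g : ℂ) • (Ψ (r g) ⟨g, rfl⟩ - e i (r g)) := by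
    simp only [smul_sub, Finset.sum_sub_distrib, ← Finset.sum_smul, Finset.smul_sum, smul_smul]
    by_cases hg : g ∈ K
    · have h3 : ∑ i : t, (ρ i g : ℂ) = 1 := by exact_mod_cast hρ1 g hg
      rw [h3, hθ1 g hg]
      simp
    · simp [h0 (r g) ⟨g, rfl⟩ hg]
  change ‖Ψ (r g) ⟨g, rfl⟩ - ∑ i : t, ((θ g * ρ i g : ℝ) : ℂ) • e i (r g)‖ ≤ δ * θ g
  rw [e1, norm_smul, Complex.norm_real, Real.norm_of_nonneg (hθ0 g), mul_comm]
  refine mul_le_mul_of_nonneg_right ?_ (hθ0 g)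
  calc ‖∑ i : t, (ρ i g : ℂ) • (Ψ (r g) ⟨g, rfl⟩ - e i (r g))‖
      ≤ ∑ i : t, ρ i g * δ := by
        refine norm_sum_le_of_le _ fun i _ => ?_
        rw [norm_smul, Complex.norm_real, Real.norm_of_nonneg (hρ0 i g)]
        by_cases hi : g ∈ tsupport (ρ i)
        · have h4 := interior_subset (hρP i hi)
          exact mul_le_mul_of_nonneg_left (le_of_lt h4) (hρ0 i g)
        · simp [image_eq_zero_of_notMem_tsupport hi]
    _ ≤ δ := by
        rw [← Finset.sum_mul]
        exact mul_le_of_le_one_left hδ.le (hρle g)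

include hF hΨ in
/-- Fibre integrals of compactly supported continuous sections are continuous sections. -/
theorem tubeCont_integral [∀ u, CompleteSpace (H u)] {K : Set G} (hK : IsCompact K)
    (h0 : ∀ u (g : Fib r u), g.1 ∉ K → Ψ u g = 0) :
    TubeCont Γ (fun u => u) fun u => ∫ g, Ψ u g ∂lam u := by
  obtain ⟨θ, hθc, hθs, hθ0, -, hθ1⟩ := exists_bump hK
  have hI := hr.continuous_real hθc hθs
  intro u
  refine hF.tendsto_of_approx tendsto_id fun ε hε => ?_
  set I := ∫ g : Fib r u, θ g.1 ∂lam u with hIdef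
  have hI0 : 0 ≤ I := integral_nonneg fun g => hθ0 _
  -- Near `u` the integral of `θ` stays below `I + 1`, so this choice gives an integrated error of
  -- at most `ε`.
  obtain ⟨t, χ, e, he, hχc, hχs, -, happ⟩ := hr.exists_approx hΨ hK h0 hθc hθ0 hθ1
    (δ := ε / (I + 1)) (by positivity)
  have hle : ∀ v, ‖∫ g, Ψ v g ∂lam v - ∑ i, ((∫ g : Fib r v, χ i g.1 ∂lam v : ℝ) : ℂ) • e i v‖ ≤
      ε / (I + 1) * ∫ g : Fib r v, θ g.1 ∂lam v := by
    intro v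
    have hi : ∀ i, Integrable (fun g : Fib r v => (χ i g.1 : ℂ) • e i v) (lam v) := fun i =>
      ((hr.integrable_restrict (hχc i) (hχs i)).ofReal).smul_const _
    have e1 : ∑ i, ((∫ g : Fib r v, χ i g.1 ∂lam v : ℝ) : ℂ) • e i v =
        ∫ g : Fib r v, ∑ i, (χ i g.1 : ℂ) • e i v ∂lam v := by
      rw [integral_finsetSum _ fun i _ => hi i]
      refine Finset.sum_congr rfl fun i _ => ?_
      rw [integral_smul_const, integral_complex_ofReal]
    rw [e1, ← integral_sub (hr.integrable hK (hr.continuous_of_tubeCont hF hΨ v) (h0 v))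
      (integrable_finsetSum _ fun i _ => hi i), ← integral_const_mul]
    exact norm_integral_le_of_norm_le ((hr.integrable_restrict hθc hθs).const_mul _)
      (.of_forall fun g => happ v g)
  refine ⟨fun v => ∑ i, ((∫ g : Fib r v, χ i g.1 ∂lam v : ℝ) : ℂ) • e i v,
    ∑ i, ((∫ g : Fib r u, χ i g.1 ∂lam u : ℝ) : ℂ) • e i u, ?_, ?_, ?_⟩
  · refine hF.tendsto_sum _ tendsto_id fun i _ => hF.tendsto_smul ?_
      (hF.tendsto_of_mem (he i) tendsto_id)
    exact (Complex.continuous_ofReal.comp (hr.continuous_real (hχc i) (hχs i))).tendsto u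
  · refine (hle u).trans ?_
    rw [← hIdef, div_mul_eq_mul_div, div_le_iff₀ (by linarith)]
    nlinarith
  · filter_upwards [(hI.tendsto u).eventually (gt_mem_nhds (lt_add_one I))] with v hv
    refine (hle v).trans ?_
    rw [div_mul_eq_mul_div, div_le_iff₀ (by linarith)]
    exact mul_le_mul_of_nonneg_left hv.le hε.le

end IsFibreSystem

end Integration

/-! ### Orbit integrals and cutoff functions for proper cocompact groupoids. -/

section Groupoid

set_option linter.unusedSectionVars false

variable {dG dM : ℕ} {G M : Type*}
  [TopologicalSpace G] [ChartedSpace (EuclideanSpace ℝ (Fin dG)) G]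
  [TopologicalSpace M] [ChartedSpace (EuclideanSpace ℝ (Fin dM)) M]

namespace LieGroupoid

variable {𝒢 : LieGroupoid dG dM G M}

theorem continuous_r : Continuous 𝒢.r := 𝒢.smooth_r.continuous

theorem continuous_s : Continuous 𝒢.s := 𝒢.smooth_s.continuous

theorem continuous_inv : Continuous 𝒢.inv := 𝒢.smooth_inv.continuous

theorem inv_inv (g : G) : 𝒢.inv (𝒢.inv g) = g := by
  have e2 : 𝒢.mul g (𝒢.mul (𝒢.inv g) (𝒢.inv (𝒢.inv g))) = g := by
    rw [𝒢.mul_inv, 𝒢.r_inv, 𝒢.mul_unit]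
  rw [← 𝒢.mul_assoc _ _ _ (𝒢.r_inv g).symm (𝒢.r_inv _).symm, 𝒢.mul_inv] at e2
  have e3 := 𝒢.unit_mul (𝒢.inv (𝒢.inv g))
  rw [𝒢.r_inv, 𝒢.s_inv, e2] at e3
  exact e3.symm

variable [T2Space G] [SecondCountableTopology G] [LocallyCompactSpace G]
  [MeasurableSpace G] [BorelSpace G] [T2Space M] [LocallyCompactSpace M]

theorem UnitSpaceProper.isCompact (h : 𝒢.UnitSpaceProper) {A B : Set M} (hA : IsCompact A)
    (hB : IsCompact B) : IsCompact {g | 𝒢.r g ∈ A ∧ 𝒢.s g ∈ B} :=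
  h (A ×ˢ B) (hA.prod hB)

variable {lam : ∀ u : M, Measure (Fib 𝒢.r u)} (hlam : 𝒢.IsLeftHaarSystem lam)

namespace IsLeftHaarSystem

include hlam

theorem isFibreSystem : IsFibreSystem 𝒢.r lam where
  continuous_map := continuous_r
  finite u := by
    have := hlam.regular u
    infer_instance
  continuous := hlam.continuous

/-- A bump function at `g₀` vanishing off `V` has positive integral over the fibre through `g₀`, by
full support. By continuity of the system its integral over neighbouring fibres is positive as well,
so those fibres meet `V`. -/
theorem isOpenMap_r : IsOpenMap 𝒢.r := by
  intro V hV
  rw [isOpen_iff_mem_nhds]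
  rintro _ ⟨g₀, hg₀, rfl⟩
  obtain ⟨f, h1, h0, h2, h3⟩ := exists_continuous_one_zero_of_isCompact
    (isCompact_singleton (x := g₀)) hV.isClosed_compl
    (disjoint_singleton_left.2 fun h => h hg₀)
  have hr := hlam.isFibreSystem
  have := hr.finite (𝒢.r g₀)
  have := hlam.full_support (𝒢.r g₀)
  have hpos : 0 < ∫ g : Fib 𝒢.r (𝒢.r g₀), f g.1 ∂lam (𝒢.r g₀) := by
    refine Continuous.integral_pos_of_hasCompactSupport_nonneg_nonzero (x := ⟨g₀, rfl⟩)
      (f.continuous.comp continuous_subtype_val)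
      (hr.hasCompactSupport h2 fun g hg => image_eq_zero_of_notMem_tsupport hg)
      (fun g => (h3 g.1).1) ?_
    rw [h1 rfl]
    exact one_ne_zero
  filter_upwards [((hr.continuous_real f.continuous h2).tendsto _).eventually (lt_mem_nhds hpos)]
    with u hu
  by_contra hne
  have : (fun g : Fib 𝒢.r u => f g.1) = 0 := by
    funext g
    exact h0 fun hgV => hne ⟨g.1, hgV, g.2⟩
  rw [this] at hu
  simp at hu

/-- The saturation of an open `W` is `r (s⁻¹ W)`, which is open because `r` is. Hence the orbit map
is open, and finitely many compact neighbourhoods already cover the compact orbit space. -/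
theorem exists_isCompact_meets (hcompact : 𝒢.UnitSpaceGCompact) :
    ∃ A : Set M, IsCompact A ∧ ∀ u, ∃ g, 𝒢.r g = u ∧ 𝒢.s g ∈ A := by
  choose N hN hNu using fun u : M => exists_compact_mem_nhds u
  have : CompactSpace (Quotient 𝒢.orbitSetoid) := hcompact
  let q : M → Quotient 𝒢.orbitSetoid := Quotient.mk _
  obtain ⟨t, ht⟩ := isCompact_univ.elim_finite_subcover (fun u => q '' interior (N u)) (fun u => by
    refine isOpen_coinduced.2 ?_
    change IsOpen (q ⁻¹' (q '' interior (N u)))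
    have : q ⁻¹' (q '' interior (N u)) = 𝒢.r '' (𝒢.s ⁻¹' interior (N u)) := by
      ext v
      constructor
      · rintro ⟨w, hw, hwv⟩
        obtain ⟨g, hg1, hg2⟩ := Quotient.exact hwv
        exact ⟨g, by simpa [hg1] using hw, hg2⟩
      · rintro ⟨g, hg, rfl⟩
        exact ⟨𝒢.s g, hg, Quotient.sound ⟨g, rfl, rfl⟩⟩
    rw [this]
    exact hlam.isOpenMap_r _ (isOpen_interior.preimage continuous_s)) (fun x _ => by
      obtain ⟨u, rfl⟩ := Quotient.exists_rep x
      exact mem_iUnion.2 ⟨u, u, mem_interior_iff_mem_nhds.2 (hNu u), rfl⟩)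
  refine ⟨⋃ u ∈ t, N u, t.isCompact_biUnion fun u _ => hN u, fun u => ?_⟩
  obtain ⟨v, hv, w, hw, hwu⟩ := mem_iUnion₂.1 (ht (mem_univ (q u)))
  obtain ⟨g, hg1, hg2⟩ := Quotient.exact hwu
  exact ⟨g, hg2, mem_iUnion₂.2 ⟨v, hv, by rw [hg1]; exact interior_subset hw⟩⟩

variable (hproper : 𝒢.UnitSpaceProper) {h : M → ℝ} (hc : Continuous h) (hs : HasCompactSupport h)
include hproper hc hs

theorem hasCompactSupport_orbit {χ : M → ℝ} (hχs : HasCompactSupport χ) :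
    HasCompactSupport fun g => h (𝒢.s g) * χ (𝒢.r g) := by
  refine HasCompactSupport.intro (hproper.isCompact hχs hs) fun g hg => ?_
  by_cases h1 : 𝒢.r g ∈ tsupport χ
  · rw [image_eq_zero_of_notMem_tsupport fun h2 => hg ⟨h1, h2⟩, zero_mul]
  · rw [image_eq_zero_of_notMem_tsupport h1, mul_zero]

theorem integrable_orbit (u : M) : Integrable (fun g : Fib 𝒢.r u => h (𝒢.s g.1)) (lam u) :=
  hlam.isFibreSystem.integrable (hproper.isCompact (isCompact_singleton (x := u)) hs)
    (hc.comp (continuous_s.comp continuous_subtype_val))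
    fun g hg => image_eq_zero_of_notMem_tsupport fun h2 => hg ⟨g.2, h2⟩

/-- The function `h ∘ s` need not have compact support on `G`. Multiplying by `χ ∘ r`, with `χ = 1`
near `u`, makes it compactly supported by properness and leaves the nearby integrals unchanged. -/
theorem continuous_orbit : Continuous fun u => ∫ g : Fib 𝒢.r u, h (𝒢.s g.1) ∂lam u := by
  rw [continuous_iff_continuousAt]
  intro u
  obtain ⟨N, hN, hNu⟩ := exists_compact_mem_nhds u
  obtain ⟨χ, hχc, hχs, -, -, hχ1⟩ := exists_bump hN
  have h1 := hlam.isFibreSystem.continuous_real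
    ((hc.comp continuous_s).mul (hχc.comp continuous_r))
    (hlam.hasCompactSupport_orbit hproper hc hs hχs)
  refine h1.continuousAt.congr ?_
  filter_upwards [hNu] with v hv
  refine integral_congr_ae (.of_forall fun g => ?_)
  simp [g.2, hχ1 v hv]

/-- This is left invariance together with `s (g k) = s k`; the factor `χ ∘ r` only makes the test
function compactly supported. -/
theorem orbit_invariant (g : G) : ∫ k : Fib 𝒢.r (𝒢.s g), h (𝒢.s k.1) ∂lam (𝒢.s g) =
    ∫ k : Fib 𝒢.r (𝒢.r g), h (𝒢.s k.1) ∂lam (𝒢.r g) := by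
  obtain ⟨χ, hχc, hχs, -, -, hχ1⟩ := exists_bump (isCompact_singleton (x := 𝒢.r g))
  have h1 := hlam.left_invariant g (fun k => ((h (𝒢.s k) * χ (𝒢.r k) : ℝ) : ℂ))
    (Complex.continuous_ofReal.comp ((hc.comp continuous_s).mul (hχc.comp continuous_r)))
    ((hlam.hasCompactSupport_orbit hproper hc hs hχs).comp_left (g := fun x : ℝ => (x : ℂ)) rfl)
  rw [integral_complex_ofReal, integral_complex_ofReal, Complex.ofReal_inj] at h1
  refine Eq.trans ?_ (h1.trans ?_)
  · refine integral_congr_ae (.of_forall fun k => ?_)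
    simp only [𝒢.s_mul g k.1 k.2.symm, 𝒢.r_mul g k.1 k.2.symm, hχ1 _ rfl, mul_one]
  · refine integral_congr_ae (.of_forall fun k => ?_)
    simp only [k.2, hχ1 _ rfl, mul_one]

/-- The integral is constant on orbits, so its maximum over a compact set meeting every orbit bounds
it everywhere. Cocompactness enters the boundedness of the averaged operators here. -/
theorem exists_bound_orbit (hcompact : 𝒢.UnitSpaceGCompact) :
    ∃ C : ℝ, ∀ u, ∫ g : Fib 𝒢.r u, h (𝒢.s g.1) ∂lam u ≤ C := by
  obtain ⟨A, hA, hAm⟩ := hlam.exists_isCompact_meets hcompact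
  obtain ⟨C, hC⟩ := hA.bddAbove_image (hlam.continuous_orbit hproper hc hs).continuousOn
  refine ⟨C, fun u => ?_⟩
  obtain ⟨g, rfl, hg⟩ := hAm u
  rw [← hlam.orbit_invariant hproper hc hs]
  exact hC ⟨_, hg, rfl⟩

omit hc hs in
-- A bump `h` that is 1 on a compact set meeting every orbit has a positive orbit integral `k`. As
-- `k` is invariant, dividing `h` by it commutes with integration over the orbit.
theorem exists_cutoff (hcompact : 𝒢.UnitSpaceGCompact) :
    ∃ c : M → ℝ, Continuous c ∧ HasCompactSupport c ∧ (∀ u, 0 ≤ c u) ∧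
      ∀ u, ∫ g : Fib 𝒢.r u, c (𝒢.s g.1) ∂lam u = 1 := by
  obtain ⟨A, hA, hAm⟩ := hlam.exists_isCompact_meets hcompact
  obtain ⟨h, hc, hs, h0, -, h1⟩ := exists_bump hA
  set k : M → ℝ := fun u => ∫ g : Fib 𝒢.r u, h (𝒢.s g.1) ∂lam u with hk
  have hkc : Continuous k := hlam.continuous_orbit hproper hc hs
  have hpos : ∀ u, 0 < k u := by
    intro u
    obtain ⟨g, rfl, hg⟩ := hAm u
    have := hlam.isFibreSystem.finite (𝒢.r g)
    have := hlam.full_support (𝒢.r g)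
    refine Continuous.integral_pos_of_hasCompactSupport_nonneg_nonzero (x := ⟨g, rfl⟩)
      (hc.comp (continuous_s.comp continuous_subtype_val))
      (hlam.isFibreSystem.hasCompactSupport
        (hproper.isCompact (isCompact_singleton (x := 𝒢.r g)) hs)
        fun k hk => image_eq_zero_of_notMem_tsupport fun h2 => hk ⟨k.2, h2⟩)
      (fun g => h0 _) ?_
    rw [h1 _ hg]
    exact one_ne_zero
  refine ⟨fun u => h u / k u, hc.div hkc fun u => (hpos u).ne', ?_,
    fun u => div_nonneg (h0 u) (hpos u).le, fun u => ?_⟩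
  · simp only [div_eq_mul_inv]
    exact hs.mul_right
  · have : ∀ g : Fib 𝒢.r u, h (𝒢.s g.1) / k (𝒢.s g.1) = h (𝒢.s g.1) / k u := by
      rintro ⟨g, rfl⟩
      rw [show k (𝒢.s g) = k (𝒢.r g) from hlam.orbit_invariant hproper hc hs g]
    simp only [this]
    rw [integral_div]
    exact div_self (hpos u).ne'

end IsLeftHaarSystem

end LieGroupoid

end Groupoid

/-! ### Compactly supported sections of vector bundles and their extension. -/

section Sections

set_option linter.unusedSectionVars false

variable {X : Type*} [TopologicalSpace X] [MeasurableSpace X] [BorelSpace X]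
  {F : Type*} [NormedAddCommGroup F] [NormedSpace ℂ F]
  {E : X → Type*} [TopologicalSpace (TotalSpace F E)] [∀ x, NormedAddCommGroup (E x)]
  [∀ x, InnerProductSpace ℂ (E x)] [FiberBundle F E] [VectorBundle ℂ F E]

theorem continuousAt_smul_section {A : Type*} [TopologicalSpace A] {b : A → X} {a : A}
    {f : ∀ a, E (b a)} {c : A → ℂ} (hc : ContinuousAt c a)
    (hf : ContinuousAt (fun a => (⟨b a, f a⟩ : TotalSpace F E)) a) :
    ContinuousAt (fun a => (⟨b a, c a • f a⟩ : TotalSpace F E)) a := by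
  have h1 := (FiberBundle.continuousAt_totalSpace F _).1 hf
  refine (FiberBundle.continuousAt_totalSpace F _).2 ⟨h1.1, ?_⟩
  refine (hc.smul h1.2).congr ?_
  have hb : ∀ᶠ d in 𝓝 a, b d ∈ (trivializationAt F E (b a)).baseSet :=
    h1.1.eventually ((trivializationAt F E (b a)).open_baseSet.mem_nhds
      (FiberBundle.mem_baseSet_trivializationAt F E (b a)))
  filter_upwards [hb] with d hd
  exact (((trivializationAt F E (b a)).linear ℂ hd).map_smul (c d) (f d)).symm

theorem continuous_sub_section {A : Type*} [TopologicalSpace A] {b : A → X}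
    {f g : ∀ a, E (b a)}
    (hf : Continuous fun a => (⟨b a, f a⟩ : TotalSpace F E))
    (hg : Continuous fun a => (⟨b a, g a⟩ : TotalSpace F E)) :
    Continuous fun a => (⟨b a, f a - g a⟩ : TotalSpace F E) := by
  have := continuous_add_section hf (continuous_smul_section (-1) hg)
  simpa [sub_eq_add_neg] using this

variable (F E) in
/-- The underlying functions of compactly supported continuous sections. -/
def ccSubmodule [T2Space X] : Submodule ℂ (∀ x, E x) where
  carrier := {f | Continuous (fun x => (⟨x, f x⟩ : TotalSpace F E)) ∧
    ∃ K : Set X, IsCompact K ∧ ∀ x ∉ K, f x = 0}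
  add_mem' := by
    rintro f g ⟨hf, K, hK, hK'⟩ ⟨hg, L, hL, hL'⟩
    refine ⟨continuous_add_section hf hg, K ∪ L, hK.union hL, fun x hx => ?_⟩
    rw [mem_union, not_or] at hx
    simp [hK' x hx.1, hL' x hx.2]
  zero_mem' := ⟨continuous_zero_section continuous_id, ∅, isCompact_empty, fun _ _ => rfl⟩
  smul_mem' := by
    rintro c f ⟨hf, K, hK, hK'⟩
    exact ⟨continuous_smul_section c hf, K, hK, fun x hx => by simp [hK' x hx]⟩

/-- The compactly supported section defined by an element of `ccSubmodule`. -/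
def CcSection.ofMem [T2Space X] {f : ∀ x, E x} (hf : f ∈ ccSubmodule F E) : CcSection F E where
  toFun := f
  continuous := hf.1
  compact_support := by
    obtain ⟨-, K, hK, h⟩ := hf
    refine hK.of_isClosed_subset isClosed_closure (closure_minimal (fun x hx => ?_) hK.isClosed)
    by_contra hxK
    exact hx (h x hxK)

theorem CcSection.toFun_mem [T2Space X] (e : CcSection F E) : e.toFun ∈ ccSubmodule F E :=
  ⟨e.continuous, _, e.compact_support, fun x hx => by
    by_contra h
    exact hx (subset_closure h)⟩

theorem mul_mem_ccSubmodule [T2Space X] {f : ∀ x, E x} (hf : f ∈ ccSubmodule F E) {c : X → ℂ}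
    (hc : Continuous c) : (fun x => c x • f x) ∈ ccSubmodule F E := by
  obtain ⟨h, K, hK, hK'⟩ := hf
  refine ⟨?_, K, hK, fun x hx => by simp [hK' x hx]⟩
  rw [continuous_iff_continuousAt]
  exact fun x => continuousAt_smul_section hc.continuousAt h.continuousAt

/-- Produces global sections from local coordinates: the trivialization gives continuity on the
support of `ρ`, and off the support the section is locally zero. -/
theorem smul_symm_mem_ccSubmodule [T2Space X] (t : Trivialization F (π F E)) {ρ : X → ℝ}
    (hρ : Continuous ρ) (hρs : HasCompactSupport ρ) (hρt : tsupport ρ ⊆ t.baseSet)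
    {g : X → F} (hg : Continuous g) :
    (fun x => (ρ x : ℂ) • t.symm x (g x)) ∈ ccSubmodule F E := by
  refine ⟨?_, tsupport ρ, hρs, fun x hx => by simp [image_eq_zero_of_notMem_tsupport hx]⟩
  rw [continuous_iff_continuousAt]
  intro x
  by_cases hx : x ∈ tsupport ρ
  · refine continuousAt_smul_section (Complex.continuous_ofReal.comp hρ).continuousAt ?_
    have h1 := t.continuousOn_symm.continuousAt (x := (x, g x))
      ((t.open_baseSet.prod isOpen_univ).mem_nhds ⟨hρt hx, trivial⟩)
    exact ContinuousAt.comp (f := fun x => (x, g x)) h1 (by fun_prop)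
  · refine (continuous_zero_section (F := F) (E := E) continuous_id).continuousAt.congr ?_
    filter_upwards [(isClosed_tsupport ρ).isOpen_compl.mem_nhds hx] with y hy
    simp [image_eq_zero_of_notMem_tsupport hy]

/-- Tietze extension for sections of vector bundles. -/
theorem exists_extension_section [T2Space X] [LocallyCompactSpace X] [SecondCountableTopology X]
    [FiniteDimensional ℂ F] {K : Set X} (hK : IsCompact K) (f : ∀ x : K, E x)
    (hf : Continuous fun x : K => (⟨x, f x⟩ : TotalSpace F E)) :
    ∃ e ∈ ccSubmodule F E, ∀ x : K, e x = f x := by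
  have hloc : ∀ x : X, ∃ C : Set X, IsCompact C ∧ C ∈ 𝓝 x ∧ C ⊆ (trivializationAt F E x).baseSet :=
    fun x => by
      obtain ⟨C, h1, h2, h3⟩ := local_compact_nhds ((trivializationAt F E x).open_baseSet.mem_nhds
        (FiberBundle.mem_baseSet_trivializationAt F E x))
      exact ⟨C, h3, h1, h2⟩
  choose C hC hCx hCt using hloc
  obtain ⟨t, ρ, -, hρc, hρs, -, hρC, hρ1, -⟩ := exists_finite_partition hK C fun x _ => hCx x
  -- In the `i`-th trivialization `f` is an `F`-valued map on the closed set `K ∩ C i`, where the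
  -- Tietze theorem applies because `F` is finite dimensional. Gluing with `ρ` returns `f` on `K`,
  -- each summand there being `ρ i x • f x`.
  have hg : ∀ i : t, ∃ g : C(X, F), ∀ x (hx : x ∈ K), x ∈ C i →
      g x = ((trivializationAt F E (i : X)) ⟨x, f ⟨x, hx⟩⟩).2 := by
    intro i
    have h1 : Continuous fun x : ↥(K ∩ C i) =>
        ((trivializationAt F E (i : X)) ⟨x, f ⟨x, x.2.1⟩⟩).2 := by
      have h2 : Continuous fun x : ↥(K ∩ C i) => (⟨x, f ⟨x, x.2.1⟩⟩ : TotalSpace F E) :=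
        hf.comp (f := fun x : ↥(K ∩ C i) => (⟨x, x.2.1⟩ : K)) (by fun_prop)
      refine continuous_snd.comp ((trivializationAt F E (i : X)).continuousOn.comp_continuous h2 ?_)
      intro x
      rw [Trivialization.mem_source]
      exact hCt _ x.2.2
    have : TietzeExtension F := TietzeExtension.of_tvs ℂ
    obtain ⟨g, hg⟩ := ContinuousMap.exists_restrict_eq (hK.inter (hC i)).isClosed ⟨_, h1⟩
    refine ⟨g, fun x hx hxi => ?_⟩
    exact DFunLike.congr_fun hg (⟨x, hx, hxi⟩ : ↥(K ∩ C i))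
  choose g hg using hg
  refine ⟨∑ i : t, fun x => (ρ i x : ℂ) • (trivializationAt F E (i : X)).symm x (g i x),
    Submodule.sum_mem _ fun i _ => smul_symm_mem_ccSubmodule _ (hρc i) (hρs i)
      ((hρC i).trans (interior_subset.trans (hCt i))) (g i).continuous, fun x => ?_⟩
  rw [Finset.sum_apply]
  have h1 : ∀ i : t, (ρ i x : ℂ) • (trivializationAt F E (i : X)).symm x (g i x) =
      (ρ i x : ℂ) • f x := by
    intro i
    by_cases hi : (x : X) ∈ tsupport (ρ i)
    · have hx := interior_subset (hρC i hi)
      rw [hg i x x.2 hx, Trivialization.symm_apply_apply_mk _ (hCt _ hx)]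
    · simp [image_eq_zero_of_notMem_tsupport hi]
  simp only [h1, ← Finset.sum_smul]
  rw [show ∑ i : t, (ρ i x : ℂ) = 1 by exact_mod_cast hρ1 x x.2, one_smul]

end Sections

/-! ### Fibre volumes in coordinates and continuity of fibre integrals. -/

section FibreVolume

set_option linter.unusedSectionVars false

variable {dM dX j : ℕ} {M : Type*}
  [TopologicalSpace M] [ChartedSpace (EuclideanSpace ℝ (Fin dM)) M]
  {X : Type*} [TopologicalSpace X] [ChartedSpace (EuclideanSpace ℝ (Fin dX)) X]
  [MeasurableSpace X] [BorelSpace X] {p : X → M} {h : TangentForm dX X}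
  {μ : ∀ u : M, Measure (Fib p u)}

namespace FibredChart

variable (ψ : FibredChart dM dX j p)

/-- The density of the fibre volumes in the coordinates of a fibred chart. -/
noncomputable def density (h : TangentForm dX X) (q : M × EuclideanSpace ℝ (Fin j)) : ℝ :=
  Real.sqrt ‖(ψ.gram h q).det‖

theorem continuousOn_density (hh : IsVerticalHermitianMetric dM j p h) :
    ContinuousOn (ψ.density h) ψ.toHomeo.target := by
  rw [continuousOn_iff_continuous_domRestrict]
  refine Real.continuous_sqrt.comp (continuous_norm.comp (Continuous.matrix_det ?_))
  refine continuous_pi fun i => continuous_pi fun k => ?_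
  exact continuousOn_iff_continuous_domRestrict.1 (hh.continuous ψ i k)

/-- The part of a fibre lying in the domain of a fibred chart. -/
def fibSource (u : M) : Set (Fib p u) := {x | x.1 ∈ ψ.toHomeo.source}

/-- The coordinate domain of a fibre. -/
def fibTarget (u : M) : Set (EuclideanSpace ℝ (Fin j)) := {y | (u, y) ∈ ψ.toHomeo.target}

open Classical in
/-- The fibre coordinates, extended by zero. -/
noncomputable def coord (u : M) : Fib p u → EuclideanSpace ℝ (Fin j) :=
  (ψ.fibSource u).piecewise (fun x => (ψ.toHomeo x.1).2) 0

theorem isOpen_fibSource (u : M) : IsOpen (ψ.fibSource u) :=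
  ψ.toHomeo.open_source.preimage continuous_subtype_val

theorem isOpen_fibTarget (u : M) : IsOpen (ψ.fibTarget u) :=
  ψ.toHomeo.open_target.preimage (by fun_prop)

theorem coord_eq {u : M} {x : Fib p u} (hx : x ∈ ψ.fibSource u) :
    (u, ψ.coord u x) = ψ.toHomeo x.1 := by
  classical
  rw [coord, piecewise_eq_of_mem _ _ _ hx]
  exact Prod.ext ((x.2.symm.trans (ψ.fst_eq _ hx).symm)) rfl

theorem coord_mem {u : M} {x : Fib p u} (hx : x ∈ ψ.fibSource u) :
    ψ.coord u x ∈ ψ.fibTarget u := by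
  rw [fibTarget, mem_ofPred_eq, ψ.coord_eq hx]
  exact ψ.toHomeo.map_source hx

theorem symm_coord {u : M} {x : Fib p u} (hx : x ∈ ψ.fibSource u) :
    ψ.toHomeo.symm (u, ψ.coord u x) = x.1 := by
  rw [ψ.coord_eq hx]
  exact ψ.toHomeo.left_inv hx

theorem p_symm {q : M × EuclideanSpace ℝ (Fin j)} (hq : q ∈ ψ.toHomeo.target) :
    p (ψ.toHomeo.symm q) = q.1 := by
  rw [← ψ.fst_eq _ (ψ.toHomeo.map_target hq), ψ.toHomeo.right_inv hq]

theorem exists_coord_eq {u : M} {y : EuclideanSpace ℝ (Fin j)} (hy : y ∈ ψ.fibTarget u) :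
    ∃ x ∈ ψ.fibSource u, ψ.coord u x = y := by
  have hy' : (u, y) ∈ ψ.toHomeo.target := hy
  have h1 : (⟨_, ψ.p_symm hy'⟩ : Fib p u) ∈ ψ.fibSource u := ψ.toHomeo.map_target hy'
  have h2 := ψ.coord_eq h1
  rw [ψ.toHomeo.right_inv hy'] at h2
  exact ⟨_, h1, (Prod.ext_iff.1 h2).2⟩

theorem measurable_coord (u : M) : Measurable (ψ.coord u) := by
  classical
  refine ContinuousOn.measurable_piecewise ?_ continuousOn_const (ψ.isOpen_fibSource u).measurableSet
  exact continuous_snd.comp_continuousOn (ψ.toHomeo.continuousOn.comp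
    continuous_subtype_val.continuousOn fun x hx => hx)

theorem setOf_symm_eq {u : M} (A : Set (Fib p u)) (hA : A ⊆ ψ.fibSource u) :
    {y : EuclideanSpace ℝ (Fin j) | (u, y) ∈ ψ.toHomeo.target ∧
        ∃ a ∈ A, a.1 = ψ.toHomeo.symm (u, y)} = ψ.coord u '' A := by
  ext y
  constructor
  · rintro ⟨hy, a, ha, hay⟩
    refine ⟨a, ha, ?_⟩
    have h1 := ψ.coord_eq (hA ha)
    rw [hay, ψ.toHomeo.right_inv hy] at h1
    exact (Prod.ext_iff.1 h1).2
  · rintro ⟨a, ha, rfl⟩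
    exact ⟨ψ.coord_mem (hA ha), a, ha, (ψ.symm_coord (hA ha)).symm⟩

theorem measure_eq (hμ : IsFibreVolume dM j p h μ) (u : M) {A : Set (Fib p u)}
    (hA : A ⊆ ψ.fibSource u) (hAm : MeasurableSet A) :
    μ u A = ∫⁻ y in ψ.coord u '' A, ENNReal.ofReal (ψ.density h (u, y)) := by
  rw [hμ.apply_eq u ψ A hAm hA, ψ.setOf_symm_eq A hA]
  rfl

theorem image_coord_inter {u : M} (B : Set (EuclideanSpace ℝ (Fin j))) :
    ψ.coord u '' (ψ.fibSource u ∩ ψ.coord u ⁻¹' B) = B ∩ ψ.fibTarget u := by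
  ext y
  constructor
  · rintro ⟨a, ha, rfl⟩
    exact ⟨ha.2, ψ.coord_mem ha.1⟩
  · rintro ⟨hB, hy⟩
    obtain ⟨x, hx, rfl⟩ := ψ.exists_coord_eq hy
    exact ⟨x, ⟨hx, hB⟩, rfl⟩

/-- The defining formula for volumes of sets is recast as a statement about measures, so that
vector-valued integrals can be transported. -/
theorem map_coord (hμ : IsFibreVolume dM j p h μ) (u : M) :
    Measure.map (ψ.coord u) ((μ u).restrict (ψ.fibSource u)) =
      (volume.restrict (ψ.fibTarget u)).withDensity
        fun y => ENNReal.ofReal (ψ.density h (u, y)) := by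
  ext B hB
  rw [Measure.map_apply (ψ.measurable_coord u) hB, withDensity_apply _ hB,
    Measure.restrict_apply (ψ.measurable_coord u hB), Measure.restrict_restrict hB, inter_comm,
    ψ.measure_eq hμ u inter_subset_left
      ((ψ.isOpen_fibSource u).measurableSet.inter (ψ.measurable_coord u hB)),
    ψ.image_coord_inter]

theorem integral_eq (hh : IsVerticalHermitianMetric dM j p h) (hμ : IsFibreVolume dM j p h μ)
    {f : X → ℂ} (hf : Continuous f) (hfs : Function.support f ⊆ ψ.toHomeo.source) (u : M) :
    ∫ x : Fib p u, f x.1 ∂μ u =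
      ∫ y in ψ.fibTarget u, ψ.density h (u, y) • f (ψ.toHomeo.symm (u, y)) := by
  have hT := (ψ.isOpen_fibTarget u).measurableSet
  have h1 : ∫ x : Fib p u, f x.1 ∂μ u = ∫ x in ψ.fibSource u, f x.1 ∂μ u :=
    (setIntegral_eq_integral_of_forall_compl_eq_zero fun x hx => by
      by_contra hne
      exact hx (hfs hne)).symm
  have h2 : ∫ x in ψ.fibSource u, f x.1 ∂μ u =
      ∫ x in ψ.fibSource u, f (ψ.toHomeo.symm (u, ψ.coord u x)) ∂μ u :=
    setIntegral_congr_fun (ψ.isOpen_fibSource u).measurableSet fun x hx => by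
      simp only [ψ.symm_coord hx]
  have hg : ContinuousOn (fun y => f (ψ.toHomeo.symm (u, y))) (ψ.fibTarget u) :=
    hf.comp_continuousOn (ψ.toHomeo.continuousOn_symm.comp (by fun_prop) fun y hy => hy)
  have hd : ContinuousOn (fun y => ψ.density h (u, y)) (ψ.fibTarget u) :=
    (ψ.continuousOn_density hh).comp (by fun_prop) fun y hy => hy
  rw [h1, h2, ← integral_map (φ := ψ.coord u) (f := fun y => f (ψ.toHomeo.symm (u, y)))
    (ψ.measurable_coord u).aemeasurable, ψ.map_coord hμ,
    integral_withDensity_eq_integral_toReal_smul₀]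
  · refine setIntegral_congr_fun hT fun y _ => ?_
    rw [ENNReal.toReal_ofReal (show 0 ≤ ψ.density h (u, y) from Real.sqrt_nonneg _)]
  · exact (ENNReal.continuous_ofReal.comp_continuousOn hd).aemeasurable hT
  · exact .of_forall fun y => ENNReal.ofReal_lt_top
  · rw [ψ.map_coord hμ]
    exact (hg.aestronglyMeasurable hT).mono_ac (withDensity_absolutelyContinuous _ _)

/-- In coordinates the measure is the fixed Lebesgue measure and the dependence on `u` sits in the
integrand `Θ`, which is continuous with compact support on `M × ℝʲ`. -/
theorem continuous_integral [FirstCountableTopology M] [LocallyCompactSpace M] [T2Space M]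
    (hh : IsVerticalHermitianMetric dM j p h) (hμ : IsFibreVolume dM j p h μ)
    {f : X → ℂ} (hf : Continuous f) (hfc : HasCompactSupport f)
    (hfs : tsupport f ⊆ ψ.toHomeo.source) :
    Continuous fun u => ∫ x : Fib p u, f x.1 ∂μ u := by
  classical
  set K := ψ.toHomeo '' tsupport f with hK
  have hKc : IsCompact K := IsCompact.image_of_continuousOn hfc (ψ.toHomeo.continuousOn.mono hfs)
  set Θ : M × EuclideanSpace ℝ (Fin j) → ℂ :=
    ψ.toHomeo.target.indicator fun q => ψ.density h q • f (ψ.toHomeo.symm q) with hΘ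
  have h0 : ∀ q ∉ K, Θ q = 0 := by
    intro q hq
    by_cases hqt : q ∈ ψ.toHomeo.target
    · have hs : ψ.toHomeo.symm q ∉ tsupport f := fun hs => hq ⟨_, hs, ψ.toHomeo.right_inv hqt⟩
      rw [hΘ, indicator_of_mem hqt, image_eq_zero_of_notMem_tsupport hs, smul_zero]
    · rw [hΘ, indicator_of_notMem hqt]
  -- Extension by zero is continuous because `K` is closed and contained in the open target: a point
  -- outside the target has a neighbourhood on which `Θ` vanishes.
  have hΘc : Continuous Θ := by
    rw [continuous_iff_continuousAt]
    intro q
    by_cases hqt : q ∈ ψ.toHomeo.target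
    · have h1 : ContinuousOn (fun q => ψ.density h q • f (ψ.toHomeo.symm q)) ψ.toHomeo.target :=
        (ψ.continuousOn_density hh).smul (hf.comp_continuousOn ψ.toHomeo.continuousOn_symm)
      refine (h1.continuousAt (ψ.toHomeo.open_target.mem_nhds hqt)).congr ?_
      filter_upwards [ψ.toHomeo.open_target.mem_nhds hqt] with r hr
      rw [hΘ, indicator_of_mem hr]
    · have hqK : q ∉ K := by
        rintro ⟨x, hx, rfl⟩
        exact hqt (ψ.toHomeo.map_source (hfs hx))
      refine (continuousAt_const (y := (0 : ℂ))).congr ?_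
      filter_upwards [hKc.isClosed.isOpen_compl.mem_nhds hqK] with r hr
      exact (h0 r hr).symm
  have h1 := continuous_parametric_integral_of_continuous (μ := (volume : Measure (EuclideanSpace ℝ (Fin j))))
    (f := fun u y => Θ (u, y)) hΘc (hKc.image continuous_snd)
  refine h1.congr fun u => ?_
  have h2 : ∫ y in Prod.snd '' K, Θ (u, y) = ∫ y, Θ (u, y) :=
    setIntegral_eq_integral_of_forall_compl_eq_zero fun y hy =>
      h0 _ fun hK => hy ⟨(u, y), hK, rfl⟩
  rw [ψ.integral_eq hh hμ hf ((subset_tsupport f).trans hfs) u, h2,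
    ← integral_indicator (ψ.isOpen_fibTarget u).measurableSet]
  rfl

end FibredChart

/-- Integrals over the fibres of a compactly supported continuous function depend continuously
on the fibre. -/
theorem continuous_fibre_integral [FirstCountableTopology M] [LocallyCompactSpace M] [T2Space M]
    [LocallyCompactSpace X] [T2Space X]
    (hh : IsVerticalHermitianMetric dM j p h) (hμ : IsFibreVolume dM j p h μ)
    (hψ : ∀ x, ∃ ψ : FibredChart dM dX j p, x ∈ ψ.toHomeo.source)
    {f : X → ℂ} (hf : Continuous f) (hfc : HasCompactSupport f) :
    Continuous fun u => ∫ x : Fib p u, f x.1 ∂μ u := by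
  choose ψ hψ using hψ
  obtain ⟨t, ρ, -, hρc, hρs, -, hρψ, hρ1, -⟩ := exists_finite_partition hfc
    (fun x => (ψ x).toHomeo.source) fun x _ => (ψ x).toHomeo.open_source.mem_nhds (hψ x)
  have hc : ∀ i : t, Continuous fun x => (ρ i x : ℂ) * f x := fun i =>
    (Complex.continuous_ofReal.comp (hρc i)).mul hf
  have hs : ∀ i : t, HasCompactSupport fun x => (ρ i x : ℂ) * f x := fun i => hfc.mul_left
  have key : ∀ u, ∫ x : Fib p u, f x.1 ∂μ u =
      ∑ i : t, ∫ x : Fib p u, (ρ i x.1 : ℂ) * f x.1 ∂μ u := by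
    intro u
    have := hμ.finite u
    rw [← integral_finsetSum]
    · refine integral_congr_ae (.of_forall fun x => ?_)
      simp only [← Finset.sum_mul]
      by_cases hx : x.1 ∈ tsupport f
      · rw [show ∑ i : t, (ρ i x.1 : ℂ) = 1 by exact_mod_cast hρ1 x.1 hx, one_mul]
      · simp [image_eq_zero_of_notMem_tsupport hx]
    · intro i _
      obtain ⟨C, hC⟩ := (hs i).exists_bound_of_continuous (hc i)
      refine Integrable.of_bound (C := C) ?_ (.of_forall fun x => hC x.1)
      exact ((hc i).measurable.comp measurable_subtype_coe).aestronglyMeasurable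
  simp only [key]
  refine continuous_finsetSum _ fun i _ => (ψ i).continuous_integral hh hμ (hc i) (hs i) ?_
  refine (closure_mono fun x hx => ?_).trans ((hρψ i).trans interior_subset)
  intro h0
  exact hx (by simp [h0])

end FibreVolume

/-! ### Transition maps of the action and the transformation of the metric density. -/

section Action

set_option linter.unusedSectionVars false

variable {dG dM dX j : ℕ} {G M X : Type*}
  [TopologicalSpace G] [ChartedSpace (EuclideanSpace ℝ (Fin dG)) G]
  [TopologicalSpace M] [ChartedSpace (EuclideanSpace ℝ (Fin dM)) M]
  {𝒢 : LieGroupoid dG dM G M}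
  [TopologicalSpace X] [ChartedSpace (EuclideanSpace ℝ (Fin dX)) X]
  [MeasurableSpace X] [BorelSpace X]

theorem bilinear_sum_apply {V : Type*} [AddCommGroup V] [Module ℝ V] (B : V →ₗ[ℝ] V →ₗ[ℝ] ℂ)
    (P : Matrix (Fin j) (Fin j) ℝ) (c : Fin j → V) (i k : Fin j) :
    B (∑ l, P l i • c l) (∑ l, P l k • c l) = ((P.map Complex.ofRealHom).transpose *
      Matrix.of (fun a b => B (c a) (c b)) * P.map Complex.ofRealHom) i k := by
  simp only [map_sum, map_smul, LinearMap.sum_apply, LinearMap.smul_apply, Matrix.mul_apply,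
    Matrix.transpose_apply, Matrix.map_apply, Finset.sum_mul, Matrix.of_apply, Finset.smul_sum,
    Complex.real_smul, Complex.ofRealHom_eq_coe]
  refine Finset.sum_congr rfl fun a _ => Finset.sum_congr rfl fun b _ => ?_
  ring

namespace FibredChart

variable {p : X → M} (ψ : FibredChart dM dX j p)

theorem mdifferentiableAt_symm {u : M} {y : EuclideanSpace ℝ (Fin j)} (hy : y ∈ ψ.fibTarget u) :
    MDifferentiableAt (𝓡 j) (𝓡 dX) (fun y => ψ.toHomeo.symm (u, y)) y := by
  have h1 : ContMDiffAt ((𝓡 dM).prod (𝓡 j)) (𝓡 dX) ∞ ψ.toHomeo.symm (u, y) :=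
    ψ.smooth_symm.contMDiffAt (ψ.toHomeo.open_target.mem_nhds hy)
  have h2 : ContMDiffAt (𝓡 j) ((𝓡 dM).prod (𝓡 j)) ∞ (fun y : EuclideanSpace ℝ (Fin j) => (u, y)) y :=
    contMDiffAt_const.prodMk contMDiffAt_id
  exact (h1.comp (f := fun y : EuclideanSpace ℝ (Fin j) => (u, y)) y h2).mdifferentiableAt
    (by simp)

/-- Along a fibre, `p` is constant. Verticality of the coordinate vectors is what allows the
isometry hypothesis to be applied to them. -/
theorem mfderiv_p_coordVec (hp : MDifferentiable (𝓡 dX) (𝓡 dM) p) {u : M}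
    {y : EuclideanSpace ℝ (Fin j)} (hy : y ∈ ψ.fibTarget u) (i : Fin j) :
    mfderiv (𝓡 dX) (𝓡 dM) p (ψ.toHomeo.symm (u, y)) (ψ.coordVec (u, y) i) = 0 := by
  have h1 := (ψ.mdifferentiableAt_symm hy).hasMFDerivAt
  have h2 := (hp (ψ.toHomeo.symm (u, y))).hasMFDerivAt
  have h3 := HasMFDerivAt.comp y h2 h1
  have h4 : HasMFDerivAt (𝓡 j) (𝓡 dM) (p ∘ fun y => ψ.toHomeo.symm (u, y)) y 0 := by
    refine (hasMFDerivAt_const u y).congr_of_eventuallyEq ?_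
    filter_upwards [(ψ.isOpen_fibTarget u).mem_nhds hy] with z hz
    exact ψ.p_symm (q := (u, z)) hz
  have h5 := hasMFDerivAt_unique h3 h4
  exact DFunLike.congr_fun h5 (EuclideanSpace.single i (1 : ℝ) : EuclideanSpace ℝ (Fin j))

end FibredChart

variable (𝒳 : GManifold 𝒢 dX X) {h : TangentForm dX X}

/-- The transition map between fibred charts induced by the action of a groupoid element. -/
noncomputable def transition (ψ₁ ψ₂ : FibredChart dM dX j 𝒳.p) (k : G) (y : EuclideanSpace ℝ (Fin j)) :
    EuclideanSpace ℝ (Fin j) :=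
  (ψ₂.toHomeo (𝒳.act k (ψ₁.toHomeo.symm (𝒢.s k, y)))).2

theorem contMDiffOn_act (k : G) :
    ContMDiffOn (𝓡 dX) (𝓡 dX) ∞ (𝒳.act k) (𝒳.p ⁻¹' {𝒢.s k}) :=
  𝒳.smooth_act.comp (contMDiffOn_const.prodMk contMDiffOn_id) fun x hx => (hx : 𝒳.p x = _).symm

variable (ψ₁ ψ₂ : FibredChart dM dX j 𝒳.p) {k : G} {y : EuclideanSpace ℝ (Fin j)}
  (hy : y ∈ ψ₁.fibTarget (𝒢.s k))
  (hy₂ : 𝒳.act k (ψ₁.toHomeo.symm (𝒢.s k, y)) ∈ ψ₂.toHomeo.source)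
include hy

/-- The map `x ↦ kx` is meaningful only on one fibre, so it has just a derivative within that fibre.
Precomposition with fibre coordinates, defined on an open subset of `ℝʲ`, turns it into an ordinary
derivative. -/
theorem hasMFDerivAt_act : HasMFDerivAt (𝓡 j) (𝓡 dX)
    (𝒳.act k ∘ fun y => ψ₁.toHomeo.symm (𝒢.s k, y)) y
    ((mfderivWithin (𝓡 dX) (𝓡 dX) (𝒳.act k) (𝒳.p ⁻¹' {𝒢.s k}) (ψ₁.toHomeo.symm (𝒢.s k, y))).comp
      (mfderiv (𝓡 j) (𝓡 dX) (fun y => ψ₁.toHomeo.symm (𝒢.s k, y)) y)) := by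
  have h1 := (ψ₁.mdifferentiableAt_symm hy).hasMFDerivAt.hasMFDerivWithinAt
    (s := ψ₁.fibTarget (𝒢.s k))
  have h2 := ((contMDiffOn_act 𝒳 k (ψ₁.toHomeo.symm (𝒢.s k, y))
    (ψ₁.p_symm (q := (𝒢.s k, y)) hy)).mdifferentiableWithinAt (by simp)).hasMFDerivWithinAt
  have h0 : ψ₁.fibTarget (𝒢.s k) ⊆
      (fun y => ψ₁.toHomeo.symm (𝒢.s k, y)) ⁻¹' (𝒳.p ⁻¹' {𝒢.s k}) :=
    fun z hz => ψ₁.p_symm (q := (𝒢.s k, z)) hz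
  have h3 := HasMFDerivWithinAt.comp y h2 h1 h0
  exact h3.hasMFDerivAt ((ψ₁.isOpen_fibTarget _).mem_nhds hy)

include hy₂

theorem eventually_transition : ∀ᶠ z in 𝓝 y, 𝒳.act k (ψ₁.toHomeo.symm (𝒢.s k, z)) =
    ψ₂.toHomeo.symm (𝒢.r k, transition 𝒳 ψ₁ ψ₂ k z) := by
  filter_upwards [(hasMFDerivAt_act 𝒳 ψ₁ hy).continuousAt.eventually
    (ψ₂.toHomeo.open_source.mem_nhds hy₂), (ψ₁.isOpen_fibTarget _).mem_nhds hy] with z hz hz1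
  have hp : 𝒳.p (𝒳.act k (ψ₁.toHomeo.symm (𝒢.s k, z))) = 𝒢.r k :=
    𝒳.p_act _ _ (ψ₁.p_symm (q := (𝒢.s k, z)) hz1).symm
  have : (𝒢.r k, transition 𝒳 ψ₁ ψ₂ k z) = ψ₂.toHomeo (𝒳.act k (ψ₁.toHomeo.symm (𝒢.s k, z))) :=
    Prod.ext (hp.symm.trans (ψ₂.fst_eq _ hz).symm) rfl
  rw [this]
  exact (ψ₂.toHomeo.left_inv hz).symm

theorem transition_mem : transition 𝒳 ψ₁ ψ₂ k y ∈ ψ₂.fibTarget (𝒢.r k) := by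
  have hp : 𝒳.p (𝒳.act k (ψ₁.toHomeo.symm (𝒢.s k, y))) = 𝒢.r k :=
    𝒳.p_act _ _ (ψ₁.p_symm (q := (𝒢.s k, y)) hy).symm
  have : (𝒢.r k, transition 𝒳 ψ₁ ψ₂ k y) = ψ₂.toHomeo (𝒳.act k (ψ₁.toHomeo.symm (𝒢.s k, y))) :=
    Prod.ext (hp.symm.trans (ψ₂.fst_eq _ hy₂).symm) rfl
  change (𝒢.r k, transition 𝒳 ψ₁ ψ₂ k y) ∈ ψ₂.toHomeo.target
  rw [this]
  exact ψ₂.toHomeo.map_source hy₂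

theorem hasFDerivAt_transition :
    HasFDerivAt (transition 𝒳 ψ₁ ψ₂ k) (fderiv ℝ (transition 𝒳 ψ₁ ψ₂ k) y) y := by
  have h1 := (hasMFDerivAt_act 𝒳 ψ₁ hy).mdifferentiableAt
  have h2 : MDifferentiableAt (𝓡 dX) ((𝓡 dM).prod (𝓡 j)) ψ₂.toHomeo
      (𝒳.act k (ψ₁.toHomeo.symm (𝒢.s k, y))) :=
    (ψ₂.smooth.contMDiffAt (ψ₂.toHomeo.open_source.mem_nhds hy₂)).mdifferentiableAt (by simp)
  have h3 := mdifferentiableAt_snd.comp y (MDifferentiableAt.comp y h2 h1)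
  exact (mdifferentiableAt_iff_differentiableAt.1 h3).hasFDerivAt

/-- The action in coordinates is `ψ₂⁻¹ ∘ transition`; uniqueness of the derivative equates the two
chain rules. Both sides are read in the model space because the base points agree only
propositionally. -/
theorem mfderiv_act_coordVec (i : Fin j) :
    (mfderivWithin (𝓡 dX) (𝓡 dX) (𝒳.act k) (𝒳.p ⁻¹' {𝒢.s k}) (ψ₁.toHomeo.symm (𝒢.s k, y))
      (ψ₁.coordVec (𝒢.s k, y) i) : EuclideanSpace ℝ (Fin dX)) =
    ∑ l, (fderiv ℝ (transition 𝒳 ψ₁ ψ₂ k) y (EuclideanSpace.single i 1)) l •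
      (ψ₂.coordVec (𝒢.r k, transition 𝒳 ψ₁ ψ₂ k y) l : EuclideanSpace ℝ (Fin dX)) := by
  have h1 := hasMFDerivAt_act 𝒳 ψ₁ hy
  have h2 := (ψ₂.mdifferentiableAt_symm (transition_mem 𝒳 ψ₁ ψ₂ hy hy₂)).hasMFDerivAt
  have h3 := HasMFDerivAt.comp y h2 (hasFDerivAt_transition 𝒳 ψ₁ ψ₂ hy hy₂).hasMFDerivAt
  have h4 := h3.congr_of_eventuallyEq (eventually_transition 𝒳 ψ₁ ψ₂ hy hy₂)
  have h5 := hasMFDerivAt_unique h1 h4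
  have h6 := DFunLike.congr_fun h5 (EuclideanSpace.single i (1 : ℝ) : EuclideanSpace ℝ (Fin j))
  refine Eq.trans h6 ?_
  set w : EuclideanSpace ℝ (Fin j) :=
    fderiv ℝ (transition 𝒳 ψ₁ ψ₂ k) y (EuclideanSpace.single i 1) with hw
  have h7 : w = ∑ l, w l • (EuclideanSpace.single l (1 : ℝ) : EuclideanSpace ℝ (Fin j)) := by
    have := (EuclideanSpace.basisFun (Fin j) ℝ).sum_repr w
    simpa using this.symm
  let φ : EuclideanSpace ℝ (Fin j) →L[ℝ] EuclideanSpace ℝ (Fin dX) :=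
    mfderiv (𝓡 j) (𝓡 dX) (fun y => ψ₂.toHomeo.symm (𝒢.r k, y)) (transition 𝒳 ψ₁ ψ₂ k y)
  change φ w = ∑ l, w l • φ (EuclideanSpace.single l 1)
  conv_lhs => rw [h7]
  simp only [map_sum, map_smul]

theorem gram_transition (hiso : IsGIsometricForm 𝒳 h) :
    ψ₁.gram h (𝒢.s k, y) =
      ((LinearMap.toMatrix (EuclideanSpace.basisFun (Fin j) ℝ).toBasis
        (EuclideanSpace.basisFun (Fin j) ℝ).toBasis
        (fderiv ℝ (transition 𝒳 ψ₁ ψ₂ k) y).toLinearMap).map Complex.ofRealHom).transpose *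
      ψ₂.gram h (𝒢.r k, transition 𝒳 ψ₁ ψ₂ k y) *
      (LinearMap.toMatrix (EuclideanSpace.basisFun (Fin j) ℝ).toBasis
        (EuclideanSpace.basisFun (Fin j) ℝ).toBasis
        (fderiv ℝ (transition 𝒳 ψ₁ ψ₂ k) y).toLinearMap).map Complex.ofRealHom := by
  have hpd : MDifferentiable (𝓡 dX) (𝓡 dM) 𝒳.p := 𝒳.smooth_p.mdifferentiable (by simp)
  ext i l
  -- Retyping the form on the model space allows the base point to be rewritten independently of the
  -- vectors.
  let h' : X → EuclideanSpace ℝ (Fin dX) →ₗ[ℝ] EuclideanSpace ℝ (Fin dX) →ₗ[ℝ] ℂ := fun x => h x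
  have e1 : ψ₁.gram h (𝒢.s k, y) i l = h' (𝒳.act k (ψ₁.toHomeo.symm (𝒢.s k, y)))
      (mfderivWithin (𝓡 dX) (𝓡 dX) (𝒳.act k) (𝒳.p ⁻¹' {𝒢.s k}) (ψ₁.toHomeo.symm (𝒢.s k, y))
        (ψ₁.coordVec (𝒢.s k, y) i))
      (mfderivWithin (𝓡 dX) (𝓡 dX) (𝒳.act k) (𝒳.p ⁻¹' {𝒢.s k}) (ψ₁.toHomeo.symm (𝒢.s k, y))
        (ψ₁.coordVec (𝒢.s k, y) l)) :=
    (hiso k _ (ψ₁.p_symm (q := (𝒢.s k, y)) hy).symm _ _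
      (ψ₁.mfderiv_p_coordVec hpd hy i) (ψ₁.mfderiv_p_coordVec hpd hy l)).symm
  have hP : LinearMap.toMatrix (EuclideanSpace.basisFun (Fin j) ℝ).toBasis
      (EuclideanSpace.basisFun (Fin j) ℝ).toBasis
      (fderiv ℝ (transition 𝒳 ψ₁ ψ₂ k) y).toLinearMap = Matrix.of fun l i =>
        (fderiv ℝ (transition 𝒳 ψ₁ ψ₂ k) y (EuclideanSpace.single i 1)) l := by
    ext a b
    simp [LinearMap.toMatrix_apply]
  rw [hP]
  refine e1.trans (Eq.trans ?_ (bilinear_sum_apply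
    (h' (ψ₂.toHomeo.symm (𝒢.r k, transition 𝒳 ψ₁ ψ₂ k y)))
    (Matrix.of fun l i => (fderiv ℝ (transition 𝒳 ψ₁ ψ₂ k) y (EuclideanSpace.single i 1)) l)
    (fun l => ψ₂.coordVec (𝒢.r k, transition 𝒳 ψ₁ ψ₂ k y) l) i l))
  rw [mfderiv_act_coordVec 𝒳 ψ₁ ψ₂ hy hy₂, mfderiv_act_coordVec 𝒳 ψ₁ ψ₂ hy hy₂,
    (eventually_transition 𝒳 ψ₁ ψ₂ hy hy₂).self_of_nhds]
  rfl

/-- The Gram determinants differ by the square of the Jacobian determinant, so the square roots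
differ by exactly the factor in the change of variables formula. -/
theorem density_transition (hiso : IsGIsometricForm 𝒳 h) :
    ψ₁.density h (𝒢.s k, y) = |(fderiv ℝ (transition 𝒳 ψ₁ ψ₂ k) y).det| *
      ψ₂.density h (𝒢.r k, transition 𝒳 ψ₁ ψ₂ k y) := by
  rw [FibredChart.density, gram_transition 𝒳 ψ₁ ψ₂ hy hy₂ hiso, Matrix.det_mul, Matrix.det_mul,
    Matrix.det_transpose, ← RingHom.mapMatrix_apply, ← RingHom.map_det, LinearMap.det_toMatrix,
    norm_mul, norm_mul]
  simp only [Complex.ofRealHom_eq_coe, Complex.norm_real, Real.norm_eq_abs]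
  rw [mul_right_comm, Real.sqrt_mul (mul_self_nonneg _), Real.sqrt_mul_self (abs_nonneg _)]
  rfl

end Action

/-! ### Invariance of the fibre volumes under the action. -/

section Action

set_option linter.unusedSectionVars false

variable {dG dM dX j : ℕ} {G M X : Type*}
  [TopologicalSpace G] [ChartedSpace (EuclideanSpace ℝ (Fin dG)) G]
  [TopologicalSpace M] [ChartedSpace (EuclideanSpace ℝ (Fin dM)) M]
  {𝒢 : LieGroupoid dG dM G M}
  [TopologicalSpace X] [ChartedSpace (EuclideanSpace ℝ (Fin dX)) X]
  [MeasurableSpace X] [BorelSpace X]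

theorem FibredChart.measurableSet_image_coord {p : X → M} (ψ : FibredChart dM dX j p) {u : M}
    {A : Set (Fib p u)} (hA : MeasurableSet A) (hAs : A ⊆ ψ.fibSource u) :
    MeasurableSet (ψ.coord u '' A) := by
  let ι : ψ.fibTarget u → Fib p u := fun y => ⟨ψ.toHomeo.symm (u, y.1), ψ.p_symm (q := (u, y.1)) y.2⟩
  have hι : Continuous ι := by
    refine Continuous.subtype_mk ?_ _
    exact ψ.toHomeo.continuousOn_symm.comp_continuous (by fun_prop) fun y => y.2
  have h1 : ψ.coord u '' A = Subtype.val '' (ι ⁻¹' A) := by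
    ext y
    constructor
    · rintro ⟨a, ha, rfl⟩
      refine ⟨⟨_, ψ.coord_mem (hAs ha)⟩, ?_, rfl⟩
      have : ι ⟨_, ψ.coord_mem (hAs ha)⟩ = a := Subtype.ext (ψ.symm_coord (hAs ha))
      rw [mem_preimage, this]
      exact ha
    · rintro ⟨⟨y, hy⟩, hyA, rfl⟩
      obtain ⟨x, hx, rfl⟩ := ψ.exists_coord_eq hy
      have : ι ⟨_, hy⟩ = x := Subtype.ext (ψ.symm_coord hx)
      rw [mem_preimage, this] at hyA
      exact ⟨x, hyA, rfl⟩
  rw [h1]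
  exact (ψ.isOpen_fibTarget u).measurableSet.subtype_image (hι.measurable hA)

namespace GManifold

variable (𝒳 : GManifold 𝒢 dX X) {h : TangentForm dX X}

/-- The diffeomorphism `x ↦ kx` between fibres of a `G`-manifold. -/
def move (k : G) {u v : M} (hu : 𝒢.s k = u) (hv : 𝒢.r k = v) (x : Fib 𝒳.p u) : Fib 𝒳.p v :=
  ⟨𝒳.act k x.1, by rw [𝒳.p_act _ _ (by rw [hu, x.2]), hv]⟩

variable (k : G) {u v : M} (hu : 𝒢.s k = u) (hv : 𝒢.r k = v)

theorem continuous_move : Continuous (𝒳.move k hu hv) := by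
  refine Continuous.subtype_mk ?_ _
  exact 𝒳.smooth_act.continuousOn.comp_continuous (f := fun x : Fib 𝒳.p u => (k, x.1))
    (by fun_prop) fun x => hu.trans x.2.symm

theorem move_inv_move (x : Fib 𝒳.p u) :
    𝒳.move (𝒢.inv k) ((𝒢.s_inv k).trans hv) ((𝒢.r_inv k).trans hu) (𝒳.move k hu hv x) = x :=
  Subtype.ext (𝒳.inv_act k x.1 (hu.trans x.2.symm))

theorem move_move_inv (x : Fib 𝒳.p v) :
    𝒳.move k hu hv (𝒳.move (𝒢.inv k) ((𝒢.s_inv k).trans hv) ((𝒢.r_inv k).trans hu) x) = x := by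
  have := 𝒳.inv_act (𝒢.inv k) x.1 ((𝒢.s_inv k).trans (hv.trans x.2.symm))
  rw [LieGroupoid.inv_inv] at this
  exact Subtype.ext this

variable {μ : ∀ u : M, Measure (Fib 𝒳.p u)} (hμ : IsFibreVolume dM j 𝒳.p h μ)
  (hiso : IsGIsometricForm 𝒳 h)
include hμ hiso

/-- For sets inside one chart on either side, this is the change of variables formula in `ℝʲ` for
the transition map, combined with `density_transition`. -/
theorem measure_preimage_move (ψ₁ ψ₂ : FibredChart dM dX j 𝒳.p) {A : Set (Fib 𝒳.p (𝒢.r k))}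
    (hA : MeasurableSet A) (hA₂ : A ⊆ ψ₂.fibSource (𝒢.r k))
    (hA₁ : 𝒳.move k rfl rfl ⁻¹' A ⊆ ψ₁.fibSource (𝒢.s k)) :
    μ (𝒢.s k) (𝒳.move k rfl rfl ⁻¹' A) = μ (𝒢.r k) A := by
  have hA' := (𝒳.continuous_move k rfl rfl).measurable hA
  set B := ψ₁.coord (𝒢.s k) '' (𝒳.move k rfl rfl ⁻¹' A) with hB
  have hτ : ∀ x ∈ 𝒳.move k rfl rfl ⁻¹' A, transition 𝒳 ψ₁ ψ₂ k (ψ₁.coord (𝒢.s k) x) =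
      ψ₂.coord (𝒢.r k) (𝒳.move k rfl rfl x) := by
    intro x hx
    rw [transition, ψ₁.symm_coord (hA₁ hx)]
    exact (Prod.ext_iff.1 (ψ₂.coord_eq (hA₂ hx))).2.symm
  have himg : transition 𝒳 ψ₁ ψ₂ k '' B = ψ₂.coord (𝒢.r k) '' A := by
    ext y
    constructor
    · rintro ⟨_, ⟨x, hx, rfl⟩, rfl⟩
      exact ⟨_, hx, (hτ x hx).symm⟩
    · rintro ⟨z, hz, rfl⟩
      have hz' := 𝒳.move_move_inv k rfl rfl z
      have hx : 𝒳.move (𝒢.inv k) (𝒢.s_inv k) (𝒢.r_inv k) z ∈ 𝒳.move k rfl rfl ⁻¹' A := by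
        rw [mem_preimage, hz']
        exact hz
      exact ⟨_, ⟨_, hx, rfl⟩, by rw [hτ _ hx, hz']⟩
  have hmem : ∀ y ∈ B, y ∈ ψ₁.fibTarget (𝒢.s k) ∧
      𝒳.act k (ψ₁.toHomeo.symm (𝒢.s k, y)) ∈ ψ₂.toHomeo.source := by
    rintro _ ⟨x, hx, rfl⟩
    refine ⟨ψ₁.coord_mem (hA₁ hx), ?_⟩
    rw [ψ₁.symm_coord (hA₁ hx)]
    exact hA₂ hx
  have hinj : InjOn (transition 𝒳 ψ₁ ψ₂ k) B := by
    rintro _ ⟨x, hx, rfl⟩ _ ⟨y, hy, rfl⟩ hxy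
    rw [hτ x hx, hτ y hy] at hxy
    have h1 : 𝒳.move k rfl rfl x = 𝒳.move k rfl rfl y := by
      refine Subtype.ext ?_
      rw [← ψ₂.symm_coord (hA₂ hx), ← ψ₂.symm_coord (hA₂ hy), hxy]
    rw [← 𝒳.move_inv_move k rfl rfl x, h1, 𝒳.move_inv_move k rfl rfl y]
  rw [ψ₁.measure_eq hμ _ hA₁ hA', ψ₂.measure_eq hμ _ hA₂ hA, ← himg, ← hB]
  rw [lintegral_image_eq_lintegral_abs_det_fderiv_mul volume
    (ψ₁.measurableSet_image_coord hA' hA₁)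
    (fun y hy => (hasFDerivAt_transition 𝒳 ψ₁ ψ₂ (hmem y hy).1 (hmem y hy).2).hasFDerivWithinAt)
    hinj]
  refine setLIntegral_congr_fun (ψ₁.measurableSet_image_coord hA' hA₁) fun y hy => ?_
  rw [← ENNReal.ofReal_mul (abs_nonneg _),
    density_transition 𝒳 ψ₁ ψ₂ (hmem y hy).1 (hmem y hy).2 hiso]

/-- Two measures that agree on the members of a countable open cover are equal; second countability
supplies such a cover by sets `W z` to which the local statement applies. -/
theorem map_move [SecondCountableTopology X]
    (hψ : ∀ x, ∃ ψ : FibredChart dM dX j 𝒳.p, x ∈ ψ.toHomeo.source) :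
    Measure.map (𝒳.move k hu hv) (μ u) = μ v := by
  subst hu hv
  choose ψ hψ using hψ
  have hm := (𝒳.continuous_move k rfl rfl).measurable
  set n := 𝒳.move (𝒢.inv k) (𝒢.s_inv k) (𝒢.r_inv k) with hn
  set W : Fib 𝒳.p (𝒢.r k) → Set (Fib 𝒳.p (𝒢.r k)) := fun z =>
    (ψ z.1).fibSource _ ∩ n ⁻¹' (ψ (n z).1).fibSource _ with hW
  have hWo : ∀ z, IsOpen (W z) := fun z => ((ψ z.1).isOpen_fibSource _).inter
    (((ψ (n z).1).isOpen_fibSource _).preimage (𝒳.continuous_move _ _ _))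
  have : SecondCountableTopology (Fib 𝒳.p (𝒢.r k)) :=
    Topology.IsEmbedding.subtypeVal.secondCountableTopology
  obtain ⟨t, htc, ht⟩ := TopologicalSpace.countable_cover_nhds fun z =>
    (hWo z).mem_nhds ⟨hψ z.1, hψ (n z).1⟩
  have := htc.to_subtype
  refine (Measure.ext_iff_of_biUnion_eq_univ htc ht).2 fun z _ => ?_
  ext A hA
  rw [Measure.restrict_apply hA, Measure.restrict_apply hA,
    Measure.map_apply hm (hA.inter (hWo z).measurableSet)]
  refine 𝒳.measure_preimage_move k hμ hiso (ψ (n z).1) (ψ z.1) (hA.inter (hWo z).measurableSet)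
    (fun x hx => hx.2.1) fun x hx => ?_
  have h1 := hx.2.2
  rw [mem_preimage, hn, 𝒳.move_inv_move k rfl rfl x] at h1
  exact h1

end GManifold

end Action

/-! ### Fibred charts of the family and properness of `p`. -/

section Family

set_option linter.unusedSectionVars false

variable {dG dM : ℕ} {G M : Type*}
    [TopologicalSpace G] [ChartedSpace (EuclideanSpace ℝ (Fin dG)) G]
    [TopologicalSpace M] [ChartedSpace (EuclideanSpace ℝ (Fin dM)) M]
    {𝒢 : LieGroupoid dG dM G M}
    {dX j : ℕ} {X Z : Type*}
    [TopologicalSpace X] [ChartedSpace (EuclideanSpace ℝ (Fin dX)) X]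
    [MeasurableSpace X] [BorelSpace X]
    [TopologicalSpace Z] [ChartedSpace (EuclideanSpace ℝ (Fin j)) Z] [CompactSpace Z]
    [IsManifold (𝓡 j) ∞ Z]
    {F : Type*} [NormedAddCommGroup F] [NormedSpace ℂ F]
    {E : X → Type*} [TopologicalSpace (TotalSpace F E)] [∀ x, NormedAddCommGroup (E x)]
    [∀ x, InnerProductSpace ℂ (E x)] [FiberBundle F E] [VectorBundle ℂ F E]
    {E₀ : Z → Type*} [TopologicalSpace (TotalSpace F E₀)] [∀ z, TopologicalSpace (E₀ z)]
    [∀ z, AddCommGroup (E₀ z)] [∀ z, Module ℂ (E₀ z)] [FiberBundle F E₀]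

namespace GFamily

variable (D : GFamily 𝒢 dX j X Z F E E₀)

/-- A local trivialization over `M`, followed by a chart of `Z` in the second factor. -/
theorem exists_fibredChart (x : X) : ∃ ψ : FibredChart dM dX j D.p, x ∈ ψ.toHomeo.source := by
  obtain ⟨U, φ, -, -, hu, hs, ht, hφ, h1, h2, -⟩ := D.locally_trivial (D.p x)
  have hx : x ∈ φ.source := by rw [hs]; exact hu
  set κ := chartAt (EuclideanSpace ℝ (Fin j)) (φ x).2 with hκ
  set e := φ.trans ((OpenPartialHomeomorph.refl M).prod κ) with he
  have hes : ∀ z ∈ e.source, z ∈ φ.source ∧ (φ z).2 ∈ κ.source := by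
    intro z hz
    simp only [he, OpenPartialHomeomorph.trans_source] at hz
    exact ⟨hz.1, hz.2.2⟩
  have het : ∀ q ∈ e.target, q.2 ∈ κ.target ∧ (q.1, κ.symm q.2) ∈ φ.target := by
    intro q hq
    simp only [he, OpenPartialHomeomorph.trans_target] at hq
    exact ⟨hq.1.2, hq.2⟩
  refine ⟨⟨e, ?_, ?_, ?_⟩, ?_⟩
  · have h3 : ContMDiffOn ((𝓡 dM).prod (𝓡 j)) ((𝓡 dM).prod (𝓡 j)) ∞ (Prod.map (id : M → M) κ)
        (univ ×ˢ κ.source) := contMDiffOn_id.prodMap contMDiffOn_chart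
    exact h3.comp (h1.mono fun z hz => (hes z hz).1) fun z hz => ⟨trivial, (hes z hz).2⟩
  · have h3 : ContMDiffOn ((𝓡 dM).prod (𝓡 j)) ((𝓡 dM).prod (𝓡 j)) ∞
        (Prod.map (id : M → M) κ.symm) (univ ×ˢ κ.target) :=
      contMDiffOn_id.prodMap contMDiffOn_chart_symm
    exact h2.comp (h3.mono fun q hq => ⟨trivial, (het q hq).1⟩) fun q hq => (het q hq).2
  · exact fun z hz => hφ z (hes z hz).1
  · simp only [he, OpenPartialHomeomorph.trans_source]
    exact ⟨hx, trivial, mem_chart_source _ _⟩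

theorem isCompact_preimage_p [T2Space M] [LocallyCompactSpace M] {C : Set M} (hC : IsCompact C) :
    IsCompact (D.p ⁻¹' C) := by
  have hloc : ∀ u : M, ∃ N ∈ 𝓝 u, IsCompact (D.p ⁻¹' N) := by
    intro u
    obtain ⟨U, φ, -, hU, hu, hs, ht, hφ, -⟩ := D.locally_trivial u
    obtain ⟨N, hN, hNU, hNc⟩ := local_compact_nhds (hU.mem_nhds hu)
    refine ⟨N, hN, ?_⟩
    have h2 : N ×ˢ (univ : Set Z) ⊆ φ.target := by
      rw [ht]; exact prod_mono hNU le_rfl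
    have h3 := (hNc.prod isCompact_univ).image_of_continuousOn (φ.continuousOn_symm.mono h2)
    convert h3 using 1
    ext x
    constructor
    · intro hx
      have hxs : x ∈ φ.source := by rw [hs]; exact hNU hx
      exact ⟨φ x, ⟨by rw [hφ x hxs]; exact hx, trivial⟩, φ.left_inv hxs⟩
    · rintro ⟨q, hq, rfl⟩
      have h4 := φ.map_target (h2 hq)
      rw [mem_preimage, ← hφ _ h4, φ.right_inv (h2 hq)]
      exact hq.1
  choose N hN hNc using hloc
  obtain ⟨t, -, ht⟩ := hC.elim_nhds_subcover N fun u _ => hN u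
  refine (t.isCompact_biUnion fun u _ => hNc u).of_isClosed_subset
    (hC.isClosed.preimage D.smooth_p.continuous) fun x hx => ?_
  obtain ⟨u, hu, hxu⟩ := mem_iUnion₂.1 (ht hx)
  exact mem_iUnion₂.2 ⟨u, hu, hxu⟩

end GFamily

end Family

/-! ### Norms of sections and unitarity of the action. -/

section Family

set_option linter.unusedSectionVars false

variable {dG dM : ℕ} {G M : Type*}
    [TopologicalSpace G] [ChartedSpace (EuclideanSpace ℝ (Fin dG)) G]
    [TopologicalSpace M] [ChartedSpace (EuclideanSpace ℝ (Fin dM)) M]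
    {𝒢 : LieGroupoid dG dM G M}
    {dX j : ℕ} {X Z : Type*}
    [TopologicalSpace X] [ChartedSpace (EuclideanSpace ℝ (Fin dX)) X]
    [MeasurableSpace X] [BorelSpace X]
    [TopologicalSpace Z] [ChartedSpace (EuclideanSpace ℝ (Fin j)) Z] [CompactSpace Z]
    {F : Type*} [NormedAddCommGroup F] [NormedSpace ℂ F]
    {E : X → Type*} [TopologicalSpace (TotalSpace F E)] [∀ x, NormedAddCommGroup (E x)]
    [∀ x, InnerProductSpace ℂ (E x)] [FiberBundle F E] [VectorBundle ℂ F E]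
    {E₀ : Z → Type*} [TopologicalSpace (TotalSpace F E₀)] [∀ z, TopologicalSpace (E₀ z)]
    [∀ z, AddCommGroup (E₀ z)] [∀ z, Module ℂ (E₀ z)] [FiberBundle F E₀]

namespace GFamily

variable (D : GFamily 𝒢 dX j X Z F E E₀)

theorem continuous_p : Continuous D.p := D.smooth_p.continuous

theorem ext_preL2 {u : M} {f g : D.PreL2 u} (h : ∀ x, f.1 x = g.1 x) : f = g :=
  Subtype.ext (funext h)

theorem preL2_norm_sq {u : M} (f : D.PreL2 u) : ‖f‖ ^ 2 = ∫ x, ‖f.1 x‖ ^ 2 ∂D.μ u := by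
  have h1 : (inner ℂ f f : ℂ) = ∫ x : Fib D.p u, (inner ℂ (f.1 x) (f.1 x) : ℂ) ∂D.μ u := rfl
  have h2 : ∀ x : Fib D.p u, (inner ℂ (f.1 x) (f.1 x) : ℂ) = ((‖f.1 x‖ ^ 2 : ℝ) : ℂ) :=
    fun x => by simp [inner_self_eq_norm_sq_to_K]
  simp only [h2] at h1
  rw [integral_complex_ofReal] at h1
  rw [← inner_self_eq_norm_sq (𝕜 := ℂ) f, h1]
  exact Complex.ofReal_re _

theorem preL2_norm_le {u : M} (f : D.PreL2 u) {δ : ℝ} (hδ : 0 ≤ δ) (h : ∀ x, ‖f.1 x‖ ≤ δ) :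
    ‖f‖ ≤ δ * Real.sqrt ((D.μ u).real univ) := by
  have := D.μ_volume.finite u
  refine le_of_sq_le_sq ?_ (by positivity)
  rw [preL2_norm_sq, mul_pow, Real.sq_sqrt measureReal_nonneg]
  calc ∫ x, ‖f.1 x‖ ^ 2 ∂D.μ u ≤ ∫ x, δ ^ 2 ∂D.μ u := by
        refine integral_mono_of_nonneg (.of_forall fun x => by positivity) (integrable_const _)
          (.of_forall fun x => ?_)
        exact pow_le_pow_left₀ (norm_nonneg _) (h x) 2
    _ = δ ^ 2 * (D.μ u).real univ := by simp [mul_comm]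

/-! ### The unitary action -/

theorem cast_add {x y : X} (h : y = x) (a b : E y) : (h ▸ (a + b) : E x) = h ▸ a + h ▸ b := by
  subst h; rfl

theorem cast_smul {x y : X} (h : y = x) (c : ℂ) (a : E y) : (h ▸ (c • a) : E x) = c • h ▸ a := by
  subst h; rfl

theorem norm_cast_eq {x y : X} (h : y = x) (a : E y) : ‖(h ▸ a : E x)‖ = ‖a‖ := by
  subst h; rfl

variable (g : G) {u v : M} (hu : 𝒢.s g = u) (hv : 𝒢.r g = v)

theorem norm_translateFun (f : ∀ x : Fib D.p u, E x.1) (x : Fib D.p v) :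
    ‖D.translateFun g hu hv f x‖ = ‖f (D.pull g hu hv x)‖ := by
  rw [translateFun, norm_cast_eq]
  have h1 := D.lift_isometric g _ (f (D.pull g hu hv x)) (f (D.pull g hu hv x))
    (hu.trans (D.pull g hu hv x).2.symm)
  rw [inner_self_eq_norm_sq_to_K, inner_self_eq_norm_sq_to_K] at h1
  have h2 : ‖D.lift g _ (f (D.pull g hu hv x))‖ ^ 2 = ‖f (D.pull g hu hv x)‖ ^ 2 := by
    exact_mod_cast h1
  exact (sq_eq_sq₀ (norm_nonneg _) (norm_nonneg _)).1 h2

theorem translate_add (f k : D.PreL2 u) :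
    D.translate g hu hv (f + k) = D.translate g hu hv f + D.translate g hu hv k := by
  refine D.ext_preL2 fun x => ?_
  change D.translateFun g hu hv (fun x => f.1 x + k.1 x) x =
    D.translateFun g hu hv f.1 x + D.translateFun g hu hv k.1 x
  exact (congrArg (fun w : E (D.act g (D.act (𝒢.inv g) x.1)) =>
    (D.act_inv_act g x.1 (x.2.trans hv.symm) ▸ w : E x.1)) (map_add _ _ _)).trans (cast_add _ _ _)

theorem translate_smul (c : ℂ) (f : D.PreL2 u) :
    D.translate g hu hv (c • f) = c • D.translate g hu hv f := by
  refine D.ext_preL2 fun x => ?_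
  change D.translateFun g hu hv (fun x => c • f.1 x) x = c • D.translateFun g hu hv f.1 x
  exact (congrArg (fun w : E (D.act g (D.act (𝒢.inv g) x.1)) =>
    (D.act_inv_act g x.1 (x.2.trans hv.symm) ▸ w : E x.1)) (map_smul _ _ _)).trans
    (cast_smul _ _ _)

/-- The inverse is a variable `k` with an equation so that both `L_{g⁻¹} L_g` and `L_g L_{g⁻¹}` are
covered. The values are compared in the total space, where no transport between fibres is needed. -/
theorem translate_inv_translate {k : G} (hk : k = 𝒢.inv g) (hu' : 𝒢.r k = u) (hv' : 𝒢.s k = v)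
    (f : D.PreL2 u) : D.translate k hv' hu' (D.translate g hu hv f) = f := by
  subst hk
  refine D.ext_preL2 fun x => ?_
  have h1 : (⟨x.1, D.translateFun (𝒢.inv g) hv' hu' (D.translateFun g hu hv f.1) x⟩ :
      TotalSpace F E) = ⟨x.1, f.1 x⟩ := by
    have hpp : D.pull g hu hv (D.pull (𝒢.inv g) hv' hu' x) = x := by
      exact Subtype.ext (D.act_inv_act (𝒢.inv g) x.1 (x.2.trans hu'.symm))
    have h2 := D.translateFun_total g hu hv f.1 (D.pull (𝒢.inv g) hv' hu' x)
    rw [hpp] at h2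
    rw [translateFun_total]
    have key : ∀ (y z : TotalSpace F E), y = z →
        (⟨_, D.lift (𝒢.inv g) y.proj y.2⟩ : TotalSpace F E) = ⟨_, D.lift (𝒢.inv g) z.proj z.2⟩ := by
      rintro y _ rfl; rfl
    exact (key _ _ h2).trans (D.inv_lift g x.1 (f.1 x) (hu.trans x.2.symm))
  exact eq_of_heq (TotalSpace.mk.inj h1).2

variable [SecondCountableTopology X] [IsManifold (𝓡 j) ∞ Z]

theorem map_pull : Measure.map (D.pull g hu hv) (D.μ v) = D.μ u :=
  D.toGManifold.map_move (𝒢.inv g) ((𝒢.s_inv g).trans hv) ((𝒢.r_inv g).trans hu) D.μ_volume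
    D.h_isometric D.exists_fibredChart

theorem continuous_pull : Continuous (D.pull g hu hv) :=
  D.toGManifold.continuous_move (𝒢.inv g) ((𝒢.s_inv g).trans hv) ((𝒢.r_inv g).trans hu)

/-- The lift is isometric on the fibres of `E`, and `x ↦ g⁻¹x` carries one fibre volume to the
other. -/
theorem norm_translate (f : D.PreL2 u) : ‖D.translate g hu hv f‖ = ‖f‖ := by
  rw [← sq_eq_sq₀ (norm_nonneg _) (norm_nonneg _), preL2_norm_sq, preL2_norm_sq,
    ← D.map_pull g hu hv, integral_map (D.continuous_pull g hu hv).aemeasurable]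
  · exact integral_congr_ae (.of_forall fun x => by
      change ‖D.translateFun g hu hv f.1 x‖ ^ 2 = _
      rw [norm_translateFun])
  · exact (D.metric_continuous.comp f.2).aestronglyMeasurable

/-- Translation of continuous sections as a linear isometry. -/
noncomputable def translateₗᵢ : D.PreL2 u →ₗᵢ[ℂ] D.PreL2 v where
  toFun := D.translate g hu hv
  map_add' := D.translate_add g hu hv
  map_smul' := D.translate_smul g hu hv
  norm_map' := D.norm_translate g hu hv

theorem L_coe (f : D.PreL2 u) : D.L g hu hv (f : D.H u) = (D.translate g hu hv f : D.H v) :=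
  UniformSpace.Completion.map_coe (D.translateₗᵢ g hu hv).isometry.uniformContinuous f

theorem L_eq : D.L g hu hv = (D.translateₗᵢ g hu hv).toContinuousLinearMap.completion := rfl

theorem continuous_L : Continuous (D.L g hu hv) := by
  rw [L_eq]; exact ContinuousLinearMap.continuous _

theorem L_add (ξ η : D.H u) : D.L g hu hv (ξ + η) = D.L g hu hv ξ + D.L g hu hv η := by
  rw [L_eq, map_add]

theorem L_smul (c : ℂ) (ξ : D.H u) : D.L g hu hv (c • ξ) = c • D.L g hu hv ξ := by
  rw [L_eq, map_smul]

theorem norm_L (ξ : D.H u) : ‖D.L g hu hv ξ‖ = ‖ξ‖ := by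
  induction ξ using UniformSpace.Completion.induction_on with
  | hp => exact isClosed_eq (D.continuous_L g hu hv).norm continuous_norm
  | ih f => rw [L_coe, UniformSpace.Completion.norm_coe, UniformSpace.Completion.norm_coe,
      norm_translate]

/-- `L_g` as a linear isometry. -/
noncomputable def Lₗᵢ : D.H u →ₗᵢ[ℂ] D.H v where
  toFun := D.L g hu hv
  map_add' := D.L_add g hu hv
  map_smul' := D.L_smul g hu hv
  norm_map' := D.norm_L g hu hv

theorem inner_L (ξ η : D.H u) : (inner ℂ (D.L g hu hv ξ) (D.L g hu hv η) : ℂ) = inner ℂ ξ η :=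
  (D.Lₗᵢ g hu hv).inner_map_map ξ η

theorem L_L_of_inv {k : G} (hk : k = 𝒢.inv g) (hu' : 𝒢.r k = u) (hv' : 𝒢.s k = v) (ξ : D.H u) :
    D.L k hv' hu' (D.L g hu hv ξ) = ξ := by
  induction ξ using UniformSpace.Completion.induction_on with
  | hp => exact isClosed_eq ((D.continuous_L k _ _).comp (D.continuous_L g hu hv)) continuous_id
  | ih f => rw [L_coe, L_coe, translate_inv_translate D g hu hv hk hu' hv']

end GFamily

end Family

/-! ### The Hilbert bundle as a continuous field, and continuity of the action on it. -/

section Family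

set_option linter.unusedSectionVars false

variable {dG dM : ℕ} {G M : Type*}
    [TopologicalSpace G] [ChartedSpace (EuclideanSpace ℝ (Fin dG)) G]
    [TopologicalSpace M] [ChartedSpace (EuclideanSpace ℝ (Fin dM)) M]
    {𝒢 : LieGroupoid dG dM G M}
    {dX j : ℕ} {X Z : Type*}
    [TopologicalSpace X] [ChartedSpace (EuclideanSpace ℝ (Fin dX)) X]
    [MeasurableSpace X] [BorelSpace X]
    [TopologicalSpace Z] [ChartedSpace (EuclideanSpace ℝ (Fin j)) Z] [CompactSpace Z]
    {F : Type*} [NormedAddCommGroup F] [NormedSpace ℂ F]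
    {E : X → Type*} [TopologicalSpace (TotalSpace F E)] [∀ x, NormedAddCommGroup (E x)]
    [∀ x, InnerProductSpace ℂ (E x)] [FiberBundle F E] [VectorBundle ℂ F E]
    {E₀ : Z → Type*} [TopologicalSpace (TotalSpace F E₀)] [∀ z, TopologicalSpace (E₀ z)]
    [∀ z, AddCommGroup (E₀ z)] [∀ z, Module ℂ (E₀ z)] [FiberBundle F E₀]

variable [T2Space X] [SecondCountableTopology X] [LocallyCompactSpace X] [IsManifold (𝓡 j) ∞ Z]
    [FiniteDimensional ℂ F] [T2Space M] [LocallyCompactSpace M] [FirstCountableTopology M]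

namespace GFamily

variable (D : GFamily 𝒢 dX j X Z F E E₀)

/-! ### The continuous field of Hilbert spaces -/

variable (F E) in
theorem continuous_norm_sq_section (D : GFamily 𝒢 dX j X Z F E E₀) (e : CcSection F E) :
    Continuous fun x => ‖e.toFun x‖ ^ 2 := D.metric_continuous.comp e.continuous

theorem norm_restrict_sq (e : CcSection F E) (u : M) :
    ‖(D.restrict e u : D.H u)‖ ^ 2 = ∫ x : Fib D.p u, ‖e.toFun x.1‖ ^ 2 ∂D.μ u := by
  rw [UniformSpace.Completion.norm_coe, preL2_norm_sq]
  rfl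

/-- The sections `u ↦ eᵘ` for `e ∈ C_c(X, E)`. -/
def fieldSections : Submodule ℂ (∀ u, D.H u) where
  carrier := {σ | ∃ e : CcSection F E, σ = fun u => (D.restrict e u : D.H u)}
  add_mem' := by
    rintro _ _ ⟨e, rfl⟩ ⟨f, rfl⟩
    refine ⟨.ofMem (Submodule.add_mem _ e.toFun_mem f.toFun_mem), funext fun u => ?_⟩
    exact (UniformSpace.Completion.coe_add (D.restrict e u) (D.restrict f u)).symm
  zero_mem' := ⟨.ofMem (Submodule.zero_mem _), funext fun u => UniformSpace.Completion.coe_zero.symm⟩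
  smul_mem' := by
    rintro c _ ⟨e, rfl⟩
    refine ⟨.ofMem (Submodule.smul_mem _ c e.toFun_mem), funext fun u => ?_⟩
    exact (UniformSpace.Completion.coe_smul c (D.restrict e u)).symm

theorem mem_fieldSections (e : CcSection F E) :
    (fun u => (D.restrict e u : D.H u)) ∈ D.fieldSections := ⟨e, rfl⟩

theorem norm_sq_cont {σ : ∀ u, D.H u} (hσ : σ ∈ D.fieldSections) :
    Continuous fun u => ((‖σ u‖ ^ 2 : ℝ) : ℂ) := by
  obtain ⟨e, rfl⟩ := hσ
  have hc := D.continuous_norm_sq_section F E e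
  have hs : HasCompactSupport fun x => ((‖e.toFun x‖ ^ 2 : ℝ) : ℂ) := by
    refine HasCompactSupport.intro e.compact_support fun x hx => ?_
    have : e.toFun x = 0 := by
      by_contra h
      exact hx (subset_closure h)
    simp [this]
  have h1 := continuous_fibre_integral D.h_metric D.μ_volume D.exists_fibredChart
    (Complex.continuous_ofReal.comp hc) hs
  refine h1.congr fun u => ?_
  rw [norm_restrict_sq]
  exact integral_complex_ofReal

theorem exists_section_eq {u : M} (f : D.PreL2 u) : ∃ e : CcSection F E, D.restrict e u = f := by
  obtain ⟨e, he, h⟩ := exists_extension_section (D.isCompact_preimage_p (isCompact_singleton (x := u)))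
    (fun x => f.1 x) f.2
  exact ⟨.ofMem he, D.ext_preL2 h⟩

/-- Polarization reduces continuity of inner products to that of `‖σ u‖ ^ 2`, a fibre integral.
Density holds because every continuous section over a fibre extends to `C_c(X, E)`, and scalar
functions act through `p`. -/
theorem isHilbertField : IsHilbertField D.fieldSections where
  inner_cont e he f hf := by
    have key : ∀ c : ℂ, Continuous fun u => ((‖e u + c • f u‖ ^ 2 : ℝ) : ℂ) := fun c =>
      D.norm_sq_cont (Submodule.add_mem _ he (Submodule.smul_mem _ c hf))
    have h := (((key 1).sub (key (-1))).add
      (((key (-Complex.I)).sub (key Complex.I)).mul (continuous_const (y := Complex.I)))).div_const 4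
    refine h.congr fun u => ?_
    rw [inner_eq_sum_norm_sq_div_four (𝕜 := ℂ) (e u) (f u)]
    simp [sub_eq_add_neg]
  dense u ξ ε hε := by
    obtain ⟨f, hf⟩ := (UniformSpace.Completion.denseRange_coe (α := D.PreL2 u)).exists_dist_lt ξ hε
    obtain ⟨e, rfl⟩ := D.exists_section_eq f
    exact ⟨_, D.mem_fieldSections e, by rwa [dist_eq_norm] at hf⟩
  smul_mem := by
    rintro _ ⟨e, rfl⟩ c hc
    refine ⟨.ofMem (mul_mem_ccSubmodule e.toFun_mem (hc.comp D.continuous_p)), funext fun u => ?_⟩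
    change c u • (D.restrict e u : D.H u) = _
    rw [← UniformSpace.Completion.coe_smul]
    refine congrArg _ (D.ext_preL2 fun x => ?_)
    change c u • e.toFun x.1 = c (D.p x.1) • e.toFun x.1
    rw [x.2]

theorem topology_eq : (inferInstance : TopologicalSpace D.HTotal) = tubeTopology D.fieldSections := by
  refine congrArg TopologicalSpace.generateFrom (Set.ext fun W => ⟨?_, ?_⟩)
  · rintro ⟨V, e, ε, hV, hε, rfl⟩
    exact ⟨V, _, ε, D.mem_fieldSections e, hV, hε, rfl⟩
  · rintro ⟨V, _, ε, ⟨e, rfl⟩, hV, hε, rfl⟩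
    exact ⟨V, e, ε, hV, hε, rfl⟩

/-- The constant 1 need not have compact support on `X`, but `χ ∘ p` does since `p` is proper, and
it equals 1 on the fibres near `u`. The bound converts uniform estimates into `L²` estimates. -/
theorem exists_mass_bound (u : M) : ∃ C : ℝ, 0 ≤ C ∧ ∀ᶠ v in 𝓝 u, (D.μ v).real univ ≤ C := by
  obtain ⟨N, hN, hNu⟩ := exists_compact_mem_nhds u
  obtain ⟨χ, hχc, hχs, -, -, hχ1⟩ := exists_bump hN
  have hs : HasCompactSupport fun x => (χ (D.p x) : ℂ) := by
    refine HasCompactSupport.intro (D.isCompact_preimage_p hχs) fun x hx => ?_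
    rw [image_eq_zero_of_notMem_tsupport hx, Complex.ofReal_zero]
  have h1 := continuous_fibre_integral D.h_metric D.μ_volume D.exists_fibredChart
    (Complex.continuous_ofReal.comp (hχc.comp D.continuous_p)) hs
  have h2 : ∀ᶠ v in 𝓝 u, ‖∫ x : Fib D.p v, (χ (D.p x.1) : ℂ) ∂D.μ v‖ <
      ‖∫ x : Fib D.p u, (χ (D.p x.1) : ℂ) ∂D.μ u‖ + 1 :=
    (h1.norm.tendsto u).eventually (gt_mem_nhds (lt_add_one _))
  refine ⟨‖∫ x : Fib D.p u, (χ (D.p x.1) : ℂ) ∂D.μ u‖ + 1, by positivity, ?_⟩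
  filter_upwards [h2, hNu] with v hv hvN
  have h3 : ∫ x : Fib D.p v, (χ (D.p x.1) : ℂ) ∂D.μ v = ((D.μ v).real univ : ℂ) := by
    have : ∀ x : Fib D.p v, (χ (D.p x.1) : ℂ) = 1 := fun x => by rw [x.2, hχ1 v hvN]; simp
    simp [this]
  rw [h3, Complex.norm_real, Real.norm_of_nonneg measureReal_nonneg] at hv
  exact hv.le

/-! ### Continuity of the translates -/

variable [T2Space G] [LocallyCompactSpace G]

theorem continuous_translateFun_total (e : CcSection F E) :
    Continuous fun q : {q : G × X // D.p q.2 = 𝒢.r q.1} =>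
      (⟨q.1.2, D.translateFun q.1.1 rfl rfl (fun x => e.toFun x.1) ⟨q.1.2, q.2⟩⟩ :
        TotalSpace F E) := by
  have c1 : Continuous fun q : {q : G × X // D.p q.2 = 𝒢.r q.1} =>
      D.act (𝒢.inv q.1.1) q.1.2 := by
    refine D.smooth_act.continuousOn.comp_continuous
      (f := fun q : {q : G × X // D.p q.2 = 𝒢.r q.1} => (𝒢.inv q.1.1, q.1.2)) ?_ ?_
    · exact (LieGroupoid.continuous_inv.comp (continuous_fst.comp continuous_subtype_val)).prodMk
        (continuous_snd.comp continuous_subtype_val)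
    · exact fun q => (𝒢.s_inv _).trans q.2.symm
  have c2 := e.continuous.comp c1
  refine Continuous.congr (D.smooth_lift.continuousOn.comp_continuous
    (f := fun q : {q : G × X // D.p q.2 = 𝒢.r q.1} => (q.1.1,
      (⟨D.act (𝒢.inv q.1.1) q.1.2, e.toFun (D.act (𝒢.inv q.1.1) q.1.2)⟩ : TotalSpace F E))) ?_ ?_)
    fun q => (D.translateFun_total q.1.1 rfl rfl (fun x => e.toFun x.1) ⟨q.1.2, q.2⟩).symm
  · exact (continuous_fst.comp continuous_subtype_val).prodMk c2
  · exact fun q => (D.pull q.1.1 rfl rfl ⟨q.1.2, q.2⟩).2.symm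

/-- The translate `L_{g₀} e` extends to some `e' ∈ C_c(X, E)`, and `L_g e` is compared with `e'` in
the uniform norm on the fibre. The pairs `(g, x)` at which they differ by at least `δ`, with `g` in
a compact neighbourhood, form a compact set whose projection to `G` is closed and misses `g₀`. -/
theorem tubeCont_Lsec (e : CcSection F E) :
    TubeCont D.fieldSections 𝒢.r fun g => D.Lsec e (u := 𝒢.r g) ⟨g, rfl⟩ := by
  intro g₀
  refine ⟨LieGroupoid.continuous_r.tendsto g₀, fun ε hε => ?_⟩
  obtain ⟨e', he'⟩ := D.exists_section_eq (D.translate g₀ rfl rfl (D.restrict e (𝒢.s g₀)))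
  refine ⟨_, D.mem_fieldSections e', ?_, ?_⟩
  · change ‖((D.translate g₀ rfl rfl (D.restrict e (𝒢.s g₀)) : D.PreL2 (𝒢.r g₀)) : D.H (𝒢.r g₀)) -
      (D.restrict e' (𝒢.r g₀) : D.H (𝒢.r g₀))‖ < ε
    rw [he', sub_self, norm_zero]
    exact hε
  obtain ⟨C, hC0, hC⟩ := D.exists_mass_bound (𝒢.r g₀)
  -- A uniform bound `δ` costs a factor of at most `√C` in the `L²` norm.
  set δ := ε / (Real.sqrt C + 1) with hδ
  have hδ0 : 0 < δ := by positivity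
  let P := {q : G × X // D.p q.2 = 𝒢.r q.1}
  let k : ∀ q : P, E q.1.2 := fun q =>
    D.translateFun q.1.1 rfl rfl (fun x => e.toFun x.1) ⟨q.1.2, q.2⟩ - e'.toFun q.1.2
  have hk : Continuous fun q : P => ‖k q‖ ^ 2 := by
    refine D.metric_continuous.comp (continuous_sub_section (D.continuous_translateFun_total e) ?_)
    exact e'.continuous.comp (continuous_snd.comp continuous_subtype_val)
  have hPc : IsClosed {q : G × X | D.p q.2 = 𝒢.r q.1} :=
    isClosed_eq (D.continuous_p.comp continuous_snd) (LieGroupoid.continuous_r.comp continuous_fst)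
  obtain ⟨N, hN, hNg⟩ := exists_compact_mem_nhds g₀
  have hcomp : IsCompact {q : P | q.1.1 ∈ N ∧ δ ^ 2 ≤ ‖k q‖ ^ 2} := by
    refine (hPc.isClosedEmbedding_subtypeVal.isCompact_preimage
      (hN.prod (D.isCompact_preimage_p (hN.image (LieGroupoid.continuous_r (𝒢 := 𝒢)))))).of_isClosed_subset
      ?_ ?_
    · exact (hN.isClosed.preimage (continuous_fst.comp continuous_subtype_val)).inter
        (isClosed_le continuous_const hk)
    · rintro q ⟨hq, -⟩
      exact ⟨hq, q.1.1, hq, q.2.symm⟩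
  have himg := (hcomp.image (f := fun q : P => q.1.1)
    (continuous_fst.comp continuous_subtype_val)).isClosed
  have hg₀ : g₀ ∉ (fun q : P => q.1.1) '' {q : P | q.1.1 ∈ N ∧ δ ^ 2 ≤ ‖k q‖ ^ 2} := by
    rintro ⟨⟨⟨g, x⟩, hx⟩, ⟨-, h2⟩, rfl⟩
    have h3 : k ⟨(g, x), hx⟩ = 0 := by
      have := congrFun (congrArg Subtype.val he') ⟨x, hx⟩
      exact sub_eq_zero.2 this.symm
    rw [h3] at h2
    simp at h2
    linarith
  filter_upwards [himg.isOpen_compl.mem_nhds hg₀, hNg,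
    (LieGroupoid.continuous_r.tendsto g₀).eventually hC] with g hg hgN hgC
  have hx : ∀ x : Fib D.p (𝒢.r g),
      ‖(D.translate g rfl rfl (D.restrict e (𝒢.s g)) - D.restrict e' (𝒢.r g)).1 x‖ ≤ δ := by
    intro x
    by_contra hne
    rw [not_le] at hne
    exact hg ⟨⟨(g, x.1), x.2⟩, ⟨hgN, pow_le_pow_left₀ hδ0.le hne.le 2⟩, rfl⟩
  have h1 := D.preL2_norm_le _ hδ0.le hx
  rw [← UniformSpace.Completion.norm_coe, UniformSpace.Completion.coe_sub] at h1
  refine lt_of_le_of_lt h1 ?_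
  calc δ * Real.sqrt ((D.μ (𝒢.r g)).real univ) ≤ δ * Real.sqrt C := by gcongr
    _ < δ * (Real.sqrt C + 1) := by gcongr; linarith
    _ = ε := by rw [hδ]; field_simp

theorem act_inv_mul (g k : G) (hgk : 𝒢.s g = 𝒢.r k) (x : X) (hx : D.p x = 𝒢.r g) :
    D.act (𝒢.inv (𝒢.mul g k)) x = D.act (𝒢.inv k) (D.act (𝒢.inv g) x) := by
  have h1 : D.p (D.act (𝒢.inv g) x) = 𝒢.r k := by
    rw [D.p_act _ _ ((𝒢.s_inv g).trans hx.symm), 𝒢.r_inv, hgk]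
  have h2 : 𝒢.s k = D.p (D.act (𝒢.inv k) (D.act (𝒢.inv g) x)) := by
    rw [D.p_act _ _ ((𝒢.s_inv k).trans h1.symm), 𝒢.r_inv]
  have h3 : D.act (𝒢.mul g k) (D.act (𝒢.inv k) (D.act (𝒢.inv g) x)) = x := by
    rw [← D.act_act g k _ hgk h2, D.act_inv_act k _ h1, D.act_inv_act g x hx]
  have h4 := D.inv_act (𝒢.mul g k) (D.act (𝒢.inv k) (D.act (𝒢.inv g) x))
    ((𝒢.s_mul g k hgk).trans h2)
  rwa [h3] at h4

theorem L_Lsec (e : CcSection F E) (g : G) (k : Fib 𝒢.r (𝒢.s g)) :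
    D.L g rfl rfl (D.Lsec e k) = D.Lsec e ⟨𝒢.mul g k.1, 𝒢.r_mul g k.1 k.2.symm⟩ := by
  rw [Lsec, L_coe, Lsec]
  refine congrArg _ (D.ext_preL2 fun x => ?_)
  refine eq_of_heq (TotalSpace.mk.inj (F := F) (?_ : (⟨x.1, _⟩ : TotalSpace F E) = ⟨x.1, _⟩)).2
  refine (D.translateFun_total g rfl rfl _ x).trans
    (Eq.trans ?_ (D.translateFun_total (𝒢.mul g k.1) rfl (𝒢.r_mul g k.1 k.2.symm) _ x).symm)
  have key : ∀ (g : G) (y z : TotalSpace F E), y = z →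
      (⟨_, D.lift g y.proj y.2⟩ : TotalSpace F E) = ⟨_, D.lift g z.proj z.2⟩ := by
    rintro g y _ rfl; rfl
  have h1 := D.translateFun_total k.1 rfl k.2 (D.restrict e (𝒢.s k.1)).1 (D.pull g rfl rfl x)
  refine (key g _ _ h1).trans ?_
  refine (D.lift_lift g k.1 _ _ k.2.symm (D.pull k.1 rfl k.2 (D.pull g rfl rfl x)).2.symm).trans ?_
  have h2 := D.act_inv_mul g k.1 k.2.symm x.1 x.2
  have key2 : ∀ (y z : X), y = z → (⟨_, D.lift (𝒢.mul g k.1) y (e.toFun y)⟩ : TotalSpace F E) =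
      ⟨_, D.lift (𝒢.mul g k.1) z (e.toFun z)⟩ := by
    rintro y _ rfl; rfl
  exact key2 _ _ h2.symm

end GFamily

end Family

/-! ### A form of compactness stable under linear combinations. -/

section Approximable

variable {M : Type*} [TopologicalSpace M] {H : M → Type*} [∀ u, NormedAddCommGroup (H u)]
  [∀ u, InnerProductSpace ℂ (H u)] {Γ : Submodule ℂ (∀ u, H u)}

/-- Over every compact set, the image of the unit ball under `T` is uniformly close to bounded
linear combinations of finitely many sections in `Γ`. -/
def IsApproximable (Γ : Submodule ℂ (∀ u, H u)) (T : ∀ u, H u → H u) : Prop :=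
  ∀ A : Set M, IsCompact A → ∀ δ : ℝ, 0 < δ → ∃ (n : ℕ) (e : Fin n → ∀ u, H u) (C : ℝ),
    (∀ i, e i ∈ Γ) ∧ ∀ u ∈ A, ∀ ξ : H u, ‖ξ‖ ≤ 1 →
      ∃ a : Fin n → ℂ, (∀ i, ‖a i‖ ≤ C) ∧ ‖T u ξ - ∑ i, a i • e i u‖ ≤ δ

theorem isApproximable_of_fintype {T : ∀ u, H u → H u}
    (h : ∀ A : Set M, IsCompact A → ∀ δ : ℝ, 0 < δ → ∃ (ι : Type*) (_ : Fintype ι)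
      (e : ι → ∀ u, H u) (C : ℝ), (∀ i, e i ∈ Γ) ∧ ∀ u ∈ A, ∀ ξ : H u, ‖ξ‖ ≤ 1 →
        ∃ a : ι → ℂ, (∀ i, ‖a i‖ ≤ C) ∧ ‖T u ξ - ∑ i, a i • e i u‖ ≤ δ) :
    IsApproximable Γ T := by
  intro A hA δ hδ
  obtain ⟨ι, _, e, C, he, h1⟩ := h A hA δ hδ
  let φ := Fintype.equivFin ι
  refine ⟨Fintype.card ι, fun i => e (φ.symm i), C, fun i => he _, fun u hu ξ hξ => ?_⟩
  obtain ⟨a, ha, h2⟩ := h1 u hu ξ hξ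
  refine ⟨fun i => a (φ.symm i), fun i => ha _, ?_⟩
  rwa [Equiv.sum_comp φ.symm fun i => a i • e i u]

namespace IsApproximable

theorem zero : IsApproximable Γ (0 : ∀ u, H u → H u) := fun _ _ δ hδ =>
  ⟨0, fun _ => 0, 0, fun _ => Γ.zero_mem, fun u _ ξ _ => ⟨0, fun i => i.elim0, by simpa using hδ.le⟩⟩

theorem add {T S : ∀ u, H u → H u} (hT : IsApproximable Γ T) (hS : IsApproximable Γ S) :
    IsApproximable Γ (T + S) := by
  refine isApproximable_of_fintype fun A hA δ hδ => ?_
  obtain ⟨n, e, C, he, h1⟩ := hT A hA (δ / 2) (by linarith)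
  obtain ⟨m, f, C', hf, h2⟩ := hS A hA (δ / 2) (by linarith)
  refine ⟨Fin n ⊕ Fin m, inferInstance, Sum.elim e f, max C C',
    fun i => by cases i <;> simp [he, hf], fun u hu ξ hξ => ?_⟩
  obtain ⟨a, ha, h3⟩ := h1 u hu ξ hξ
  obtain ⟨b, hb, h4⟩ := h2 u hu ξ hξ
  refine ⟨Sum.elim a b, fun i => ?_, ?_⟩
  · cases i with
    | inl i => exact (ha i).trans (le_max_left _ _)
    | inr i => exact (hb i).trans (le_max_right _ _)
  · rw [Fintype.sum_sum_type]
    simp only [Sum.elim_inl, Sum.elim_inr, Pi.add_apply]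
    rw [add_sub_add_comm]
    exact (norm_add_le _ _).trans (by linarith)

theorem smul {T : ∀ u, H u → H u} (c : ℂ) (hT : IsApproximable Γ T) :
    IsApproximable Γ (c • T) := by
  intro A hA δ hδ
  obtain ⟨n, e, C, he, h1⟩ := hT A hA (δ / (‖c‖ + 1)) (by positivity)
  refine ⟨n, e, ‖c‖ * C, he, fun u hu ξ hξ => ?_⟩
  obtain ⟨a, ha, h3⟩ := h1 u hu ξ hξ
  refine ⟨fun i => c * a i, fun i => ?_, ?_⟩
  · rw [norm_mul]
    exact mul_le_mul_of_nonneg_left (ha i) (norm_nonneg _)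
  · simp only [mul_smul, ← Finset.smul_sum, Pi.smul_apply, ← smul_sub, norm_smul]
    calc ‖c‖ * ‖T u ξ - ∑ i, a i • e i u‖ ≤ (‖c‖ + 1) * (δ / (‖c‖ + 1)) := by
          gcongr; linarith
      _ = δ := by field_simp

/-- Combinations of finitely many sections, with bounded coefficients and base point in `A`, form
the continuous image of a compact subset of `M × ℂⁿ`; `isCompact_closure_of_approx` then applies. -/
theorem isCompact_closure (hF : IsHilbertField Γ) [T2Space M] [∀ u, CompleteSpace (H u)]
    {T : ∀ u, H u → H u} (hT : IsApproximable Γ T) {A : Set M} (hA : IsCompact A) :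
    @IsCompact _ (tubeTopology Γ) (@closure _ (tubeTopology Γ)
      {ζ : Σ u, H u | ∃ u ∈ A, ∃ ξ : H u, ‖ξ‖ ≤ 1 ∧ ζ = ⟨u, T u ξ⟩}) := by
  let _ := tubeTopology Γ
  refine hF.isCompact_closure_of_approx hA ?_ fun δ hδ => ?_
  · rintro _ ⟨u, hu, ξ, -, rfl⟩
    exact hu
  obtain ⟨n, e, C, he, h1⟩ := hT A hA δ hδ
  let φ : M × (Fin n → ℂ) → Σ u, H u := fun q => ⟨q.1, ∑ i, q.2 i • e i q.1⟩
  have hφ : Continuous φ := by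
    rw [hF.continuous_iff]
    intro q
    have h2 : Tendsto (fun q : M × (Fin n → ℂ) => q.1) (𝓝 q) (𝓝 q.1) := continuous_fst.tendsto q
    change TubeTendsto Γ (𝓝 q) (fun q : M × (Fin n → ℂ) => q.1) (fun q => ∑ i, q.2 i • e i q.1)
      q.1 (∑ i, q.2 i • e i q.1)
    refine hF.tendsto_sum _ h2 fun i _ => hF.tendsto_smul ?_ (hF.tendsto_of_mem (he i) h2)
    exact ((continuous_apply i).comp continuous_snd).continuousAt
  refine ⟨φ '' (A ×ˢ Metric.closedBall 0 (max C 0)),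
    (hA.prod (isCompact_closedBall _ _)).image hφ, ?_⟩
  rintro _ ⟨u, hu, ξ, hξ, rfl⟩
  obtain ⟨a, ha, h2⟩ := h1 u hu ξ hξ
  refine ⟨_, ⟨(u, a), ⟨hu, ?_⟩, rfl⟩, h2⟩
  rw [mem_closedBall_zero_iff, pi_norm_le_iff_of_nonneg (le_max_right _ _)]
  exact fun i => (ha i).trans (le_max_left _ _)

end IsApproximable

end Approximable

/-! ### The averaged operators belong to `KG`. -/

section Family

set_option linter.unusedSectionVars false

variable {dG dM : ℕ} {G M : Type*}
    [TopologicalSpace G] [ChartedSpace (EuclideanSpace ℝ (Fin dG)) G]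
    [TopologicalSpace M] [ChartedSpace (EuclideanSpace ℝ (Fin dM)) M]
    {𝒢 : LieGroupoid dG dM G M}
    {dX j : ℕ} {X Z : Type*}
    [TopologicalSpace X] [ChartedSpace (EuclideanSpace ℝ (Fin dX)) X]
    [MeasurableSpace X] [BorelSpace X]
    [TopologicalSpace Z] [ChartedSpace (EuclideanSpace ℝ (Fin j)) Z] [CompactSpace Z]
    {F : Type*} [NormedAddCommGroup F] [NormedSpace ℂ F]
    {E : X → Type*} [TopologicalSpace (TotalSpace F E)] [∀ x, NormedAddCommGroup (E x)]
    [∀ x, InnerProductSpace ℂ (E x)] [FiberBundle F E] [VectorBundle ℂ F E]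
    {E₀ : Z → Type*} [TopologicalSpace (TotalSpace F E₀)] [∀ z, TopologicalSpace (E₀ z)]
    [∀ z, AddCommGroup (E₀ z)] [∀ z, Module ℂ (E₀ z)] [FiberBundle F E₀]

variable [T2Space X] [SecondCountableTopology X] [LocallyCompactSpace X] [IsManifold (𝓡 j) ∞ Z]
    [FiniteDimensional ℂ F] [T2Space M] [LocallyCompactSpace M] [FirstCountableTopology M]

variable [T2Space G] [SecondCountableTopology G] [LocallyCompactSpace G]
    [MeasurableSpace G] [BorelSpace G]

namespace GFamily

variable (D : GFamily 𝒢 dX j X Z F E E₀)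

/-! ### Elements of `K_G(𝔥)` -/

theorem continuous_toTotal_iff (T : ∀ u, D.H u → D.H u) : Continuous (D.toTotal T) ↔
    @Continuous _ _ (tubeTopology D.fieldSections) (tubeTopology D.fieldSections)
      (fun ζ : Σ u, D.H u => (⟨ζ.1, T ζ.1 ζ.2⟩ : Σ u, D.H u)) := by
  have key : ∀ t t' : TopologicalSpace D.HTotal, t = t' →
      (@Continuous _ _ t t (D.toTotal T) ↔ @Continuous _ _ t' t' (D.toTotal T)) := by
    rintro t _ rfl
    exact Iff.rfl
  exact key _ _ D.topology_eq

theorem isCompactFamily_iff (T : ∀ u, D.H u → D.H u) : D.IsCompactFamily T ↔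
    ∀ A : Set M, IsCompact A → @IsCompact _ (tubeTopology D.fieldSections)
      (@closure _ (tubeTopology D.fieldSections)
        {ζ : Σ u, D.H u | ∃ u ∈ A, ∃ ξ : D.H u, ‖ξ‖ ≤ 1 ∧ ζ = ⟨u, T u ξ⟩}) := by
  have key : ∀ t t' : TopologicalSpace D.HTotal, t = t' → ∀ S : Set D.HTotal,
      (@IsCompact _ t (@closure _ t S) ↔ @IsCompact _ t' (@closure _ t' S)) := by
    rintro t _ rfl S
    exact Iff.rfl
  exact forall_congr' fun A => forall_congr' fun _ => key _ _ D.topology_eq _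

/-- The equivariant bounded morphisms which are approximable by sections. -/
structure IsNice (T : ∀ u, D.H u → D.H u) : Prop where
  morphism : D.IsMorphism T
  bounded : D.IsBounded T
  equivariant : D.IsEquivariant T
  approximable : IsApproximable D.fieldSections T

theorem IsNice.mem_KG {T : ∀ u, D.H u → D.H u} (hT : D.IsNice T) : T ∈ D.KG :=
  ⟨hT.morphism, hT.bounded, (D.isCompactFamily_iff T).2 fun _ hA =>
    hT.approximable.isCompact_closure D.isHilbertField hA, hT.equivariant⟩

theorem continuous_toTotal_add {T S : ∀ u, D.H u → D.H u} (hT : Continuous (D.toTotal T))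
    (hS : Continuous (D.toTotal S)) : Continuous (D.toTotal (T + S)) := by
  rw [continuous_toTotal_iff] at *
  let _ := tubeTopology D.fieldSections
  have hF := D.isHilbertField
  rw [hF.continuous_iff] at *
  exact fun ζ => hF.tendsto_add (hT ζ) (hS ζ)

theorem continuous_toTotal_smul {T : ∀ u, D.H u → D.H u} (c : ℂ)
    (hT : Continuous (D.toTotal T)) : Continuous (D.toTotal (c • T)) := by
  rw [continuous_toTotal_iff] at *
  let _ := tubeTopology D.fieldSections
  have hF := D.isHilbertField
  rw [hF.continuous_iff] at *
  exact fun ζ => hF.tendsto_smul tendsto_const_nhds (hT ζ)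

theorem IsNice.add {T S : ∀ u, D.H u → D.H u} (hT : D.IsNice T) (hS : D.IsNice S) :
    D.IsNice (T + S) where
  morphism := by
    obtain ⟨T', h1, h2⟩ := hT.morphism.adjoint
    obtain ⟨S', h3, h4⟩ := hS.morphism.adjoint
    refine ⟨fun u => ⟨fun ξ η => ?_, fun c ξ => ?_⟩,
      D.continuous_toTotal_add hT.morphism.continuous hS.morphism.continuous, T' + S',
      fun u ξ η => ?_, D.continuous_toTotal_add h2 h4⟩
    · simp only [Pi.add_apply, (hT.morphism.linear u).map_add, (hS.morphism.linear u).map_add]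
      abel
    · simp only [Pi.add_apply, (hT.morphism.linear u).map_smul, (hS.morphism.linear u).map_smul,
        smul_add]
    · simp only [Pi.add_apply, inner_add_left, inner_add_right, h1, h3]
  bounded := by
    obtain ⟨C, hC⟩ := hT.bounded
    obtain ⟨C', hC'⟩ := hS.bounded
    refine ⟨C + C', fun u ξ => (norm_add_le _ _).trans ?_⟩
    rw [add_mul]
    exact add_le_add (hC u ξ) (hC' u ξ)
  equivariant g ξ := by
    simp only [Pi.add_apply, L_add]
    rw [hT.equivariant, hS.equivariant]
  approximable := hT.approximable.add hS.approximable

theorem IsNice.smul {T : ∀ u, D.H u → D.H u} (c : ℂ) (hT : D.IsNice T) : D.IsNice (c • T) where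
  morphism := by
    obtain ⟨T', h1, h2⟩ := hT.morphism.adjoint
    refine ⟨fun u => ⟨fun ξ η => ?_, fun d ξ => ?_⟩,
      D.continuous_toTotal_smul c hT.morphism.continuous, starRingEnd ℂ c • T',
      fun u ξ η => ?_, D.continuous_toTotal_smul _ h2⟩
    · simp only [Pi.smul_apply, (hT.morphism.linear u).map_add, smul_add]
    · simp only [Pi.smul_apply, (hT.morphism.linear u).map_smul, smul_comm c d]
    · simp only [Pi.smul_apply, inner_smul_left, inner_smul_right, h1, Complex.conj_conj]
  bounded := by
    obtain ⟨C, hC⟩ := hT.bounded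
    refine ⟨‖c‖ * C, fun u ξ => ?_⟩
    rw [Pi.smul_apply, Pi.smul_apply, norm_smul, mul_assoc]
    exact mul_le_mul_of_nonneg_left (hC u ξ) (norm_nonneg _)
  equivariant g ξ := by
    simp only [Pi.smul_apply, L_smul]
    rw [hT.equivariant]
  approximable := hT.approximable.smul c

theorem IsNice.zero : D.IsNice (0 : ∀ u, D.H u → D.H u) where
  morphism := by
    have hc : Continuous (D.toTotal (0 : ∀ u, D.H u → D.H u)) := by
      rw [continuous_toTotal_iff]
      let _ := tubeTopology D.fieldSections
      have hF := D.isHilbertField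
      exact hF.continuous_of_tubeCont (T := fun _ _ => 0) (C := 0) (fun u => (0 : D.H u →ₗ[ℂ] D.H u).isLinear)
        (fun u ξ => by simp) fun e _ u => hF.tendsto_of_mem (Submodule.zero_mem _) tendsto_id
    exact ⟨fun u => (0 : D.H u →ₗ[ℂ] D.H u).isLinear, hc, 0, fun u ξ η => by simp, hc⟩
  bounded := ⟨0, fun u ξ => by simp⟩
  equivariant g ξ := by
    have := D.L_smul g rfl rfl 0 (0 : D.H (𝒢.s g))
    simpa using this
  approximable := IsApproximable.zero

/-! ### The averaged operators -/

theorem exists_support (e : CcSection F E) :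
    ∃ K : Set M, IsCompact K ∧ ∀ u ∉ K, (D.restrict e u : D.H u) = 0 := by
  refine ⟨_, e.compact_support.image D.continuous_p, fun u hu => ?_⟩
  have : D.restrict e u = 0 := D.ext_preL2 fun x => by
    by_contra h
    exact hu ⟨x.1, subset_closure h, x.2⟩
  rw [this, UniformSpace.Completion.coe_zero]

theorem norm_Lsec (e : CcSection F E) {u : M} (g : Fib 𝒢.r u) :
    ‖D.Lsec e g‖ = ‖(D.restrict e (𝒢.s g.1) : D.H (𝒢.s g.1))‖ := by
  rw [Lsec, UniformSpace.Completion.norm_coe, UniformSpace.Completion.norm_coe, norm_translate]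

theorem Lsec_eq_L (e : CcSection F E) {u : M} (g : Fib 𝒢.r u) :
    D.Lsec e g = D.L g.1 rfl g.2 (D.restrict e (𝒢.s g.1) : D.H (𝒢.s g.1)) := by
  rw [Lsec, L_coe]

theorem continuous_norm_restrict (e : CcSection F E) :
    Continuous fun u => ‖(D.restrict e u : D.H u)‖ :=
  D.isHilbertField.norm_cont (D.mem_fieldSections e)

theorem hasCompactSupport_norm (e : CcSection F E) :
    HasCompactSupport fun u => ‖(D.restrict e u : D.H u)‖ := by
  obtain ⟨K, hK, h⟩ := D.exists_support e
  exact HasCompactSupport.intro hK fun u hu => by rw [h u hu, norm_zero]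

theorem exists_norm_bound (e : CcSection F E) :
    ∃ C : ℝ, 0 ≤ C ∧ ∀ u, ‖(D.restrict e u : D.H u)‖ ≤ C := by
  obtain ⟨C, hC⟩ := (D.hasCompactSupport_norm e).exists_bound_of_continuous
    (D.continuous_norm_restrict e)
  exact ⟨max C 0, le_max_right _ _, fun u =>
    (le_of_eq (norm_norm _).symm).trans ((hC u).trans (le_max_left _ _))⟩

variable {lam : ∀ u : M, Measure (Fib 𝒢.r u)} (hlam : 𝒢.IsLeftHaarSystem lam)
  (hproper : 𝒢.UnitSpaceProper)
include hlam

theorem continuous_Lsec (e : CcSection F E) (u : M) : Continuous fun g : Fib 𝒢.r u => D.Lsec e g :=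
  hlam.isFibreSystem.continuous_of_tubeCont D.isHilbertField (Ψ := fun _ g => D.Lsec e g)
    (D.tubeCont_Lsec e) u

include hproper

/-- The integrand is continuous and vanishes unless `s g` lies in the compact set carrying `e₁`;
properness makes the set of such `g` in `Gᵘ` compact. -/
theorem integrable_avgIntegrand (e₁ e₂ : CcSection F E) (u : M) (ξ : D.H u) :
    Integrable (D.avgIntegrand e₁ e₂ u ξ) (lam u) := by
  obtain ⟨K, hK, h⟩ := D.exists_support e₁
  have hc : Continuous fun g : Fib 𝒢.r u => (inner ℂ (D.Lsec e₂ g) ξ : ℂ) • D.Lsec e₁ g := by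
    have h1 := D.continuous_Lsec hlam e₁ u
    have h2 := D.continuous_Lsec hlam e₂ u
    fun_prop
  refine hlam.isFibreSystem.integrable (hproper.isCompact (isCompact_singleton (x := u)) hK) hc ?_
  intro g hg
  have : D.Lsec e₁ g = 0 := by
    rw [← norm_eq_zero, norm_Lsec, h _ fun h2 => hg ⟨g.2, h2⟩, norm_zero]
  rw [avgIntegrand, this, smul_zero]

theorem norm_avgOp_le (e₁ e₂ : CcSection F E) (u : M) (ξ : D.H u) :
    ‖D.avgOp lam e₁ e₂ u ξ‖ ≤ (∫ g : Fib 𝒢.r u, ‖(D.restrict e₂ (𝒢.s g.1) : D.H (𝒢.s g.1))‖ *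
      ‖(D.restrict e₁ (𝒢.s g.1) : D.H (𝒢.s g.1))‖ ∂lam u) * ‖ξ‖ := by
  have hi := hlam.integrable_orbit hproper
    ((D.continuous_norm_restrict e₂).mul (D.continuous_norm_restrict e₁))
    (D.hasCompactSupport_norm e₁).mul_left u
  rw [← integral_mul_const]
  refine norm_integral_le_of_norm_le (hi.mul_const _) (.of_forall fun g => ?_)
  rw [avgIntegrand, norm_smul, ← norm_Lsec, ← norm_Lsec]
  have := norm_inner_le_norm (𝕜 := ℂ) (D.Lsec e₂ g) ξ
  nlinarith [norm_nonneg (D.Lsec e₁ g)]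

theorem isLinearMap_avgOp (e₁ e₂ : CcSection F E) (u : M) :
    IsLinearMap ℂ (D.avgOp lam e₁ e₂ u) := by
  have hi := D.integrable_avgIntegrand hlam hproper e₁ e₂ u
  constructor
  · intro ξ η
    rw [avgOp, avgOp, avgOp, ← integral_add (hi ξ) (hi η)]
    exact integral_congr_ae (.of_forall fun g => by
      simp only [avgIntegrand, inner_add_right, add_smul])
  · intro c ξ
    rw [avgOp, avgOp, ← integral_smul]
    exact integral_congr_ae (.of_forall fun g => by
      simp only [avgIntegrand, inner_smul_right, mul_smul])

theorem inner_avgOp (e₁ e₂ : CcSection F E) (u : M) (ξ η : D.H u) :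
    (inner ℂ ξ (D.avgOp lam e₁ e₂ u η) : ℂ) =
      ∫ g, inner ℂ (D.Lsec e₂ g) η * inner ℂ ξ (D.Lsec e₁ g) ∂lam u := by
  rw [avgOp, ← integral_inner (D.integrable_avgIntegrand hlam hproper e₁ e₂ u η)]
  exact integral_congr_ae (.of_forall fun g => by simp only [avgIntegrand, inner_smul_right])

theorem inner_avgOp_adjoint (e₁ e₂ : CcSection F E) (u : M) (ξ η : D.H u) :
    (inner ℂ (D.avgOp lam e₂ e₁ u ξ) η : ℂ) = inner ℂ ξ (D.avgOp lam e₁ e₂ u η) := by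
  rw [← inner_conj_symm, D.inner_avgOp hlam hproper, D.inner_avgOp hlam hproper, ← integral_conj]
  refine integral_congr_ae (.of_forall fun g => ?_)
  simp only [map_mul, inner_conj_symm]
  exact mul_comm _ _

variable (hcompact : 𝒢.UnitSpaceGCompact)
include hcompact

/-- The estimate in `norm_avgOp_le` is an orbit integral of a compactly supported function on `M`,
hence bounded uniformly in `u`. -/
theorem isBounded_avgOp (e₁ e₂ : CcSection F E) : D.IsBounded (D.avgOp lam e₁ e₂) := by
  obtain ⟨C, hC⟩ := hlam.exists_bound_orbit hproper
    ((D.continuous_norm_restrict e₂).mul (D.continuous_norm_restrict e₁))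
    (D.hasCompactSupport_norm e₁).mul_left hcompact
  refine ⟨C, fun u ξ => (D.norm_avgOp_le hlam hproper e₁ e₂ u ξ).trans ?_⟩
  exact mul_le_mul_of_nonneg_right (hC u) (norm_nonneg _)

/-- Boundedness reduces the claim to vectors `fᵘ`. For these the integrand vanishes unless `r g` and
`s g` lie in compact sets, so the fibre integral of a compactly supported section is continuous. -/
theorem continuous_toTotal_avgOp (e₁ e₂ : CcSection F E) :
    Continuous (D.toTotal (D.avgOp lam e₁ e₂)) := by
  rw [continuous_toTotal_iff]
  have hF := D.isHilbertField
  obtain ⟨C, hC⟩ := D.isBounded_avgOp hlam hproper hcompact e₁ e₂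
  refine hF.continuous_of_tubeCont (D.isLinearMap_avgOp hlam hproper e₁ e₂) hC ?_
  rintro _ ⟨f, rfl⟩
  obtain ⟨K, hK, h⟩ := D.exists_support e₁
  obtain ⟨K', hK', h'⟩ := D.exists_support f
  refine hlam.isFibreSystem.tubeCont_integral hF
    (Ψ := fun u g => D.avgIntegrand e₁ e₂ u (D.restrict f u : D.H u) g) ?_
    (hproper.isCompact hK' hK) ?_
  · intro g
    exact hF.tendsto_smul (hF.tendsto_inner (D.tubeCont_Lsec e₂ g)
      (hF.tendsto_of_mem (D.mem_fieldSections f) ((LieGroupoid.continuous_r (𝒢 := 𝒢)).tendsto g)))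
      (D.tubeCont_Lsec e₁ g)
  · intro u g hg
    by_cases hu : u ∈ K'
    · have : D.Lsec e₁ g = 0 := by
        rw [← norm_eq_zero, norm_Lsec, h _ fun h2 => hg ⟨g.2.symm ▸ hu, h2⟩, norm_zero]
      rw [avgIntegrand, this, smul_zero]
    · rw [avgIntegrand, h' u hu, inner_zero_right, zero_smul]

theorem isMorphism_avgOp (e₁ e₂ : CcSection F E) : D.IsMorphism (D.avgOp lam e₁ e₂) :=
  ⟨D.isLinearMap_avgOp hlam hproper e₁ e₂,
    D.continuous_toTotal_avgOp hlam hproper hcompact e₁ e₂, D.avgOp lam e₂ e₁,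
    D.inner_avgOp_adjoint hlam hproper e₁ e₂,
    D.continuous_toTotal_avgOp hlam hproper hcompact e₂ e₁⟩

theorem continuous_avgOp (e₁ e₂ : CcSection F E) (u : M) : Continuous (D.avgOp lam e₁ e₂ u) := by
  obtain ⟨C, hC⟩ := D.isBounded_avgOp hlam hproper hcompact e₁ e₂
  exact ((D.isLinearMap_avgOp hlam hproper e₁ e₂ u).mk' _).mkContinuous C (hC u) |>.continuous

/-- Left invariance is available only for scalar functions in `C_c(G)`. The identity is therefore
tested on matrix coefficients between the dense vectors coming from `C_c(X, E)`, which extend to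
such functions on `G`. -/
theorem isEquivariant_avgOp (e₁ e₂ : CcSection F E) : D.IsEquivariant (D.avgOp lam e₁ e₂) := by
  intro g ξ
  have hF := D.isHilbertField
  refine ext_inner_left ℂ fun η => ?_
  induction ξ, η using UniformSpace.Completion.induction_on₂ with
  | hp =>
    refine isClosed_eq ?_ ?_
    · exact continuous_snd.inner ((D.continuous_L g rfl rfl).comp
        ((D.continuous_avgOp hlam hproper hcompact e₁ e₂ _).comp
          ((D.continuous_L (𝒢.inv g) (𝒢.s_inv g) (𝒢.r_inv g)).comp continuous_fst)))
    · exact continuous_snd.inner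
        ((D.continuous_avgOp hlam hproper hcompact e₁ e₂ _).comp continuous_fst)
  | ih x y =>
    obtain ⟨a, rfl⟩ := D.exists_section_eq x
    obtain ⟨b, rfl⟩ := D.exists_section_eq y
    obtain ⟨K, hK, h⟩ := D.exists_support e₁
    obtain ⟨K', hK', h'⟩ := D.exists_support a
    let φ : G → ℂ := fun k =>
      inner ℂ (D.Lsec e₂ (u := 𝒢.r k) ⟨k, rfl⟩) (D.restrict a (𝒢.r k) : D.H (𝒢.r k)) *
      inner ℂ (D.restrict b (𝒢.r k) : D.H (𝒢.r k)) (D.Lsec e₁ (u := 𝒢.r k) ⟨k, rfl⟩)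
    have hφ : Continuous φ := by
      rw [continuous_iff_continuousAt]
      intro k
      have ha := hF.tendsto_of_mem (D.mem_fieldSections a)
        ((LieGroupoid.continuous_r (𝒢 := 𝒢)).tendsto k)
      have hb := hF.tendsto_of_mem (D.mem_fieldSections b)
        ((LieGroupoid.continuous_r (𝒢 := 𝒢)).tendsto k)
      exact (hF.tendsto_inner (D.tubeCont_Lsec e₂ k) ha).mul
        (hF.tendsto_inner hb (D.tubeCont_Lsec e₁ k))
    have hφs : HasCompactSupport φ := by
      refine HasCompactSupport.intro (hproper.isCompact hK' hK) fun k hk => ?_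
      by_cases hu : 𝒢.r k ∈ K'
      · have : D.Lsec e₁ (u := 𝒢.r k) ⟨k, rfl⟩ = 0 := by
          rw [← norm_eq_zero, norm_Lsec, h _ fun h2 => hk ⟨hu, h2⟩, norm_zero]
        simp only [φ, this, inner_zero_right, mul_zero]
      · simp only [φ, h' _ hu, inner_zero_right, zero_mul]
    have hval : ∀ (u : M) (k : Fib 𝒢.r u), φ k.1 =
        inner ℂ (D.Lsec e₂ k) (D.restrict a u : D.H u) *
          inner ℂ (D.restrict b u : D.H u) (D.Lsec e₁ k) := by
      rintro _ ⟨k, rfl⟩; rfl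
    have hLL : ∀ ζ : D.H (𝒢.r g),
        D.L g rfl rfl (D.L (𝒢.inv g) (𝒢.s_inv g) (𝒢.r_inv g) ζ) = ζ := fun ζ =>
      D.L_L_of_inv (𝒢.inv g) (𝒢.s_inv g) (𝒢.r_inv g) (LieGroupoid.inv_inv (𝒢 := 𝒢) g).symm rfl rfl ζ
    have hinv := hlam.left_invariant g φ hφ hφs
    -- Writing `b` as `L_g L_{g⁻¹} b` and using unitarity moves the outer `L_g` to the other side of
    -- the inner product.
    rw [← hLL (D.restrict b (𝒢.r g) : D.H (𝒢.r g)), inner_L, D.inner_avgOp hlam hproper, hLL,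
      D.inner_avgOp hlam hproper]
    refine Eq.trans ?_ (hinv.trans ?_)
    · refine integral_congr_ae (.of_forall fun k => ?_)
      have h1 := hval (𝒢.r g) ⟨𝒢.mul g k.1, 𝒢.r_mul g k.1 k.2.symm⟩
      simp only at h1 ⊢
      rw [h1, ← L_Lsec, ← L_Lsec, ← D.inner_L g rfl rfl (D.Lsec e₂ k),
        ← D.inner_L g rfl rfl _ (D.Lsec e₁ k), hLL, hLL]
    · exact integral_congr_ae (.of_forall fun k => hval _ k)

/-- Replacing `L_g e₁` by `∑ ρᵢ(g) eᵢ` under the integral turns `T ξ` into a combination of the `eᵢ`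
with coefficients `∫ ⟨L_g e₂, ξ⟩ ρᵢ`. These are bounded uniformly over `A` and the unit ball. -/
theorem isApproximable_avgOp (e₁ e₂ : CcSection F E) :
    IsApproximable D.fieldSections (D.avgOp lam e₁ e₂) := by
  refine isApproximable_of_fintype fun A hA δ hδ => ?_
  have hF := D.isHilbertField
  have hr := hlam.isFibreSystem
  obtain ⟨χ, hχc, hχs, -, -, hχ1⟩ := exists_bump hA
  obtain ⟨K, hK, h⟩ := D.exists_support e₁
  have hK2 := hproper.isCompact hχs hK
  obtain ⟨θ, hθc, hθs, hθ0, -, hθ1⟩ := exists_bump hK2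
  obtain ⟨B, hB0, hB⟩ := D.exists_norm_bound e₂
  have hB' : ∀ u (g : Fib 𝒢.r u), ‖D.Lsec e₂ g‖ ≤ B := fun u g => by rw [norm_Lsec]; exact hB _
  obtain ⟨I, hI⟩ := hA.exists_bound_of_continuousOn (hr.continuous_real hθc hθs).continuousOn
  have hcχ : ∀ g, Tendsto (fun k => (χ (𝒢.r k) : ℂ)) (𝓝 g) (𝓝 (χ (𝒢.r g) : ℂ)) := fun g =>
    (Complex.continuous_ofReal.comp (hχc.comp (LieGroupoid.continuous_r (𝒢 := 𝒢)))).tendsto g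
  -- The factor `χ` makes the section compactly supported and is 1 over `A`. The total error is at
  -- most `B` times the tolerance times `∫ θ ≤ |I| + 1`; the final `+ 1` covers `B = 0`.
  obtain ⟨t, ρ, e, he, hρc, hρs, hρ0, hρ⟩ := hr.exists_approx (Γ := D.fieldSections)
    (Ψ := fun u g => (χ u : ℂ) • D.Lsec e₁ g)
    (fun g => hF.tendsto_smul (hcχ g) (D.tubeCont_Lsec e₁ g)) hK2
    (fun u g hg => by
      by_cases hu : u ∈ tsupport χ
      · have : D.Lsec e₁ g = 0 := by
          rw [← norm_eq_zero, norm_Lsec, h _ fun h2 => hg ⟨g.2.symm ▸ hu, h2⟩, norm_zero]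
        simp only [this, smul_zero]
      · simp [image_eq_zero_of_notMem_tsupport hu])
    hθc hθ0 hθ1 (δ := δ / (B * (|I| + 1) + 1)) (by positivity)
  have hρI : ∀ i : t, ∃ C : ℝ, ∀ u ∈ A, ∫ g : Fib 𝒢.r u, ρ i g.1 ∂lam u ≤ C := fun i => by
    obtain ⟨C, hC⟩ := hA.exists_bound_of_continuousOn
      (hr.continuous_real (hρc i) (hρs i)).continuousOn
    exact ⟨C, fun u hu => (le_abs_self _).trans (hC u hu)⟩
  choose C hC using hρI
  refine ⟨t, inferInstance, e, B * ∑ i, |C i|, he, fun u hu ξ hξ => ?_⟩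
  have hin : ∀ g : Fib 𝒢.r u, ‖(inner ℂ (D.Lsec e₂ g) ξ : ℂ)‖ ≤ B := fun g => by
    refine (norm_inner_le_norm _ _).trans ?_
    calc ‖D.Lsec e₂ g‖ * ‖ξ‖ ≤ B * 1 := by gcongr; exact hB' u g
      _ = B := mul_one B
  have hci : Continuous fun g : Fib 𝒢.r u => (inner ℂ (D.Lsec e₂ g) ξ : ℂ) :=
    (D.continuous_Lsec hlam e₂ u).inner continuous_const
  have hint : ∀ i : t, Integrable (fun g : Fib 𝒢.r u => (inner ℂ (D.Lsec e₂ g) ξ : ℂ) *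
      (ρ i g.1 : ℂ)) (lam u) := fun i =>
    hr.integrable (hρs i) (hci.mul (Complex.continuous_ofReal.comp
      ((hρc i).comp continuous_subtype_val))) fun g hg => by
        rw [image_eq_zero_of_notMem_tsupport hg, Complex.ofReal_zero, mul_zero]
  refine ⟨fun i => ∫ g : Fib 𝒢.r u, inner ℂ (D.Lsec e₂ g) ξ * (ρ i g.1 : ℂ) ∂lam u,
    fun i => ?_, ?_⟩
  · have h1 : ‖∫ g : Fib 𝒢.r u, inner ℂ (D.Lsec e₂ g) ξ * (ρ i g.1 : ℂ) ∂lam u‖ ≤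
        ∫ g : Fib 𝒢.r u, B * ρ i g.1 ∂lam u := by
      refine norm_integral_le_of_norm_le ((hr.integrable_restrict (hρc i) (hρs i)).const_mul B)
        (.of_forall fun g => ?_)
      rw [norm_mul, Complex.norm_real, Real.norm_of_nonneg (hρ0 i g.1)]
      exact mul_le_mul_of_nonneg_right (hin g) (hρ0 i g.1)
    rw [integral_const_mul] at h1
    refine h1.trans (mul_le_mul_of_nonneg_left ?_ hB0)
    refine (hC i u hu).trans ((le_abs_self _).trans ?_)
    exact Finset.single_le_sum (f := fun i => |C i|) (fun i _ => abs_nonneg _) (Finset.mem_univ i)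
  · have h1 : D.avgOp lam e₁ e₂ u ξ - ∑ i : t, (∫ g : Fib 𝒢.r u,
        inner ℂ (D.Lsec e₂ g) ξ * (ρ i g.1 : ℂ) ∂lam u) • e i u =
        ∫ g : Fib 𝒢.r u, (inner ℂ (D.Lsec e₂ g) ξ : ℂ) •
          ((χ u : ℂ) • D.Lsec e₁ g - ∑ i : t, (ρ i g.1 : ℂ) • e i u) ∂lam u := by
      simp only [← integral_smul_const]
      rw [← integral_finsetSum _ fun i _ => (hint i).smul_const _, avgOp,
        ← integral_sub (D.integrable_avgIntegrand hlam hproper e₁ e₂ u ξ)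
          (integrable_finsetSum _ fun i _ => (hint i).smul_const _)]
      refine integral_congr_ae (.of_forall fun g => ?_)
      simp only [avgIntegrand, hχ1 u hu, Complex.ofReal_one, one_smul, smul_sub, Finset.smul_sum,
        smul_smul]
    rw [h1]
    have h2 := norm_integral_le_of_norm_le (μ := lam u)
      (f := fun g : Fib 𝒢.r u => (inner ℂ (D.Lsec e₂ g) ξ : ℂ) •
          ((χ u : ℂ) • D.Lsec e₁ g - ∑ i : t, (ρ i g.1 : ℂ) • e i u))
      ((hr.integrable_restrict hθc hθs).const_mul (B * (δ / (B * (|I| + 1) + 1))))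
      (.of_forall fun g => by
        rw [norm_smul, mul_assoc]
        exact mul_le_mul (hin g) (hρ u g) (norm_nonneg _) hB0)
    refine h2.trans ?_
    rw [integral_const_mul, mul_div_assoc', div_mul_eq_mul_div, div_le_iff₀ (by positivity)]
    have h3 : ∫ g : Fib 𝒢.r u, θ g.1 ∂lam u ≤ |I| + 1 :=
      (le_abs_self _).trans ((hI u hu).trans ((le_abs_self I).trans (by linarith)))
    have h4 : B * δ * ∫ g : Fib 𝒢.r u, θ g.1 ∂lam u ≤ B * δ * (|I| + 1) := by gcongr
    nlinarith

theorem isNice_avgOp (e₁ e₂ : CcSection F E) : D.IsNice (D.avgOp lam e₁ e₂) :=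
  ⟨D.isMorphism_avgOp hlam hproper hcompact e₁ e₂, D.isBounded_avgOp hlam hproper hcompact e₁ e₂,
    D.isEquivariant_avgOp hlam hproper hcompact e₁ e₂,
    D.isApproximable_avgOp hlam hproper hcompact e₁ e₂⟩

theorem isNice_of_mem_span {T : ∀ u, D.H u → D.H u} (hT : T ∈ Submodule.span ℂ
    {T | ∃ e₁ e₂ : CcSection F E, T = D.avgOp lam e₁ e₂}) : D.IsNice T := by
  induction hT using Submodule.span_induction with
  | mem T h =>
    obtain ⟨e₁, e₂, rfl⟩ := h
    exact D.isNice_avgOp hlam hproper hcompact e₁ e₂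
  | zero => exact IsNice.zero D
  | add T S _ _ hT hS => exact hT.add D hS
  | smul c T _ hT => exact hT.smul D c

end GFamily

end Family

/-! ## Finite rank approximation of compact families -/

/-- The deviation from the orthonormal case is at most `n / (n + 1)` times `∑ ‖a i‖ ^ 2`, by the
inequality between arithmetic and geometric means. A tolerance is needed because an orthonormal
basis at `u₀`, extended by sections, is only nearly orthonormal at nearby points. -/
theorem norm_sum_smul_sq_le {V : Type*} [NormedAddCommGroup V] [InnerProductSpace ℂ V] {n : ℕ}
    {e : Fin n → V}
    (h : ∀ i k, ‖(inner ℂ (e i) (e k) : ℂ) - if i = k then 1 else 0‖ ≤ 1 / (n + 1))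
    (a : Fin n → ℂ) : ‖∑ i, a i • e i‖ ^ 2 ≤ 2 * ∑ i, ‖a i‖ ^ 2 := by
  have h1 : ((‖∑ i, a i • e i‖ ^ 2 : ℝ) : ℂ) = ((∑ i, ‖a i‖ ^ 2 : ℝ) : ℂ) +
      ∑ i, ∑ k, starRingEnd ℂ (a i) * a k * ((inner ℂ (e i) (e k) : ℂ) - if i = k then 1 else 0) := by
    have h2 := inner_self_eq_norm_sq_to_K (𝕜 := ℂ) (∑ i, a i • e i)
    push_cast
    refine h2.symm.trans ?_
    rw [sum_inner]
    simp only [inner_sum, inner_smul_left, inner_smul_right, mul_sub, Finset.sum_sub_distrib,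
      mul_ite, mul_one, mul_zero, Finset.sum_ite_eq, Finset.mem_univ, if_true]
    simp only [← Complex.conj_mul']
    rw [add_sub_cancel]
    exact Finset.sum_congr rfl fun i _ => Finset.sum_congr rfl fun k _ => by ring
  have h3 : ‖∑ i, ∑ k, starRingEnd ℂ (a i) * a k *
      ((inner ℂ (e i) (e k) : ℂ) - if i = k then 1 else 0)‖ ≤ ∑ i, ‖a i‖ ^ 2 := by
    calc _ ≤ ∑ i, ∑ k, (‖a i‖ ^ 2 + ‖a k‖ ^ 2) / 2 * (1 / (n + 1)) := by
          refine (norm_sum_le _ _).trans (Finset.sum_le_sum fun i _ =>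
            (norm_sum_le _ _).trans (Finset.sum_le_sum fun k _ => ?_))
          rw [norm_mul, norm_mul, Complex.norm_conj]
          refine mul_le_mul ?_ (h i k) (norm_nonneg _) (by positivity)
          nlinarith [sq_nonneg (‖a i‖ - ‖a k‖)]
      _ = (n / (n + 1)) * ∑ i, ‖a i‖ ^ 2 := by
          simp only [← Finset.sum_mul, ← Finset.sum_div, Finset.sum_add_distrib, Finset.sum_const,
            Finset.card_univ, Fintype.card_fin, nsmul_eq_mul, ← Finset.mul_sum]
          field_simp
          ring
      _ ≤ 1 * ∑ i, ‖a i‖ ^ 2 := by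
          refine mul_le_mul_of_nonneg_right ?_ (Finset.sum_nonneg fun i _ => by positivity)
          rw [div_le_one (by positivity)]
          linarith
      _ = _ := one_mul _
  have h4 := congrArg Complex.re h1
  rw [Complex.add_re, Complex.ofReal_re, Complex.ofReal_re] at h4
  have := (Complex.re_le_norm _).trans h3
  linarith

/-- With `q` the sum on the left, `∑ |⟨eᵢ, ζ⟩|² = ⟨ζ, q⟩`, so the previous bound gives `‖q‖² ≤ 2 ‖ζ‖
‖q‖`. -/
theorem norm_sum_inner_smul_le {V : Type*} [NormedAddCommGroup V] [InnerProductSpace ℂ V] {n : ℕ}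
    {e : Fin n → V}
    (h : ∀ i k, ‖(inner ℂ (e i) (e k) : ℂ) - if i = k then 1 else 0‖ ≤ 1 / (n + 1)) (ζ : V) :
    ‖∑ i, (inner ℂ (e i) ζ : ℂ) • e i‖ ≤ 2 * ‖ζ‖ := by
  have h1 := norm_sum_smul_sq_le h fun i => (inner ℂ (e i) ζ : ℂ)
  set q := ∑ i, (inner ℂ (e i) ζ : ℂ) • e i with hq
  have h2 : ((∑ i, ‖(inner ℂ (e i) ζ : ℂ)‖ ^ 2 : ℝ) : ℂ) = inner ℂ ζ q := by
    rw [hq, inner_sum]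
    push_cast
    refine Finset.sum_congr rfl fun i _ => ?_
    rw [inner_smul_right, ← inner_conj_symm ζ (e i), Complex.mul_conj']
  have h3 := congrArg norm h2
  rw [Complex.norm_real, Real.norm_of_nonneg (Finset.sum_nonneg fun i _ => by positivity)] at h3
  have h4 := norm_inner_le_norm (𝕜 := ℂ) ζ q
  by_contra hne
  rw [not_le] at hne
  nlinarith [norm_nonneg ζ, norm_nonneg q]

theorem _root_.IsLinearMap.norm_le_of_unit {V W : Type*} [NormedAddCommGroup V] [NormedSpace ℂ V]
    [NormedAddCommGroup W] [NormedSpace ℂ W] {f : V → W} (hf : IsLinearMap ℂ f) {C : ℝ}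
    (h : ∀ ξ, ‖ξ‖ ≤ 1 → ‖f ξ‖ ≤ C) (ξ : V) : ‖f ξ‖ ≤ C * ‖ξ‖ := by
  by_cases hξ : ξ = 0
  · subst hξ
    rw [hf.map_zero]; simp
  · have hn := norm_pos_iff.2 hξ
    have h1 := h (((‖ξ‖ : ℂ))⁻¹ • ξ) (by
      rw [norm_smul, norm_inv, Complex.norm_real, norm_norm, inv_mul_cancel₀ hn.ne'])
    rw [hf.map_smul, norm_smul, norm_inv, Complex.norm_real, norm_norm] at h1
    rwa [inv_mul_le_iff₀ hn, mul_comm] at h1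

/-- Finitely many vectors of a fibre are fixed by a projection `∑ |eᵢ⟩⟨eᵢ|` onto a subspace with an
orthonormal basis consisting of values of sections. -/
theorem exists_orthonormal_sections {M : Type*} {H : M → Type*} [∀ u, NormedAddCommGroup (H u)]
    [∀ u, InnerProductSpace ℂ (H u)] {Γ : Submodule ℂ (∀ u, H u)} (u : M) (t : Finset Γ) :
    ∃ (n : ℕ) (e : Fin n → ∀ v, H v), (∀ i, e i ∈ Γ) ∧
      (∀ i k, (inner ℂ (e i u) (e k u) : ℂ) = if i = k then 1 else 0) ∧
      ∀ f ∈ t, ∑ i, (inner ℂ (e i u) (f.1 u) : ℂ) • e i u = f.1 u := by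
  let S : Submodule ℂ (H u) := Submodule.span ℂ ((fun f : Γ => f.1 u) '' t)
  have : FiniteDimensional ℂ S := FiniteDimensional.span_of_finite ℂ (t.finite_toSet.image _)
  let b := stdOrthonormalBasis ℂ S
  have hS : S ≤ Γ.map (LinearMap.proj u) := by
    refine Submodule.span_le.2 ?_
    rintro _ ⟨f, -, rfl⟩
    exact ⟨f.1, f.2, rfl⟩
  choose e he heb using fun i => hS (b i).2
  have hval : ∀ i, e i u = (b i : H u) := heb
  refine ⟨_, e, he, fun i k => ?_, fun f hf => ?_⟩
  · rw [hval, hval, ← Submodule.coe_inner]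
    exact orthonormal_iff_ite.1 b.orthonormal i k
  · have hfS : f.1 u ∈ S := Submodule.subset_span ⟨f, hf, rfl⟩
    have h1 := congrArg (Subtype.val : S → H u) (b.sum_repr' ⟨f.1 u, hfS⟩)
    simpa [hval] using h1

section Field

variable {M : Type*} [TopologicalSpace M] {H : M → Type*} [∀ u, NormedAddCommGroup (H u)]
  [∀ u, InnerProductSpace ℂ (H u)] {Γ : Submodule ℂ (∀ u, H u)}

namespace IsHilbertField

variable (hF : IsHilbertField Γ)
include hF

theorem exists_finite_net {S : Set (Σ u, H u)}
    (hS : @IsCompact _ (tubeTopology Γ) (@closure _ (tubeTopology Γ) S)) {ε : ℝ} (hε : 0 < ε) :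
    ∃ t : Finset Γ, ∀ ζ ∈ S, ∃ e ∈ t, ‖ζ.2 - e.1 ζ.1‖ < ε := by
  let _ := tubeTopology Γ
  obtain ⟨t, ht⟩ := hS.elim_finite_subcover
    (fun e : Γ => {ζ : Σ u, H u | ζ.1 ∈ (univ : Set M) ∧ ‖ζ.2 - e.1 ζ.1‖ < ε})
    (fun e => TopologicalSpace.isOpen_generateFrom_of_mem
      ⟨univ, e.1, ε, e.2, isOpen_univ, hε, rfl⟩)
    (fun ζ _ => by
      obtain ⟨e, he, h⟩ := hF.dense ζ.1 ζ.2 ε hε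
      exact mem_iUnion.2 ⟨⟨e, he⟩, trivial, h⟩)
  refine ⟨t, fun ζ hζ => ?_⟩
  obtain ⟨e, he, h⟩ := mem_iUnion₂.1 (ht (subset_closure hζ))
  exact ⟨e, he, h.2⟩

/-- Compactness provides finitely many sections close to every `R u ξ`, and `P = ∑ |eᵢ⟩⟨eᵢ|` nearly
fixes them around `u₀`, so `R` is close to `P R`. Since `P R ξ = ∑ ⟨R' eᵢ, ξ⟩ eᵢ`, continuity of the
adjoint allows `R' eᵢ` to be replaced by some `fᵢ ∈ Γ` near `u₀`. -/
theorem exists_finiteRank_near {R R' : ∀ u, H u → H u} (hR : ∀ u, IsLinearMap ℂ (R u))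
    (hadj : ∀ u (ξ η : H u), (inner ℂ (R' u ξ) η : ℂ) = inner ℂ ξ (R u η))
    (hR' : ∀ e ∈ Γ, TubeCont Γ (fun u => u) fun u => R' u (e u)) {A : Set M} {u₀ : M}
    (hA : A ∈ 𝓝 u₀) (hAc : @IsCompact _ (tubeTopology Γ) (@closure _ (tubeTopology Γ)
      {ζ : Σ u, H u | ∃ u ∈ A, ∃ ξ : H u, ‖ξ‖ ≤ 1 ∧ ζ = ⟨u, R u ξ⟩})) {ε : ℝ} (hε : 0 < ε) :
    ∃ (n : ℕ) (e f : Fin n → ∀ u, H u), (∀ i, e i ∈ Γ) ∧ (∀ i, f i ∈ Γ) ∧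
      ∀ᶠ u in 𝓝 u₀, ∀ ξ : H u, ‖R u ξ - ∑ i, (inner ℂ (f i u) ξ : ℂ) • e i u‖ ≤ ε * ‖ξ‖ := by
  -- The four terms of the final decomposition cost one, one, two and one fifths of `ε`; the two is
  -- the norm bound for the nearly orthogonal projection.
  obtain ⟨t, ht⟩ := hF.exists_finite_net hAc (ε := ε / 5) (by positivity)
  obtain ⟨n, e, he, heo, het⟩ := exists_orthonormal_sections u₀ t
  have hid : Tendsto (fun u : M => u) (𝓝 u₀) (𝓝 u₀) := tendsto_id
  have hgram : ∀ᶠ u in 𝓝 u₀, ∀ i k,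
      ‖(inner ℂ (e i u) (e k u) : ℂ) - if i = k then 1 else 0‖ ≤ 1 / (n + 1) := by
    refine eventually_all.2 fun i => eventually_all.2 fun k => ?_
    have h1 := (hF.inner_cont _ (he i) _ (he k)).tendsto u₀
    rw [heo] at h1
    filter_upwards [(Metric.tendsto_nhds.1 h1) (1 / (n + 1)) (by positivity)] with u hu
    rw [dist_eq_norm] at hu
    exact hu.le
  have hfix : ∀ᶠ u in 𝓝 u₀, ∀ k ∈ t,
      ‖k.1 u - ∑ i, (inner ℂ (e i u) (k.1 u) : ℂ) • e i u‖ ≤ ε / 5 := by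
    refine (Finset.eventually_all t).2 fun k hk => ?_
    have h1 : TubeTendsto Γ (𝓝 u₀) (fun u => u)
        (fun u => k.1 u - ∑ i, (inner ℂ (e i u) (k.1 u) : ℂ) • e i u) u₀
        (k.1 u₀ - ∑ i, (inner ℂ (e i u₀) (k.1 u₀) : ℂ) • e i u₀) :=
      hF.tendsto_sub (hF.tendsto_of_mem k.2 hid) (hF.tendsto_sum _ hid fun i _ =>
        hF.tendsto_smul ((hF.inner_cont _ (he i) _ k.2).tendsto u₀) (hF.tendsto_of_mem (he i) hid))
    rw [het k hk, sub_self] at h1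
    have h2 := hF.tendsto_norm h1
    rw [norm_zero] at h2
    filter_upwards [h2.eventually (gt_mem_nhds (show (0 : ℝ) < ε / 5 by positivity))] with u hu
    exact hu.le
  have hen : ∀ᶠ u in 𝓝 u₀, ∀ i, ‖e i u‖ ≤ ‖e i u₀‖ + 1 := by
    refine eventually_all.2 fun i => ?_
    filter_upwards [((hF.norm_cont (he i)).tendsto u₀).eventually
      (gt_mem_nhds (lt_add_one ‖e i u₀‖))] with u hu using hu.le
  set N : ℝ := ∑ i, (‖e i u₀‖ + 1) with hN
  have hN0 : 0 ≤ N := Finset.sum_nonneg fun i _ => by positivity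
  -- Near `u₀` the norms of the `e i` sum to at most `N`.
  choose f hf hf0 hfn using fun i => (hR' (e i) (he i) u₀).2 (ε / 5 / (N + 1)) (by positivity)
  refine ⟨n, e, f, he, hf, ?_⟩
  filter_upwards [hgram, hfix, hen, eventually_all.2 hfn, hA] with u h1 h2 h3 h4 h5
  have hlin : IsLinearMap ℂ fun ξ => R u ξ - ∑ i, (inner ℂ (f i u) ξ : ℂ) • e i u := by
    constructor
    · intro ξ η
      simp only [(hR u).map_add, inner_add_right, add_smul, Finset.sum_add_distrib]
      abel
    · intro c ξ
      simp only [(hR u).map_smul, inner_smul_right, mul_smul, smul_sub, Finset.smul_sum]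
  refine hlin.norm_le_of_unit fun ξ hξ => ?_
  obtain ⟨k, hk, hkn⟩ := ht ⟨u, R u ξ⟩ ⟨u, h5, ξ, hξ, rfl⟩
  simp only at hkn
  have e1 := norm_sum_inner_smul_le h1 (k.1 u - R u ξ)
  have e2 := h2 k hk
  have e3 : ‖∑ i, (inner ℂ (R' u (e i u) - f i u) ξ : ℂ) • e i u‖ ≤ ε / 5 := by
    calc _ ≤ ∑ i, ε / 5 / (N + 1) * (‖e i u₀‖ + 1) := by
          refine (norm_sum_le _ _).trans (Finset.sum_le_sum fun i _ => ?_)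
          rw [norm_smul]
          refine mul_le_mul ?_ (h3 i) (norm_nonneg _) (by positivity)
          refine (norm_inner_le_norm _ _).trans ?_
          calc _ ≤ ε / 5 / (N + 1) * 1 :=
                mul_le_mul (h4 i).le hξ (norm_nonneg _) (by positivity)
            _ = _ := mul_one _
      _ = ε / 5 * (N / (N + 1)) := by rw [← Finset.mul_sum, ← hN]; ring
      _ ≤ ε / 5 * 1 := by
          refine mul_le_mul_of_nonneg_left ?_ (by positivity)
          rw [div_le_one (by positivity)]
          linarith
      _ = _ := mul_one _
  have e4 : R u ξ - ∑ i, (inner ℂ (f i u) ξ : ℂ) • e i u = (R u ξ - k.1 u) +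
      (k.1 u - ∑ i, (inner ℂ (e i u) (k.1 u) : ℂ) • e i u) +
      (∑ i, (inner ℂ (e i u) (k.1 u - R u ξ) : ℂ) • e i u) +
      ∑ i, (inner ℂ (R' u (e i u) - f i u) ξ : ℂ) • e i u := by
    simp only [inner_sub_left, inner_sub_right, hadj, sub_smul, Finset.sum_sub_distrib]
    abel
  rw [e4]
  refine (norm_add_le _ _).trans ((add_le_add (norm_add₃_le) le_rfl).trans ?_)
  rw [norm_sub_rev (k.1 u)] at e1
  linarith

/-- A partition of unity on `K` glues the local approximations; its functions are absorbed into the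
sections `e`, so the result is still a finite sum of rank one families. -/
theorem exists_finiteRank_on [T2Space M] [LocallyCompactSpace M] {R R' : ∀ u, H u → H u}
    (hR : ∀ u, IsLinearMap ℂ (R u))
    (hadj : ∀ u (ξ η : H u), (inner ℂ (R' u ξ) η : ℂ) = inner ℂ ξ (R u η))
    (hR' : ∀ e ∈ Γ, TubeCont Γ (fun u => u) fun u => R' u (e u))
    (hRc : ∀ A : Set M, IsCompact A → @IsCompact _ (tubeTopology Γ) (@closure _ (tubeTopology Γ)
      {ζ : Σ u, H u | ∃ u ∈ A, ∃ ξ : H u, ‖ξ‖ ≤ 1 ∧ ζ = ⟨u, R u ξ⟩})) {K : Set M}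
    (hK : IsCompact K) {ε : ℝ} (hε : 0 < ε) :
    ∃ (t : Finset M) (n : t → ℕ) (e f : ∀ k, Fin (n k) → ∀ u, H u), (∀ k i, e k i ∈ Γ) ∧
      (∀ k i, f k i ∈ Γ) ∧ ∀ u ∈ K, ∀ ξ : H u,
        ‖R u ξ - ∑ k, ∑ i, (inner ℂ (f k i u) ξ : ℂ) • e k i u‖ ≤ ε * ‖ξ‖ := by
  choose A hA hAn using fun u₀ : M => exists_compact_mem_nhds u₀
  choose n e f he hf hn using fun u₀ : M =>
    hF.exists_finiteRank_near hR hadj hR' (hAn u₀) (hRc _ (hA u₀)) hε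
  obtain ⟨t, ρ, -, hρc, -, hρ0, hρs, hρ1, -⟩ := exists_finite_partition hK _ fun u _ => hn u
  refine ⟨t, fun k => n k, fun k i u => (ρ k u : ℂ) • e k i u, fun k => f k,
    fun k i => hF.smul_mem _ (he k i) _ (Complex.continuous_ofReal.comp (hρc k)),
    fun k i => hf k i, fun u hu ξ => ?_⟩
  have h1 : R u ξ - ∑ k : t, ∑ i, (inner ℂ (f k i u) ξ : ℂ) • (ρ k u : ℂ) • e k i u =
      ∑ k : t, (ρ k u : ℂ) • (R u ξ - ∑ i, (inner ℂ (f k i u) ξ : ℂ) • e k i u) := by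
    simp only [smul_sub, Finset.sum_sub_distrib, ← Finset.sum_smul, ← Complex.ofReal_sum, hρ1 u hu,
      Complex.ofReal_one, one_smul, Finset.smul_sum]
    simp only [smul_comm (ρ _ u : ℂ)]
  rw [h1]
  calc _ ≤ ∑ k : t, ρ k u * (ε * ‖ξ‖) := by
        refine (norm_sum_le _ _).trans (Finset.sum_le_sum fun k _ => ?_)
        rw [norm_smul, Complex.norm_real, Real.norm_of_nonneg (hρ0 k u)]
        by_cases h0 : ρ k u = 0
        · rw [h0, zero_mul, zero_mul]
        · exact mul_le_mul_of_nonneg_left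
            (interior_subset (hρs k (subset_tsupport _ h0)) ξ) (hρ0 k u)
    _ = ε * ‖ξ‖ := by rw [← Finset.sum_mul, hρ1 u hu, one_mul]

end IsHilbertField

end Field

/-! ### Averaging finite rank approximations over the groupoid. -/

section Family

set_option linter.unusedSectionVars false

variable {dG dM : ℕ} {G M : Type*}
    [TopologicalSpace G] [ChartedSpace (EuclideanSpace ℝ (Fin dG)) G]
    [TopologicalSpace M] [ChartedSpace (EuclideanSpace ℝ (Fin dM)) M]
    {𝒢 : LieGroupoid dG dM G M}
    {dX j : ℕ} {X Z : Type*}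
    [TopologicalSpace X] [ChartedSpace (EuclideanSpace ℝ (Fin dX)) X]
    [MeasurableSpace X] [BorelSpace X]
    [TopologicalSpace Z] [ChartedSpace (EuclideanSpace ℝ (Fin j)) Z] [CompactSpace Z]
    {F : Type*} [NormedAddCommGroup F] [NormedSpace ℂ F]
    {E : X → Type*} [TopologicalSpace (TotalSpace F E)] [∀ x, NormedAddCommGroup (E x)]
    [∀ x, InnerProductSpace ℂ (E x)] [FiberBundle F E] [VectorBundle ℂ F E]
    {E₀ : Z → Type*} [TopologicalSpace (TotalSpace F E₀)] [∀ z, TopologicalSpace (E₀ z)]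
    [∀ z, AddCommGroup (E₀ z)] [∀ z, Module ℂ (E₀ z)] [FiberBundle F E₀]

variable [T2Space X] [SecondCountableTopology X] [LocallyCompactSpace X] [IsManifold (𝓡 j) ∞ Z]
    [FiniteDimensional ℂ F] [T2Space M] [LocallyCompactSpace M] [FirstCountableTopology M]

variable [T2Space G] [SecondCountableTopology G] [LocallyCompactSpace G]
    [MeasurableSpace G] [BorelSpace G]

namespace GFamily

variable (D : GFamily 𝒢 dX j X Z F E E₀)

/-! ### Density -/

theorem map_inv_of_isEquivariant {R : ∀ u, D.H u → D.H u} (hR : D.IsEquivariant R) (g : G)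
    (η : D.H (𝒢.s g)) : R (𝒢.r g) (D.L g rfl rfl η) = D.L g rfl rfl (R (𝒢.s g) η) := by
  rw [← hR g, D.L_L_of_inv g rfl rfl rfl (𝒢.r_inv g) (𝒢.s_inv g)]

/-- Both `R` and the averaged operator are integrals of conjugates by `L_g`, weighted by `c(s g)`:
of `R` itself, by equivariance, and of its finite rank approximation over the support of `c`. -/
theorem exists_avgOp_near {lam : ∀ u : M, Measure (Fib 𝒢.r u)} (hlam : 𝒢.IsLeftHaarSystem lam)
    (hproper : 𝒢.UnitSpaceProper) (hcompact : 𝒢.UnitSpaceGCompact) {R : ∀ u, D.H u → D.H u}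
    (hR : R ∈ D.KG) {ε : ℝ} (hε : 0 < ε) :
    ∃ S ∈ Submodule.span ℂ {T | ∃ e₁ e₂ : CcSection F E, T = D.avgOp lam e₁ e₂},
      ∀ u (ξ : D.H u), ‖R u ξ - S u ξ‖ ≤ ε * ‖ξ‖ := by
  have hF := D.isHilbertField
  obtain ⟨⟨hlin, -, R', hadj, hR'c⟩, -, hRc, hReq⟩ := hR
  obtain ⟨c, hc, hcs, hc0, hc1⟩ := hlam.exists_cutoff hproper hcompact
  obtain ⟨t, n, e, f, he, hf, hef⟩ := hF.exists_finiteRank_on hlin hadj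
    (fun σ hσ => hF.tubeCont_apply ((D.continuous_toTotal_iff R').1 hR'c) hσ)
    ((D.isCompactFamily_iff R).1 hRc) hcs hε
  -- The cutoff is put into the first section, so that the weight `c(s g)` comes out of `L_g (c e)`.
  choose e' he' using fun k i =>
    hF.smul_mem _ (he k i) (fun u => (c u : ℂ)) (Complex.continuous_ofReal.comp hc)
  choose f' hf' using hf
  refine ⟨∑ k, ∑ i, D.avgOp lam (e' k i) (f' k i), Submodule.sum_mem _ fun k _ =>
    Submodule.sum_mem _ fun i _ => Submodule.subset_span ⟨_, _, rfl⟩, fun u ξ => ?_⟩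
  have hi := hlam.integrable_orbit hproper hc hcs u
  have hia := fun k i => D.integrable_avgIntegrand hlam hproper (e' k i) (f' k i) u ξ
  have h1 : R u ξ - (∑ k, ∑ i, D.avgOp lam (e' k i) (f' k i)) u ξ =
      ∫ g : Fib 𝒢.r u, ((c (𝒢.s g.1) : ℂ) • R u ξ -
        ∑ k, ∑ i, D.avgIntegrand (e' k i) (f' k i) u ξ g) ∂lam u := by
    have hic : Integrable (fun g : Fib 𝒢.r u => (c (𝒢.s g.1) : ℂ) • R u ξ) (lam u) :=
      (hi.ofReal (𝕜 := ℂ)).smul_const _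
    rw [integral_sub hic (integrable_finsetSum _ fun k _ =>
        integrable_finsetSum _ fun i _ => hia k i), integral_smul_const, integral_complex_ofReal,
      hc1, Complex.ofReal_one, one_smul, integral_finsetSum _ fun k _ =>
        integrable_finsetSum _ fun i _ => hia k i]
    simp only [Finset.sum_apply, integral_finsetSum _ fun i _ => hia _ i]
    rfl
  have h2 : ∀ g : Fib 𝒢.r u, ‖(c (𝒢.s g.1) : ℂ) • R u ξ -
      ∑ k, ∑ i, D.avgIntegrand (e' k i) (f' k i) u ξ g‖ ≤ c (𝒢.s g.1) * (ε * ‖ξ‖) := by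
    rintro ⟨g, rfl⟩
    -- With `ξ = L_g η`, unitarity and equivariance write the integrand as `L_g` applied to the
    -- finite rank error at `s g`.
    obtain ⟨η, rfl⟩ : ∃ η : D.H (𝒢.s g), D.L g rfl rfl η = ξ :=
      ⟨_, D.L_L_of_inv (𝒢.inv g) (𝒢.s_inv g) (𝒢.r_inv g)
        (LieGroupoid.inv_inv (𝒢 := 𝒢) g).symm rfl rfl ξ⟩
    have h3 : (c (𝒢.s g) : ℂ) • R (𝒢.r g) (D.L g rfl rfl η) -
        ∑ k, ∑ i, D.avgIntegrand (e' k i) (f' k i) (𝒢.r g) (D.L g rfl rfl η) ⟨g, rfl⟩ =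
        D.L g rfl rfl ((c (𝒢.s g) : ℂ) •
          (R (𝒢.s g) η - ∑ k, ∑ i, (inner ℂ (f k i (𝒢.s g)) η : ℂ) • e k i (𝒢.s g))) := by
      have hΛ : ∀ ζ : D.H (𝒢.s g), D.L g rfl rfl ζ = D.Lₗᵢ g rfl rfl ζ := fun _ => rfl
      rw [D.map_inv_of_isEquivariant hReq]
      simp only [avgIntegrand, Lsec_eq_L, ← congrFun (he' _ _) (𝒢.s g),
        ← congrFun (hf' _ _) (𝒢.s g), hΛ,
        LinearIsometry.inner_map_map, map_smul, map_sub, map_sum, smul_sub, Finset.smul_sum]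
      simp only [smul_comm (c (𝒢.s g) : ℂ)]
    rw [h3, norm_L, norm_smul, Complex.norm_real, Real.norm_of_nonneg (hc0 _), norm_L]
    -- The finite rank estimate is known only over the support of `c`; elsewhere the weight
    -- vanishes.
    by_cases h0 : c (𝒢.s g) = 0
    · rw [h0, zero_mul, zero_mul]
    · exact mul_le_mul_of_nonneg_left (hef _ (subset_tsupport _ h0) η) (hc0 _)
  rw [h1]
  refine (norm_integral_le_of_norm_le (hi.mul_const _) (.of_forall h2)).trans_eq ?_
  rw [integral_mul_const, hc1, one_mul]

end GFamily

end Family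

end ProperLie

theorem proposition5p3 {dG dM dX j : ℕ} {G M X Z : Type*}
    -- the manifolds of arrows and of units of the groupoid
    [TopologicalSpace G] [T2Space G] [SecondCountableTopology G]
    [ChartedSpace (EuclideanSpace ℝ (Fin dG)) G] [IsManifold (𝓡 dG) ∞ G]
    [MeasurableSpace G] [BorelSpace G]
    [TopologicalSpace M] [T2Space M] [SecondCountableTopology M]
    [ChartedSpace (EuclideanSpace ℝ (Fin dM)) M] [IsManifold (𝓡 dM) ∞ M]
    -- the manifold on which the groupoid acts, and the compact model of its fibres
    [TopologicalSpace X] [T2Space X] [SecondCountableTopology X]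
    [ChartedSpace (EuclideanSpace ℝ (Fin dX)) X] [IsManifold (𝓡 dX) ∞ X]
    [MeasurableSpace X] [BorelSpace X]
    [TopologicalSpace Z] [T2Space Z] [CompactSpace Z]
    [ChartedSpace (EuclideanSpace ℝ (Fin j)) Z] [IsManifold (𝓡 j) ∞ Z]
    -- the smooth complex vector bundles over these
    {F : Type*} [NormedAddCommGroup F] [NormedSpace ℂ F] [FiniteDimensional ℂ F]
    {E : X → Type*} [TopologicalSpace (TotalSpace F E)] [∀ x, NormedAddCommGroup (E x)]
    [∀ x, InnerProductSpace ℂ (E x)] [FiberBundle F E] [VectorBundle ℂ F E]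
    [VectorBundle ℝ F E] [ContMDiffVectorBundle ∞ F E (𝓡 dX)]
    {E₀ : Z → Type*} [TopologicalSpace (TotalSpace F E₀)] [∀ z, TopologicalSpace (E₀ z)]
    [∀ z, AddCommGroup (E₀ z)] [∀ z, Module ℂ (E₀ z)] [FiberBundle F E₀] [VectorBundle ℂ F E₀]
    [VectorBundle ℝ F E₀] [ContMDiffVectorBundle ∞ F E₀ (𝓡 j)]
    -- the groupoid, the equivariant family and the left Haar system
    (𝒢 : LieGroupoid dG dM G M) (hproper : 𝒢.UnitSpaceProper) (hcompact : 𝒢.UnitSpaceGCompact)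
    (D : GFamily 𝒢 dX j X Z F E E₀)
    (lam : ∀ u : M, Measure (Fib 𝒢.r u)) (hlam : 𝒢.IsLeftHaarSystem lam) :
    (∀ e₁ e₂ : CcSection F E,
      (∀ u (ξ : D.H u), Integrable (D.avgIntegrand e₁ e₂ u ξ) (lam u)) ∧
        D.avgOp lam e₁ e₂ ∈ D.KG) ∧
    ((Submodule.span ℂ {T | ∃ e₁ e₂ : CcSection F E, T = D.avgOp lam e₁ e₂} :
        Submodule ℂ (∀ u, D.H u → D.H u)) : Set (∀ u, D.H u → D.H u)) ⊆ D.KG ∧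
    ∀ R ∈ D.KG, ∀ ε : ℝ, 0 < ε →
      ∃ S ∈ Submodule.span ℂ {T | ∃ e₁ e₂ : CcSection F E, T = D.avgOp lam e₁ e₂},
        ∀ u (ξ : D.H u), ‖R u ξ - S u ξ‖ ≤ ε * ‖ξ‖ := by
  have := ChartedSpace.locallyCompactSpace (EuclideanSpace ℝ (Fin dG)) G
  have := ChartedSpace.locallyCompactSpace (EuclideanSpace ℝ (Fin dM)) M
  have := ChartedSpace.locallyCompactSpace (EuclideanSpace ℝ (Fin dX)) X
  refine ⟨fun e₁ e₂ => ⟨D.integrable_avgIntegrand hlam hproper e₁ e₂,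
    (D.isNice_avgOp hlam hproper hcompact e₁ e₂).mem_KG⟩,
    fun T hT => (D.isNice_of_mem_span hlam hproper hcompact hT).mem_KG,
    fun R hR ε hε => D.exists_avgOp_near hlam hproper hcompact hR hε⟩
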